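/- **Theorem.** There are an absolute constant $K$ and a single real-RAM program $P$ such that the following holds for all integers $d\ge 2$ and $n\ge q\ge 1$ with $2d\mid q$, and for every homogeneous polynomial $f\in\mathbb R[x_1,\dots,x_n]$ of degree $d$ with non-negative coefficients. Let $C$ be the system of constraints $\{\|x\|_2^2=1\}\cup\{x^\beta\ge 0:\beta\in\mathbb N^n,\ |\beta|=2q/d\}$. Let $\mathrm{hsos}_C(f^{q/d})$ be the supremum of $\widetilde{\mathbb E}[f^{q/d}]$ over all linear functionals $\widetilde{\mathbb E}$ on the real polynomials of degree at most $q$ such that $\widetilde{\mathbb E}[1]=1$, $\widetilde{\mathbb E}[p^2]\ge 0$, $\widetilde{\mathbb E}[p\,(\|x\|_2^2-1)]=0$ and $\widetilde{\mathbb E}[p^2x^\beta]\ge 0$ for $|\beta|=2q/d$, for all polynomials $p$ for which the argument of $\widetilde{\mathbb E}$ has degree at most $q$. Let $\|f\|_2=\sup_{\|x\|_2=1}|f(x)|$. Then such functionals exist, the supremum is finite, and $$\mathrm{hsos}_C\big(f^{q/d}\big)^{d/q}\ \le\ 2^{Kd}\left(\frac nq\right)^{d/4-1/2}\|f\|_2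 .$$ Moreover, given $n$, $d$, $q$ and the coefficients of $f$, the program $P$ stops after at most $n^{Kq}$ steps and outputs a vector $x\in\mathbb R^n$ with $\|x\|_2=1$ and $$\mathrm{hsos}_C\big(f^{q/d}\big)^{d/q}\ \le\ 2^{Kd}\left(\frac nq\right)^{d/4-1/2} f(x).$$ Here a real-RAM program works on a memory of natural numbers (constants, addition, truncated subtraction, comparison, indirect addressing) and a memory of real numbers (conversion from natural numbers, exact $+,-,\times,/,\sqrt{\ }$, comparison), each instruction, test and loop iteration costing one step. The input lists, for all $i_0,\dots,i_{d-1}$, the coefficient of $x_{i_0}\cdots x_{i_{d-1}}$ in $f$. -/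

import Mathlib

/-! ### Sum-of-squares relaxations of polynomial optimization problems -/

namespace SoS

/-- A system of polynomial constraints `{g = 0 : g ∈ eqs} ∪ {g ≥ 0 : g ∈ ineqs}` in the
variables `x i`, `i : σ`. -/
structure ConstraintSystem (σ : Type*) where
  eqs : Set (MvPolynomial σ ℝ)
  ineqs : Set (MvPolynomial σ ℝ)

/-- `E` is a pseudo-expectation operator of degree `ℓ` that respects the constraint system `C`.
Only the values of `E` on polynomials of degree at most `ℓ` are constrained; as every linear
functional on these extends linearly to all polynomials, this is the same as working with
functionals on the polynomials of degree at most `ℓ`. -/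
structure IsPseudoExpectation {σ : Type*} (C : ConstraintSystem σ) (ℓ : ℕ)
    (E : MvPolynomial σ ℝ →ₗ[ℝ] ℝ) : Prop where
  map_one : E 1 = 1
  sq_nonneg : ∀ p : MvPolynomial σ ℝ, (p ^ 2).totalDegree ≤ ℓ → 0 ≤ E (p ^ 2)
  eq_zero : ∀ g ∈ C.eqs, ∀ p : MvPolynomial σ ℝ, (p * g).totalDegree ≤ ℓ → E (p * g) = 0
  ineq_nonneg : ∀ g ∈ C.ineqs, ∀ p : MvPolynomial σ ℝ,
    (p ^ 2 * g).totalDegree ≤ ℓ → 0 ≤ E (p ^ 2 * g)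

/-- All pseudo-expectations of `p`, over the operators of degree `ℓ` that respect `C`. -/
def pseudoValues {σ : Type*} (C : ConstraintSystem σ) (ℓ : ℕ) (p : MvPolynomial σ ℝ) : Set ℝ :=
  {v | ∃ E : MvPolynomial σ ℝ →ₗ[ℝ] ℝ, IsPseudoExpectation C ℓ E ∧ E p = v}

/-- The value of the degree-`ℓ` sum-of-squares relaxation of "maximize `p` subject to `C`". -/
noncomputable def sosValue {σ : Type*} (C : ConstraintSystem σ) (ℓ : ℕ)
    (p : MvPolynomial σ ℝ) : ℝ :=
  sSup (pseudoValues C ℓ p)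

/-- The system `{‖x‖₂² = 1} ∪ {x^β ≥ 0 : |β| = m}` in `n` variables. -/
def sphereMonomialSystem (n m : ℕ) : ConstraintSystem (Fin n) where
  eqs := {(∑ i, MvPolynomial.X i ^ 2) - 1}
  ineqs := {g | ∃ β : Fin n →₀ ℕ, β.degree = m ∧ g = MvPolynomial.monomial β 1}

/-- `‖f‖₂ = sup {|f(x)| : ‖x‖₂ = 1}`. -/
noncomputable def sphereNorm {n : ℕ} (f : MvPolynomial (Fin n) ℝ) : ℝ :=
  ⨆ x : Metric.sphere (0 : EuclideanSpace ℝ (Fin n)) 1,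
    |MvPolynomial.eval (fun i => (x : EuclideanSpace ℝ (Fin n)) i) f|

end SoS

/-! ### A real RAM with a step count -/

namespace RealRAM

/-- A memory of natural numbers, used for counters and addresses, and a memory of real numbers. -/
structure State where
  nat : ℕ → ℕ
  real : ℕ → ℝ

/-- Programs. In the instructions on natural numbers the arguments are addresses of cells of the
natural-number memory. In the instructions on real numbers they are addresses of natural-number
cells that contain the addresses of the real cells to work on. -/
inductive Program : Type
  /-- `nat[r] := k` -/
  | setNat (r k : ℕ)
  /-- `nat[r] := nat[a] + nat[b]` -/
  | addNat (r a b : ℕ)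
  /-- `nat[r] := max (nat[a] - nat[b]) 0` -/
  | subNat (r a b : ℕ)
  /-- `nat[r] := nat[nat[a]]` -/
  | loadNat (r a : ℕ)
  /-- `nat[nat[r]] := nat[a]` -/
  | storeNat (r a : ℕ)
  /-- `real[nat[r]] := nat[a]` -/
  | castReal (r a : ℕ)
  /-- `real[nat[r]] := real[nat[a]] + real[nat[b]]` -/
  | addReal (r a b : ℕ)
  /-- `real[nat[r]] := real[nat[a]] - real[nat[b]]` -/
  | subReal (r a b : ℕ)
  /-- `real[nat[r]] := real[nat[a]] * real[nat[b]]` -/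
  | mulReal (r a b : ℕ)
  /-- `real[nat[r]] := real[nat[a]] / real[nat[b]]` -/
  | divReal (r a b : ℕ)
  /-- `real[nat[r]] := √real[nat[a]]` -/
  | sqrtReal (r a : ℕ)
  /-- run the first program, then the second -/
  | seq (P Q : Program)
  /-- if `nat[a] ≤ nat[b]` then run the first program, else the second -/
  | ifNat (a b : ℕ) (P Q : Program)
  /-- if `real[nat[a]] ≤ real[nat[b]]` then run the first program, else the second -/
  | ifReal (a b : ℕ) (P Q : Program)
  /-- run the program `nat[a]` times, where `nat[a]` is read once, at the start -/
  | loop (a : ℕ) (P : Program)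

/-- Write a natural number into a cell. -/
def State.writeNat (s : State) (r v : ℕ) : State where
  nat := Function.update s.nat r v
  real := s.real

/-- Write a real number into a cell. -/
def State.writeReal (s : State) (r : ℕ) (v : ℝ) : State where
  nat := s.nat
  real := Function.update s.real r v

open Classical in
/-- The state in which a program stops. -/
noncomputable def Program.run : Program → State → State
  | setNat r k, s => s.writeNat r k
  | addNat r a b, s => s.writeNat r (s.nat a + s.nat b)
  | subNat r a b, s => s.writeNat r (s.nat a - s.nat b)
  | loadNat r a, s => s.writeNat r (s.nat (s.nat a))
  | storeNat r a, s => s.writeNat (s.nat r) (s.nat a)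
  | castReal r a, s => s.writeReal (s.nat r) (s.nat a : ℝ)
  | addReal r a b, s => s.writeReal (s.nat r) (s.real (s.nat a) + s.real (s.nat b))
  | subReal r a b, s => s.writeReal (s.nat r) (s.real (s.nat a) - s.real (s.nat b))
  | mulReal r a b, s => s.writeReal (s.nat r) (s.real (s.nat a) * s.real (s.nat b))
  | divReal r a b, s => s.writeReal (s.nat r) (s.real (s.nat a) / s.real (s.nat b))
  | sqrtReal r a, s => s.writeReal (s.nat r) (Real.sqrt (s.real (s.nat a)))
  | seq P Q, s => Q.run (P.run s)
  | ifNat a b P Q, s => if s.nat a ≤ s.nat b then P.run s else Q.run s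
  | ifReal a b P Q, s =>
      if s.real (s.nat a) ≤ s.real (s.nat b) then P.run s else Q.run s
  | loop a P, s => P.run^[s.nat a] s

open Classical in
/-- The number of steps that a program makes: one for every instruction, for every test and for
every pass through the head of a loop. -/
noncomputable def Program.steps : Program → State → ℕ
  | seq P Q, s => P.steps s + Q.steps (P.run s)
  | ifNat a b P Q, s => 1 + if s.nat a ≤ s.nat b then P.steps s else Q.steps s
  | ifReal a b P Q, s =>
      1 + if s.real (s.nat a) ≤ s.real (s.nat b) then P.steps s else Q.steps s
  | loop a P, s => 1 + ∑ i ∈ Finset.range (s.nat a), (1 + P.steps (P.run^[i] s))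
  | _, _ => 1

/-- The initial state for a polynomial `f` of degree `d` in `n` variables and a level `q`.
The cells `0, 1, 2` of the natural-number memory hold `n, d, q`. For `0 ≤ i₀, …, i_{d-1} < n`, the
cell `i₀ + i₁ n + ⋯ + i_{d-1} n^{d-1}` of the real memory holds the coefficient in `f` of the
monomial `x_{i₀} x_{i₁} ⋯ x_{i_{d-1}}`. All other cells hold zero. -/
noncomputable def input {n : ℕ} (d q : ℕ) (f : MvPolynomial (Fin n) ℝ) : State where
  nat := fun a => if a = 0 then n else if a = 1 then d else if a = 2 then q else 0
  real := fun a =>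
    if h : a < n ^ d then
      f.coeff (∑ j : Fin d, Finsupp.single (finFunctionFinEquiv.symm ⟨a, h⟩ j) 1)
    else 0

/-- The vector that stands in the first `n` cells of the real memory. -/
def output (n : ℕ) (s : State) : EuclideanSpace ℝ (Fin n) :=
  WithLp.toLp 2 fun i => s.real i

end RealRAM

/-! ### Rounding pseudo-expectations of powers of forms with non-negative coefficients -/

namespace SoS

open MvPolynomial

/-! Put m = q/d and N = (q - 2m)/2. Each monomial of f is cut into a quadratic part x^J and a part
x^R of degree d - 2, so f^m is a non-negative combination of products x^J x^R with |J| = 2m and |R|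
= 2N.

The main step replaces x^R by squares. Write R = I + K with |I| = |K| = N and entries that differ by
at most one. Then 2 x^(I+K) ≤ x^(2I) + x^(2K), and this survives multiplication by x^J under a
pseudo-expectation E, since x^J ≥ 0 is one of the constraints. Give every exponent vector k of
degree N a weight vector w_k with entries at least √(k_i/q) and at least 1/√n. For k = I and k = K
the number multinomial(k) w_k^R is at least (36 √(n/q))^(-N) (`one_le_multinomial_mul_weight`),
hence E[x^J x^R] ≤ (36 √(n/q))^N ∑_k multinomial(k) w_k^R E[x^(2k) x^J] (`xpow_le_sum`). The right
side depends on R only through w_k^R, which is multiplicative. Summed over the monomials of f^m it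
therefore becomes ∑_k multinomial(k) E[x^(2k) Q_k^m], where Q_k is the quadratic form obtained from
f by substituting w_k into the parts x^R. If L bounds the absolute eigenvalues of all Q_k,
diagonalization, the multinomial theorem and the sphere constraint give E[f^m] ≤ (36 √(n/q))^N L^m
(`IsPseudoExpectation.pow_le`). The m-th root turns √(n/q)^N into (n/q)^(d/4 - 1/2).

It remains to bound L by values of f. The matrices have non-negative entries, so n steps of power
iteration from the all-ones vector bound the eigenvalues up to a factor 2 (`abs_eigenvalue_le`). For
successive iterates y, y' the unit vector along w + y/‖y‖ + y'/‖y'‖ has f-value at least 4^(-d)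
‖y'‖/‖y‖, as no coefficient is negative (`l2norm_mulVec_le`). All weights needed come from the n^q
tuples of q indices, so exhaustive search takes n^O(q) steps; the best test point is the output.

The search is written in a small language of counters and arrays. `Sim.run` and `Sim.steps_le`
transfer its meaning and cost to the RAM, and `search_spec` states its correctness. -/

lemma exists_balanced_split {ι : Type*} [Fintype ι] [DecidableEq ι] (R : ι → ℕ) (N : ℕ)
    (hR : ∑ i, R i = 2 * N) :
    ∃ (h : ι → ℕ) (A B : Finset ι), A.card = B.card ∧ ∑ i, h i + A.card = N ∧
      ∀ i, R i = 2 * h i + (if i ∈ A then 1 else 0) + if i ∈ B then 1 else 0 := by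
  set O : Finset ι := Finset.univ.filter fun i => R i % 2 = 1 with hO
  have hsum : 2 * ∑ i, R i / 2 + O.card = 2 * N := by
    rw [← hR, Finset.mul_sum, hO, Finset.card_filter, ← Finset.sum_add_distrib]
    refine Finset.sum_congr rfl fun i _ => ?_
    split_ifs <;> omega
  -- The total is even, so the set `O` of indices with odd entry has even size; its two halves serve
  -- as `A` and `B`.
  obtain ⟨A, hAO, hA⟩ := Finset.exists_subset_card_eq (show O.card / 2 ≤ O.card by omega)
  have hc := Finset.card_sdiff_add_card_eq_card hAO
  refine ⟨fun i => R i / 2, A, O \ A, by omega, by dsimp only; omega, fun i => ?_⟩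
  by_cases hiO : i ∈ O
  · have : R i % 2 = 1 := by simpa [hO] using hiO
    by_cases hiA : i ∈ A <;> simp only [Finset.mem_sdiff, hiA, hiO] <;> simp <;> omega
  · have h1 : ¬ R i % 2 = 1 := by simpa [hO] using hiO
    have h2 : i ∉ A := fun h => hiO (hAO h)
    simp only [Finset.mem_sdiff, h2, hiO]; simp; omega

lemma pow_self_le_three_pow_mul_factorial (N : ℕ) : (N : ℝ) ^ N ≤ 3 ^ N * N.factorial := by
  have h := Real.pow_div_factorial_le_exp (N : ℝ) (Nat.cast_nonneg N) N
  rw [div_le_iff₀ (by positivity)] at h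
  refine h.trans ?_
  gcongr
  rw [← Real.exp_one_pow]
  exact pow_le_pow_left₀ (Real.exp_pos _).le Real.exp_one_lt_three.le _

/-- Put I = h + 1_A and r = |A| = |B|. The weights give w^R ≥ ∏ (I_i/q)^(h_i) · (q n)^(-r/2), where
1/√n serves the indices in `B`, at which I may vanish. Moreover multinomial(I) ∏ I_i^(h_i) ≥ N!/2^N
≥ (q/36)^N. The product is at least 36^(-N) (q/n)^(r/2), and r ≤ N. In the application q/N =
2d/(d-2), which is at most 6 unless d = 2 and N = 0. -/
lemma one_le_multinomial_mul_weight {n : ℕ} (h : Fin n → ℕ) (A B : Finset (Fin n)) (N q : ℕ)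
    (w : Fin n → ℝ) (hAB : A.card = B.card) (hN : ∑ i, h i + A.card = N) (hq : 0 < q)
    (hqn : q ≤ n) (hNq : N = 0 ∨ q ≤ 6 * N)
    (hw : ∀ i, √(((h i + if i ∈ A then 1 else 0 : ℕ) : ℝ) / q) ≤ w i)
    (hw' : ∀ i, 1 / √(n : ℝ) ≤ w i) :
    1 ≤ (36 * √((n : ℝ) / q)) ^ N *
      (Nat.multinomial Finset.univ (fun i => h i + if i ∈ A then 1 else 0) *
        ∏ i, w i ^ (2 * h i + (if i ∈ A then 1 else 0) + if i ∈ B then 1 else 0)) := by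
  classical
  set I : Fin n → ℕ := fun i => h i + if i ∈ A then 1 else 0 with hI
  have hIN : ∑ i, I i = N := by simp [hI, Finset.sum_add_distrib, hN]
  have hq0 : (0 : ℝ) < q := by exact_mod_cast hq
  have hn0 : (0 : ℝ) < n := by exact_mod_cast hq.trans_le hqn
  have hsq := Real.sqrt_pos.2 hq0
  have hsn := Real.sqrt_pos.2 hn0
  have hw0 : ∀ i, 0 ≤ w i := fun i => (Real.sqrt_nonneg _).trans (hw i)
  set r := A.card with hr
  have hweight : (∏ i, ((I i : ℝ) / q) ^ h i) * (1 / √(q : ℝ)) ^ r * (1 / √(n : ℝ)) ^ r ≤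
      ∏ i, w i ^ (2 * h i + (if i ∈ A then 1 else 0) + if i ∈ B then 1 else 0) := by
    have e1 : (1 / √(q : ℝ)) ^ r = ∏ i, (1 / √(q : ℝ)) ^ (if i ∈ A then 1 else 0) := by
      rw [Finset.prod_pow_eq_pow_sum]; simp [hr]
    have e2 : (1 / √(n : ℝ)) ^ r = ∏ i : Fin n, (1 / √(n : ℝ)) ^ (if i ∈ B then 1 else 0) := by
      rw [Finset.prod_pow_eq_pow_sum, hAB]; simp
    rw [e1, e2, ← Finset.prod_mul_distrib, ← Finset.prod_mul_distrib]
    refine Finset.prod_le_prod (fun i _ => by positivity) fun i _ => ?_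
    rw [pow_add, pow_add, pow_mul]
    have h1 : (I i : ℝ) / q ≤ w i ^ 2 := by
      have := pow_le_pow_left₀ (Real.sqrt_nonneg _) (hw i) 2
      rwa [Real.sq_sqrt (by positivity)] at this
    have h2 : (1 / √(q : ℝ)) ^ (if i ∈ A then 1 else 0) ≤ w i ^ (if i ∈ A then 1 else 0) := by
      by_cases hi : i ∈ A
      · simp only [hi, if_true, pow_one]
        refine le_trans ?_ (hw i)
        rw [one_div, ← Real.sqrt_inv]
        apply Real.sqrt_le_sqrt
        rw [inv_eq_one_div]
        gcongr
        simp [hi]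
      · simp [hi]
    have h3 := pow_le_pow_left₀ (by positivity) (hw' i) (if i ∈ B then 1 else 0)
    have := hw0 i
    gcongr
  have hfact : (N.factorial : ℝ) ≤ Nat.multinomial Finset.univ I * (∏ i, (I i : ℝ) ^ h i) *
      2 ^ N := by
    have h1 := Nat.multinomial_spec Finset.univ I
    rw [hIN] at h1
    -- For i ∈ A the bound I! ≤ I^I has one factor I too many; it is paid for by 2^I.
    have h2 : ∏ i, (I i).factorial ≤ (∏ i, I i ^ h i) * 2 ^ N := by
      rw [← hIN, ← Finset.prod_pow_eq_pow_sum, ← Finset.prod_mul_distrib]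
      refine Finset.prod_le_prod' fun i _ => (Nat.factorial_le_pow (I i)).trans ?_
      have : I i ^ I i = I i ^ h i * I i ^ (if i ∈ A then 1 else 0) := by rw [← pow_add]
      rw [this]
      refine Nat.mul_le_mul_left _ ?_
      split_ifs
      · simpa using Nat.lt_two_pow_self.le
      · simpa using Nat.one_le_two_pow
    have h3 : N.factorial ≤ Nat.multinomial Finset.univ I * ((∏ i, I i ^ h i) * 2 ^ N) := by
      rw [← h1, mul_comm]; gcongr
    rw [mul_assoc]; exact_mod_cast h3
  have hqN : (q : ℝ) ^ N ≤ 6 ^ N * (N : ℝ) ^ N := by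
    rcases hNq with h0 | h6
    · simp [h0]
    · rw [← mul_pow]; exact pow_le_pow_left₀ hq0.le (by exact_mod_cast h6) _
  set mu : ℝ := (Nat.multinomial Finset.univ I : ℝ) * ∏ i, (I i : ℝ) ^ h i with hmu
  -- 36 = 6 · 3 · 2: from q ≤ 6N, from N^N ≤ 3^N N!, and from the factorials.
  have key : (q : ℝ) ^ N ≤ 36 ^ N * mu := by
    calc (q : ℝ) ^ N ≤ 6 ^ N * (N : ℝ) ^ N := hqN
      _ ≤ 6 ^ N * (3 ^ N * N.factorial) := by
        gcongr; exact pow_self_le_three_pow_mul_factorial N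
      _ ≤ 6 ^ N * (3 ^ N * (mu * 2 ^ N)) := by gcongr
      _ = 36 ^ N * mu := by
        rw [show (36 : ℝ) = 6 * 3 * 2 by norm_num, mul_pow, mul_pow]; ring
  have hone : (1 : ℝ) ≤ √((n : ℝ) / q) := by
    rw [Real.one_le_sqrt, one_le_div hq0]; exact_mod_cast hqn
  have hsplit : (∏ i, ((I i : ℝ) / q) ^ h i) =
      (∏ i, (I i : ℝ) ^ h i) / (q : ℝ) ^ (∑ i, h i) := by
    rw [← Finset.prod_pow_eq_pow_sum, ← Finset.prod_div_distrib]
    simp_rw [div_pow]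
  -- As N = ∑ h + r, the powers of q and n cancel up to √(n/q)^(N - r).
  calc (1 : ℝ) ≤ √((n : ℝ) / q) ^ (∑ i, h i) := one_le_pow₀ hone
    _ = (q : ℝ) ^ N * √((n : ℝ) / q) ^ N *
        (1 / (q : ℝ) ^ (∑ i, h i) * (1 / √(q : ℝ)) ^ r * (1 / √(n : ℝ)) ^ r) := by
      rw [← hN, pow_add, pow_add, Real.sqrt_div hn0.le]
      have : (q : ℝ) ^ r = √(q : ℝ) ^ r * √(q : ℝ) ^ r := by
        rw [← mul_pow, Real.mul_self_sqrt hq0.le]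
      rw [this]
      simp only [div_pow, one_pow]
      field_simp
    _ ≤ 36 ^ N * mu * √((n : ℝ) / q) ^ N *
        (1 / (q : ℝ) ^ (∑ i, h i) * (1 / √(q : ℝ)) ^ r * (1 / √(n : ℝ)) ^ r) := by gcongr
    _ = (36 * √((n : ℝ) / q)) ^ N * (Nat.multinomial Finset.univ I *
        ((∏ i, ((I i : ℝ) / q) ^ h i) * (1 / √(q : ℝ)) ^ r * (1 / √(n : ℝ)) ^ r)) := by
      rw [hsplit, hmu, mul_pow]; ring
    _ ≤ _ := by gcongr

end SoS

/-! ### Pseudo-expectations of monomials and of powers of quadratic forms. -/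

namespace SoS

open MvPolynomial

/-- The monomial with exponents `k`. -/
noncomputable def xpow {n : ℕ} (k : Fin n → ℕ) : MvPolynomial (Fin n) ℝ := ∏ i, X i ^ k i

/-- The squared Euclidean norm as a polynomial. -/
noncomputable def normSqPoly (n : ℕ) : MvPolynomial (Fin n) ℝ := ∑ i, X i ^ 2

lemma xpow_add {n : ℕ} (k l : Fin n → ℕ) : xpow (k + l) = xpow k * xpow l := by
  simp [xpow, pow_add, Finset.prod_mul_distrib]

lemma xpow_sum {n : ℕ} {ι : Type*} (s : Finset ι) (k : ι → Fin n → ℕ) :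
    xpow (∑ j ∈ s, k j) = ∏ j ∈ s, xpow (k j) := by
  classical
  induction s using Finset.induction_on with
  | empty => simp [xpow]
  | insert a s ha ih => rw [Finset.sum_insert ha, Finset.prod_insert ha, xpow_add, ih]

lemma isHomogeneous_xpow {n : ℕ} (k : Fin n → ℕ) : (xpow k).IsHomogeneous (∑ i, k i) :=
  IsHomogeneous.prod _ _ _ fun i _ => by simpa using (isHomogeneous_X ℝ i).pow (k i)

lemma isHomogeneous_normSqPoly (n : ℕ) : (normSqPoly n).IsHomogeneous 2 :=
  IsHomogeneous.sum _ _ _ fun i _ => by simpa using (isHomogeneous_X ℝ i).pow 2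

lemma xpow_mem_ineqs {n m : ℕ} {k : Fin n → ℕ} (hk : ∑ i, k i = m) :
    xpow k ∈ (sphereMonomialSystem n m).ineqs := by
  refine ⟨Finsupp.equivFunOnFinite.symm k, ?_, ?_⟩
  · rw [Finsupp.degree_eq_sum]; simpa using hk
  · rw [monomial_eq, Finsupp.prod_fintype _ _ (by simp)]; simp [xpow]

variable {n q : ℕ} {E : MvPolynomial (Fin n) ℝ →ₗ[ℝ] ℝ}

lemma IsPseudoExpectation.xpow_nonneg {N j : ℕ}
    (hE : IsPseudoExpectation (sphereMonomialSystem n j) q E) (hq : 2 * N + j ≤ q)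
    {k J : Fin n → ℕ} (hk : ∑ i, k i = N) (hJ : ∑ i, J i = j) :
    0 ≤ E (xpow k ^ 2 * xpow J) := by
  refine hE.ineq_nonneg _ (xpow_mem_ineqs hJ) _ (le_trans ?_ hq)
  have := ((isHomogeneous_xpow k).pow 2).mul (isHomogeneous_xpow J)
  rw [hk, hJ, mul_comm N] at this
  exact this.totalDegree_le

/-- The AM-GM inequality under E: the constraint x^J ≥ 0 is applied to the square of x^I - x^K. -/
lemma IsPseudoExpectation.xpow_add_le {N j : ℕ}
    (hE : IsPseudoExpectation (sphereMonomialSystem n j) q E) (hq : 2 * N + j ≤ q)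
    {I K J : Fin n → ℕ} (hI : ∑ i, I i = N) (hK : ∑ i, K i = N) (hJ : ∑ i, J i = j) :
    2 * E (xpow J * xpow (I + K)) ≤ E (xpow I ^ 2 * xpow J) + E (xpow K ^ 2 * xpow J) := by
  have h := hE.ineq_nonneg _ (xpow_mem_ineqs hJ) (xpow I - xpow K) (by
    have h1 : (xpow I - xpow K : MvPolynomial (Fin n) ℝ).IsHomogeneous N :=
      IsHomogeneous.sub (hI ▸ isHomogeneous_xpow I) (hK ▸ isHomogeneous_xpow K)
    have := (h1.pow 2).mul (isHomogeneous_xpow J)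
    rw [hJ, mul_comm N] at this
    exact this.totalDegree_le.trans hq)
  have e : (xpow I - xpow K) ^ 2 * xpow J =
      xpow I ^ 2 * xpow J + xpow K ^ 2 * xpow J - (2 : ℝ) • (xpow J * xpow (I + K)) := by
    rw [xpow_add, MvPolynomial.smul_eq_C_mul, map_ofNat]; ring
  rw [e, map_sub, map_add, map_smul, smul_eq_mul] at h
  linarith

lemma IsPseudoExpectation.normSqPoly_pow {j : ℕ}
    (hE : IsPseudoExpectation (sphereMonomialSystem n j) q E) (i : ℕ) (hi : 2 * i ≤ q) :
    E (normSqPoly n ^ i) = 1 := by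
  induction i with
  | zero => simpa using hE.map_one
  | succ i ih =>
    have h := hE.eq_zero (normSqPoly n - 1) rfl (normSqPoly n ^ i) (by
      refine (totalDegree_mul _ _).trans ?_
      have h1 := ((isHomogeneous_normSqPoly n).pow i).totalDegree_le
      have h2 : (normSqPoly n - 1).totalDegree ≤ 2 := by
        refine (totalDegree_sub _ _).trans ?_
        simpa using (isHomogeneous_normSqPoly n).totalDegree_le
      omega)
    rw [mul_sub, mul_one, ← pow_succ, map_sub, ih (by omega)] at h
    linarith

/-- The second identity is completeness of the eigenbasis. Together with the first it writes the
quadratic form and ‖x‖² in the same squares. -/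
lemma exists_spectral_decomposition (M : Matrix (Fin n) (Fin n) ℝ) (hM : M.IsHermitian) :
    ∃ (l : Fin n → Fin n → ℝ) (μ : Fin n → ℝ),
      (∀ a b, ∑ j, μ j * (l j a * l j b) = M a b) ∧
      (∀ a b, ∑ j, l j a * l j b = if a = b then 1 else 0) ∧
      ∀ j, M.mulVec (l j) = μ j • l j ∧ l j ≠ 0 := by
  refine ⟨fun j a => hM.eigenvectorBasis j a, hM.eigenvalues, fun a b => ?_, fun a b => ?_,
    fun j => ⟨hM.mulVec_eigenvectorBasis j, fun h => ?_⟩⟩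
  · have h := congrFun (congrFun hM.spectral_theorem a) b
    rw [Unitary.conjStarAlgAut_apply, Matrix.mul_apply] at h
    rw [h]
    refine Finset.sum_congr rfl fun j _ => ?_
    rw [Matrix.mul_diagonal]
    simp [Matrix.star_apply, Matrix.IsHermitian.eigenvectorUnitary_apply]
    ring
  · have h : (hM.eigenvectorUnitary : Matrix (Fin n) (Fin n) ℝ) *
        star (hM.eigenvectorUnitary : Matrix (Fin n) (Fin n) ℝ) = 1 := by simp
    have h := congrFun (congrFun h a) b
    rw [Matrix.mul_apply, Matrix.one_apply] at h
    rw [← h]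
    refine Finset.sum_congr rfl fun j _ => ?_
    simp [Matrix.star_apply, Matrix.IsHermitian.eigenvectorUnitary_apply]
  · apply hM.eigenvectorBasis.orthonormal.ne_zero j
    ext a
    exact congrFun h a

/-- The quadratic form of a matrix as a polynomial. -/
noncomputable def quadPoly (M : Matrix (Fin n) (Fin n) ℝ) : MvPolynomial (Fin n) ℝ :=
  ∑ a, ∑ b, C (M a b) * (X a * X b)

/-- In an orthonormal eigenbasis the form is ∑ μ_j P_j² and ‖x‖² is ∑ P_j². After expansion of the
m-th powers both sides are combinations of the same non-negative numbers E[x^(2k) ∏ P²], with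
coefficients ∏ μ ≤ L^m and L^m. Only positivity on squares enters. -/
lemma IsPseudoExpectation.quadPoly_pow_le {N m j : ℕ}
    (hE : IsPseudoExpectation (sphereMonomialSystem n j) q E) (hq : 2 * N + 2 * m ≤ q)
    {k : Fin n → ℕ} (hk : ∑ i, k i = N) {M : Matrix (Fin n) (Fin n) ℝ} (hM : M.IsHermitian)
    {L : ℝ} (hL : ∀ (c : ℝ) (v : Fin n → ℝ), M.mulVec v = c • v → v ≠ 0 → |c| ≤ L) :
    E (xpow k ^ 2 * quadPoly M ^ m) ≤ L ^ m * E (xpow k ^ 2 * normSqPoly n ^ m) := by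
  obtain ⟨l, μ, h1, h2, h3⟩ := exists_spectral_decomposition M hM
  set P : Fin n → MvPolynomial (Fin n) ℝ := fun j => ∑ a, C (l j a) * X a with hP
  have hPh : ∀ j, (P j).IsHomogeneous 1 := fun j =>
    IsHomogeneous.sum _ _ _ fun a _ => by
      simpa using (isHomogeneous_C (Fin n) (l j a)).mul (isHomogeneous_X ℝ a)
  have hsq : ∀ j, P j ^ 2 = ∑ a, ∑ b, C (l j a * l j b) * (X a * X b) := fun j => by
    rw [hP, sq, Finset.sum_mul_sum]
    refine Finset.sum_congr rfl fun a _ => Finset.sum_congr rfl fun b _ => ?_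
    rw [C_mul]; ring
  have hQ : quadPoly M = ∑ j, C (μ j) * P j ^ 2 := by
    simp_rw [hsq, Finset.mul_sum, quadPoly, ← h1, map_sum, Finset.sum_mul]
    rw [Finset.sum_comm' (s := Finset.univ) (t := fun _ => Finset.univ) (t' := Finset.univ)
      (s' := fun _ => Finset.univ) (by simp)]
    conv_rhs => rw [Finset.sum_comm]
    rw [Finset.sum_comm]
    refine Finset.sum_congr rfl fun a _ => ?_
    conv_rhs => rw [Finset.sum_comm]
    refine Finset.sum_congr rfl fun b _ => Finset.sum_congr rfl fun j _ => ?_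
    rw [C_mul]; ring
  have hS : normSqPoly n = ∑ j, P j ^ 2 := by
    simp_rw [hsq]
    rw [Finset.sum_comm, normSqPoly]
    refine Finset.sum_congr rfl fun a _ => ?_
    rw [Finset.sum_comm]
    simp_rw [← Finset.sum_mul, ← map_sum, h2]
    simp [sq]
  have hterm : ∀ τ : Fin m → Fin n, 0 ≤ E (xpow k ^ 2 * ∏ s, P (τ s) ^ 2) := fun τ => by
    rw [Finset.prod_pow, ← mul_pow]
    refine hE.sq_nonneg _ ?_
    have := ((isHomogeneous_xpow k).mul
      (IsHomogeneous.prod Finset.univ _ _ fun s _ => hPh (τ s))).pow 2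
    refine this.totalDegree_le.trans ?_
    simp [hk]; omega
  have e1 : E (xpow k ^ 2 * quadPoly M ^ m) =
      ∑ τ : Fin m → Fin n, (∏ s, μ (τ s)) * E (xpow k ^ 2 * ∏ s, P (τ s) ^ 2) := by
    rw [hQ, Fintype.sum_pow, Finset.mul_sum, map_sum]
    refine Finset.sum_congr rfl fun τ _ => ?_
    rw [Finset.prod_mul_distrib, ← map_prod, mul_left_comm, ← smul_eq_C_mul, map_smul,
      smul_eq_mul]
  have e2 : E (xpow k ^ 2 * normSqPoly n ^ m) =
      ∑ τ : Fin m → Fin n, E (xpow k ^ 2 * ∏ s, P (τ s) ^ 2) := by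
    rw [hS, Fintype.sum_pow, Finset.mul_sum, map_sum]
  rw [e1, e2, Finset.mul_sum]
  refine Finset.sum_le_sum fun τ _ => mul_le_mul_of_nonneg_right ?_ (hterm τ)
  refine (le_abs_self _).trans ?_
  rw [Finset.abs_prod]
  refine (Finset.prod_le_prod (fun _ _ => abs_nonneg _)
    fun s _ => hL _ _ (h3 (τ s)).1 (h3 (τ s)).2).trans ?_
  simp

/-- Only the terms k = I and k = K of a balanced splitting R = I + K matter; the others are
non-negative. They are kept so that the right side depends on R through w_k^R alone. -/
lemma IsPseudoExpectation.xpow_le_sum {N m : ℕ}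
    (hE : IsPseudoExpectation (sphereMonomialSystem n (2 * m)) q E) (hNm : 2 * N + 2 * m = q)
    (hq : 0 < q) (hqn : q ≤ n) (hNq : N = 0 ∨ q ≤ 6 * N) (w : (Fin n → ℕ) → Fin n → ℝ)
    (hw : ∀ k ∈ Finset.piAntidiag Finset.univ N, ∀ i, √((k i : ℝ) / q) ≤ w k i)
    (hw' : ∀ k ∈ Finset.piAntidiag Finset.univ N, ∀ i, 1 / √(n : ℝ) ≤ w k i)
    {J R : Fin n → ℕ} (hJ : ∑ i, J i = 2 * m) (hR : ∑ i, R i = 2 * N) :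
    E (xpow J * xpow R) ≤ (36 * √((n : ℝ) / q)) ^ N *
      ∑ k ∈ Finset.piAntidiag Finset.univ N, Nat.multinomial Finset.univ k *
        ((∏ i, w k i ^ R i) * E (xpow k ^ 2 * xpow J)) := by
  set S := ∑ k ∈ Finset.piAntidiag Finset.univ N, (Nat.multinomial Finset.univ k : ℝ) *
        ((∏ i, w k i ^ R i) * E (xpow k ^ 2 * xpow J)) with hS
  have hn0 : (0 : ℝ) ≤ 1 / √(n : ℝ) := by positivity
  have hsingle : ∀ (h : Fin n → ℕ) (A B : Finset (Fin n)), A.card = B.card →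
      ∑ i, h i + A.card = N →
      (∀ i, R i = 2 * h i + (if i ∈ A then 1 else 0) + if i ∈ B then 1 else 0) →
      E (xpow (fun i => h i + if i ∈ A then 1 else 0) ^ 2 * xpow J) ≤
        (36 * √((n : ℝ) / q)) ^ N * S := by
    intro h A B hAB hhA hRi
    set I : Fin n → ℕ := fun i => h i + if i ∈ A then 1 else 0 with hI
    have hIN : ∑ i, I i = N := by simp [hI, Finset.sum_add_distrib, hhA]
    have hmem : I ∈ Finset.piAntidiag Finset.univ N := by simp [hIN]
    have h0 := hE.xpow_nonneg hNm.le hIN hJ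
    have h1 := one_le_multinomial_mul_weight h A B N q (w I) hAB hhA hq hqn hNq (hw I hmem)
      (hw' I hmem)
    have h2 : (Nat.multinomial Finset.univ I : ℝ) *
        ((∏ i, w I i ^ R i) * E (xpow I ^ 2 * xpow J)) ≤ S :=
      Finset.single_le_sum (f := fun k => (Nat.multinomial Finset.univ k : ℝ) *
        ((∏ i, w k i ^ R i) * E (xpow k ^ 2 * xpow J))) (fun k hk => by
          have h3 := hE.xpow_nonneg hNm.le (k := k) (by simpa using hk) hJ
          have h4 : 0 ≤ ∏ i, w k i ^ R i :=
            Finset.prod_nonneg fun i _ => pow_nonneg (hn0.trans (hw' k hk i)) _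
          positivity) hmem
    calc E (xpow I ^ 2 * xpow J) ≤ _ := le_mul_of_one_le_left h0 h1
      _ = (36 * √((n : ℝ) / q)) ^ N * ((Nat.multinomial Finset.univ I : ℝ) *
        ((∏ i, w I i ^ R i) * E (xpow I ^ 2 * xpow J))) := by
          simp_rw [hRi]; ring
      _ ≤ _ := by gcongr
  obtain ⟨h, A, B, hAB, hhA, hRi⟩ := exists_balanced_split R N hR
  -- The splitting is symmetric in `A` and `B`, so both squares in AM-GM obey the same bound.
  have h1 := hsingle h A B hAB hhA hRi
  have h2 := hsingle h B A hAB.symm (hAB ▸ hhA) fun i => by rw [hRi i]; ring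
  have h3 := hE.xpow_add_le hNm.le (I := fun i => h i + if i ∈ A then 1 else 0)
    (K := fun i => h i + if i ∈ B then 1 else 0) (by simp [Finset.sum_add_distrib, hhA])
    (by simp [Finset.sum_add_distrib, ← hAB, hhA]) hJ
  have h4 : R = (fun i => h i + if i ∈ A then 1 else 0) +
      fun i => h i + if i ∈ B then 1 else 0 := by
    ext i; rw [hRi i, Pi.add_apply]; ring
  rw [h4]
  linarith

theorem IsPseudoExpectation.pow_le {N m : ℕ}
    (hE : IsPseudoExpectation (sphereMonomialSystem n (2 * m)) q E) (hNm : 2 * N + 2 * m = q)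
    (hq : 0 < q) (hqn : q ≤ n) (hNq : N = 0 ∨ q ≤ 6 * N) {ι : Type*} [Fintype ι]
    (c : ι → ℝ) (hc : ∀ a, 0 ≤ c a) (J R : ι → Fin n → ℕ) (r : ℕ) (hJ : ∀ a, ∑ i, J a i = 2)
    (hR : ∀ a, ∑ i, R a i = r) (hr : m * r = 2 * N)
    (w : (Fin n → ℕ) → Fin n → ℝ)
    (hw : ∀ k ∈ Finset.piAntidiag Finset.univ N, ∀ i, √((k i : ℝ) / q) ≤ w k i)
    (hw' : ∀ k ∈ Finset.piAntidiag Finset.univ N, ∀ i, 1 / √(n : ℝ) ≤ w k i)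
    (M : (Fin n → ℕ) → Matrix (Fin n) (Fin n) ℝ) (hM : ∀ k, (M k).IsHermitian)
    (hMQ : ∀ k, quadPoly (M k) = ∑ a, C (c a * ∏ i, w k i ^ R a i) * xpow (J a)) {L : ℝ}
    (hL : ∀ k ∈ Finset.piAntidiag Finset.univ N, ∀ (x : ℝ) (v : Fin n → ℝ),
      (M k).mulVec v = x • v → v ≠ 0 → |x| ≤ L) :
    E ((∑ a, C (c a) * (xpow (J a) * xpow (R a))) ^ m) ≤ (36 * √((n : ℝ) / q)) ^ N * L ^ m := by
  set K : ℝ := (36 * √((n : ℝ) / q)) ^ N with hK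
  have hK0 : 0 ≤ K := by positivity
  have hJt : ∀ τ : Fin m → ι, ∑ i, (∑ s, J (τ s)) i = 2 * m := fun τ => by
    simp_rw [Finset.sum_apply]
    rw [Finset.sum_comm]; simp [hJ, mul_comm]
  have hRt : ∀ τ : Fin m → ι, ∑ i, (∑ s, R (τ s)) i = 2 * N := fun τ => by
    simp_rw [Finset.sum_apply]
    rw [Finset.sum_comm]; simp [hR, hr]
  calc E ((∑ a, C (c a) * (xpow (J a) * xpow (R a))) ^ m)
      = ∑ τ : Fin m → ι, (∏ s, c (τ s)) * E (xpow (∑ s, J (τ s)) * xpow (∑ s, R (τ s))) := by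
        rw [Fintype.sum_pow, map_sum]
        refine Finset.sum_congr rfl fun τ _ => ?_
        rw [Finset.prod_mul_distrib, Finset.prod_mul_distrib, ← map_prod, ← xpow_sum,
          ← xpow_sum, ← smul_eq_C_mul, map_smul, smul_eq_mul]
    _ ≤ ∑ τ : Fin m → ι, (∏ s, c (τ s)) * (K *
        ∑ k ∈ Finset.piAntidiag Finset.univ N, Nat.multinomial Finset.univ k *
          ((∏ i, w k i ^ (∑ s, R (τ s)) i) * E (xpow k ^ 2 * xpow (∑ s, J (τ s))))) := by
        refine Finset.sum_le_sum fun τ _ => mul_le_mul_of_nonneg_left ?_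
          (Finset.prod_nonneg fun s _ => hc _)
        exact hE.xpow_le_sum hNm hq hqn hNq w hw hw' (hJt τ) (hRt τ)
    -- With k fixed, multiplicativity of w_k^R folds the sum over τ back into an m-th power.
    _ = K * ∑ k ∈ Finset.piAntidiag Finset.univ N, Nat.multinomial Finset.univ k *
          E (xpow k ^ 2 * quadPoly (M k) ^ m) := by
        simp_rw [Finset.mul_sum]
        rw [Finset.sum_comm]
        refine Finset.sum_congr rfl fun k _ => ?_
        rw [hMQ, Fintype.sum_pow, Finset.mul_sum, map_sum, Finset.mul_sum, Finset.mul_sum]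
        refine Finset.sum_congr rfl fun τ _ => ?_
        have e1 : ∏ i, w k i ^ (∑ s, R (τ s)) i = ∏ s, ∏ i, w k i ^ R (τ s) i := by
          rw [Finset.prod_comm]
          refine Finset.prod_congr rfl fun i _ => ?_
          rw [Finset.prod_pow_eq_pow_sum, Finset.sum_apply]
        have e2 : xpow k ^ 2 * ∏ s, C (c (τ s) * ∏ i, w k i ^ R (τ s) i) * xpow (J (τ s)) =
            ((∏ s, c (τ s)) * ∏ s, ∏ i, w k i ^ R (τ s) i) •
              (xpow k ^ 2 * xpow (∑ s, J (τ s))) := by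
          rw [Finset.prod_mul_distrib, ← map_prod, Finset.prod_mul_distrib, xpow_sum,
            smul_eq_C_mul]
          ring
        rw [e1, e2, map_smul, smul_eq_mul]
        ring
    _ ≤ K * ∑ k ∈ Finset.piAntidiag Finset.univ N, Nat.multinomial Finset.univ k *
          (L ^ m * E (xpow k ^ 2 * normSqPoly n ^ m)) := by
        refine mul_le_mul_of_nonneg_left (Finset.sum_le_sum fun k hk => ?_) hK0
        refine mul_le_mul_of_nonneg_left ?_ (Nat.cast_nonneg _)
        exact hE.quadPoly_pow_le hNm.le (by simpa using hk) (hM k) (hL k hk)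
    -- By the multinomial theorem the weighted squares x^(2k) add up to ‖x‖^(2N).
    _ = K * L ^ m * E (normSqPoly n ^ (N + m)) := by
        rw [pow_add]
        conv_rhs => rw [normSqPoly, Finset.sum_pow_eq_sum_piAntidiag, ← normSqPoly,
          Finset.sum_mul, map_sum]
        rw [Finset.mul_sum, Finset.mul_sum]
        refine Finset.sum_congr rfl fun k _ => ?_
        have : (Nat.multinomial Finset.univ k : MvPolynomial (Fin n) ℝ) *
            (∏ i, (X i ^ 2) ^ k i) * normSqPoly n ^ m =
            (Nat.multinomial Finset.univ k : ℝ) • (xpow k ^ 2 * normSqPoly n ^ m) := by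
          rw [smul_eq_C_mul, map_natCast, xpow, ← Finset.prod_pow, mul_assoc]
          simp_rw [← pow_mul, mul_comm]
        rw [this, map_smul, smul_eq_mul]
        ring
    _ = K * L ^ m := by rw [hE.normSqPoly_pow _ (by omega), mul_one]

end SoS

/-! ### Power iteration for matrices with non-negative entries -/

namespace SoS

open MvPolynomial

/-- The Euclidean norm of a vector of coordinates. -/
noncomputable def l2norm {n : ℕ} (v : Fin n → ℝ) : ℝ := √(∑ i, v i ^ 2)

lemma l2norm_nonneg {n : ℕ} (v : Fin n → ℝ) : 0 ≤ l2norm v := Real.sqrt_nonneg _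

lemma l2norm_sq {n : ℕ} (v : Fin n → ℝ) : l2norm v ^ 2 = ∑ i, v i ^ 2 :=
  Real.sq_sqrt (Finset.sum_nonneg fun _ _ => sq_nonneg _)

lemma abs_le_l2norm {n : ℕ} (v : Fin n → ℝ) (i : Fin n) : |v i| ≤ l2norm v :=
  Real.abs_le_sqrt (Finset.single_le_sum (f := fun i => v i ^ 2) (fun _ _ => sq_nonneg _)
    (Finset.mem_univ i))

lemma eq_zero_of_l2norm_eq_zero {n : ℕ} {v : Fin n → ℝ} (h : l2norm v = 0) (i : Fin n) :
    v i = 0 :=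
  abs_eq_zero.1 (le_antisymm (h ▸ abs_le_l2norm v i) (abs_nonneg _))

/-- An inequality only, because the zero vector divided by its norm is zero. -/
lemma l2norm_div_self_sq_le {n : ℕ} (v : Fin n → ℝ) : ∑ i, (v i / l2norm v) ^ 2 ≤ 1 := by
  simp_rw [div_pow]
  rw [← Finset.sum_div, ← l2norm_sq]
  exact div_self_le_one _

lemma l2norm_div_self {n : ℕ} {v : Fin n → ℝ} (h : 0 < l2norm v) :
    ∑ i, (v i / l2norm v) ^ 2 = 1 := by
  simp_rw [div_pow]
  rw [← Finset.sum_div, ← l2norm_sq]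
  exact div_self (by positivity)

variable {n : ℕ}

/-- The iterates of a matrix, started at the all-ones vector. -/
noncomputable def powerIterate (M : Matrix (Fin n) (Fin n) ℝ) (t : ℕ) : Fin n → ℝ :=
  M.mulVec^[t] 1

lemma powerIterate_succ (M : Matrix (Fin n) (Fin n) ℝ) (t : ℕ) :
    powerIterate M (t + 1) = M.mulVec (powerIterate M t) :=
  Function.iterate_succ_apply' _ _ _

lemma mulVec_nonneg {M : Matrix (Fin n) (Fin n) ℝ} (hM : ∀ a b, 0 ≤ M a b) {y : Fin n → ℝ}
    (hy : ∀ i, 0 ≤ y i) (i : Fin n) : 0 ≤ M.mulVec y i := by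
  rw [Matrix.mulVec, dotProduct]
  exact Finset.sum_nonneg fun b _ => mul_nonneg (hM i b) (hy b)

lemma powerIterate_nonneg {M : Matrix (Fin n) (Fin n) ℝ} (hM : ∀ a b, 0 ≤ M a b) (t : ℕ)
    (i : Fin n) : 0 ≤ powerIterate M t i := by
  induction t generalizing i with
  | zero => simp [powerIterate]
  | succ t ih =>
    rw [powerIterate_succ]
    exact mulVec_nonneg hM ih i

/-- Non-negative entries give |x|^t |v_i| ≤ ‖v‖ (M^t 1)_i by induction, starting from |v_i| ≤ ‖v‖.
At t = n this yields |x|^n ≤ ‖M^n 1‖ ≤ β^n √n, and √n ≤ 2^n. The hypothesis bounds every single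
ratio because each ratio belongs to one test point. -/
lemma abs_eigenvalue_le {M : Matrix (Fin n) (Fin n) ℝ} (hM : ∀ a b, 0 ≤ M a b) {β : ℝ}
    (hβ : 0 ≤ β)
    (h : ∀ t < n, l2norm (powerIterate M (t + 1)) ≤ β * l2norm (powerIterate M t))
    {x : ℝ} {v : Fin n → ℝ} (hv : M.mulVec v = x • v) (hv0 : v ≠ 0) : |x| ≤ 2 * β := by
  have hs : 0 < l2norm v := by
    refine lt_of_le_of_ne (l2norm_nonneg v) fun h => hv0 ?_
    ext i
    exact eq_zero_of_l2norm_eq_zero h.symm i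
  have hn : n ≠ 0 := by
    rintro rfl
    exact hv0 (Subsingleton.elim _ _)
  have hlow : ∀ (t : ℕ) (i : Fin n), |x| ^ t * |v i| ≤ l2norm v * powerIterate M t i := by
    intro t
    induction t with
    | zero => intro i; simpa [powerIterate] using abs_le_l2norm v i
    | succ t ih =>
      intro i
      have e : |x| * |v i| ≤ ∑ b, M i b * |v b| := by
        have := congrFun hv i
        rw [← abs_mul, ← smul_eq_mul, ← Pi.smul_apply, ← this, Matrix.mulVec, dotProduct]
        refine (Finset.abs_sum_le_sum_abs _ _).trans (le_of_eq ?_)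
        refine Finset.sum_congr rfl fun b _ => ?_
        rw [abs_mul, abs_of_nonneg (hM i b)]
      calc |x| ^ (t + 1) * |v i| = |x| ^ t * (|x| * |v i|) := by ring
        _ ≤ |x| ^ t * ∑ b, M i b * |v b| := by gcongr
        _ = ∑ b, M i b * (|x| ^ t * |v b|) := by
          rw [Finset.mul_sum]; exact Finset.sum_congr rfl fun b _ => by ring
        _ ≤ ∑ b, M i b * (l2norm v * powerIterate M t b) :=
          Finset.sum_le_sum fun b _ => mul_le_mul_of_nonneg_left (ih b) (hM i b)
        _ = l2norm v * powerIterate M (t + 1) i := by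
          rw [powerIterate_succ, Matrix.mulVec, dotProduct, Finset.mul_sum]
          exact Finset.sum_congr rfl fun b _ => by ring
  have hup : ∀ t ≤ n, l2norm (powerIterate M t) ≤ β ^ t * √n := by
    intro t
    induction t with
    | zero => intro _; simp [powerIterate, l2norm]
    | succ t ih =>
      intro ht
      calc _ ≤ β * l2norm (powerIterate M t) := h t ht
        _ ≤ β * (β ^ t * √n) := by gcongr; exact ih (by omega)
        _ = _ := by ring
  have hxn : |x| ^ n ≤ l2norm (powerIterate M n) := by
    refine Real.le_sqrt_of_sq_le ?_
    have h1 : (|x| ^ n) ^ 2 * l2norm v ^ 2 ≤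
        (∑ i, powerIterate M n i ^ 2) * l2norm v ^ 2 := by
      rw [l2norm_sq v, Finset.mul_sum, ← l2norm_sq v, Finset.sum_mul]
      refine Finset.sum_le_sum fun i _ => ?_
      have := pow_le_pow_left₀ (by positivity) (hlow n i) 2
      rw [mul_pow, mul_pow, sq_abs (v i)] at this
      linarith
    exact le_of_mul_le_mul_right h1 (by positivity)
  have h2n : √(n : ℝ) ≤ 2 ^ n := by
    rw [Real.sqrt_le_left (by positivity)]
    have h1 : (n : ℝ) ≤ 2 ^ n := by exact_mod_cast Nat.lt_two_pow_self.le
    have h2 : (1 : ℝ) ≤ 2 ^ n := one_le_pow₀ (by norm_num)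
    nlinarith
  have : |x| ^ n ≤ (2 * β) ^ n := by
    calc |x| ^ n ≤ β ^ n * √n := hxn.trans (hup n le_rfl)
      _ ≤ β ^ n * 2 ^ n := by gcongr
      _ = (2 * β) ^ n := by rw [mul_pow]; ring
  exact le_of_pow_le_pow_left₀ hn (by positivity) this

/-- The symmetric matrix of the quadratic form `∑ e, 2 * P e * x (i₀ e) * x (i₁ e)`. -/
noncomputable def edgeMatrix {ι : Type*} [Fintype ι] (P : ι → ℝ) (i₀ i₁ : ι → Fin n) :
    Matrix (Fin n) (Fin n) ℝ := fun a b =>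
  ∑ e, P e * ((if i₀ e = a ∧ i₁ e = b then 1 else 0) + if i₁ e = a ∧ i₀ e = b then 1 else 0)

section edgeMatrix

variable {ι : Type*} [Fintype ι] (P : ι → ℝ) (i₀ i₁ : ι → Fin n)

lemma edgeMatrix_isHermitian : (edgeMatrix P i₀ i₁).IsHermitian := by
  ext a b
  simp only [edgeMatrix, Matrix.conjTranspose_apply, star_trivial]
  refine Finset.sum_congr rfl fun e _ => ?_
  rw [add_comm]
  simp only [and_comm]

lemma edgeMatrix_nonneg (hP : ∀ e, 0 ≤ P e) (a b : Fin n) : 0 ≤ edgeMatrix P i₀ i₁ a b :=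
  Finset.sum_nonneg fun e _ => mul_nonneg (hP e) (by positivity)

lemma edgeMatrix_mulVec (y : Fin n → ℝ) (i : Fin n) :
    (edgeMatrix P i₀ i₁).mulVec y i =
      ∑ e, ((if i₀ e = i then P e * y (i₁ e) else 0) + if i₁ e = i then P e * y (i₀ e) else 0) := by
  simp only [Matrix.mulVec, dotProduct, edgeMatrix, Finset.sum_mul]
  rw [Finset.sum_comm]
  refine Finset.sum_congr rfl fun e _ => ?_
  simp only [mul_add, add_mul, Finset.sum_add_distrib, ite_and]
  congr 1 <;> split_ifs <;> simp

lemma dotProduct_edgeMatrix_mulVec (y z : Fin n → ℝ) :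
    ∑ i, z i * (edgeMatrix P i₀ i₁).mulVec y i =
      ∑ e, P e * (y (i₁ e) * z (i₀ e) + y (i₀ e) * z (i₁ e)) := by
  simp_rw [edgeMatrix_mulVec, Finset.mul_sum]
  rw [Finset.sum_comm]
  refine Finset.sum_congr rfl fun e _ => ?_
  simp only [mul_add, Finset.sum_add_distrib, mul_ite, mul_zero]
  simp
  ring

lemma quadPoly_half_edgeMatrix :
    quadPoly ((1 / 2 : ℝ) • edgeMatrix P i₀ i₁) = ∑ e, C (P e) * (X (i₀ e) * X (i₁ e)) := by
  have h : ∀ a b, C (((1 / 2 : ℝ) • edgeMatrix P i₀ i₁) a b) * (X a * X b : MvPolynomial (Fin n) ℝ)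
      = ∑ e, C (P e / 2) * ((if i₀ e = a then if i₁ e = b then X a * X b else 0 else 0) +
        if i₁ e = a then if i₀ e = b then X a * X b else 0 else 0) := fun a b => by
    simp only [Matrix.smul_apply, edgeMatrix, smul_eq_mul, Finset.mul_sum, map_sum, Finset.sum_mul]
    refine Finset.sum_congr rfl fun e _ => ?_
    rw [show 1 / 2 * (P e * ((if i₀ e = a ∧ i₁ e = b then (1 : ℝ) else 0) +
      if i₁ e = a ∧ i₀ e = b then 1 else 0)) = P e / 2 *
      ((if i₀ e = a ∧ i₁ e = b then 1 else 0) + if i₁ e = a ∧ i₀ e = b then 1 else 0) by ring,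
      C_mul, C_add]
    simp only [ite_and]
    rw [mul_assoc, add_mul]
    congr 2 <;> split_ifs <;> simp
  simp_rw [quadPoly, h]
  have h2 : ∀ a, ∑ b, ∑ e, C (P e / 2) *
      ((if i₀ e = a then if i₁ e = b then X a * X b else 0 else 0) +
        if i₁ e = a then if i₀ e = b then X a * X b else 0 else 0) =
      ∑ e, C (P e / 2) * ((if i₀ e = a then X a * X (i₁ e) else 0) +
        if i₁ e = a then X a * X (i₀ e) else (0 : MvPolynomial (Fin n) ℝ)) := fun a => by
    rw [Finset.sum_comm]
    refine Finset.sum_congr rfl fun e _ => ?_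
    rw [← Finset.mul_sum, Finset.sum_add_distrib]
    congr 2 <;> split_ifs <;> simp
  simp_rw [h2]
  rw [Finset.sum_comm]
  refine Finset.sum_congr rfl fun e _ => ?_
  rw [← Finset.mul_sum, Finset.sum_add_distrib]
  simp only [Finset.sum_ite_eq, Finset.mem_univ, if_true]
  rw [mul_comm (X (i₁ e)) (X (i₀ e)), ← two_mul, ← mul_assoc]
  congr 1
  rw [show (2 : MvPolynomial (Fin n) ℝ) = C 2 from (map_ofNat C 2).symm, ← C_mul]
  congr 1
  ring

end edgeMatrix

/-- The point that is tested for a weight vector `w` and successive iterates `y`, `y'`. -/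
noncomputable def candidateSum (w y y' : Fin n → ℝ) (i : Fin n) : ℝ :=
  w i + y i / l2norm y + y' i / l2norm y'

/-- The normalized test point. -/
noncomputable def candidate (w y y' : Fin n → ℝ) (i : Fin n) : ℝ :=
  candidateSum w y y' i / l2norm (candidateSum w y y')

/-- The weight keeps the sum away from zero even if both iterates vanish. -/
lemma sum_sq_candidate (w y y' : Fin n → ℝ) (hw : ∃ i, 0 < w i) (hy : ∀ i, 0 ≤ y i)
    (hy' : ∀ i, 0 ≤ y' i) : ∑ i, candidate w y y' i ^ 2 = 1 := by
  refine l2norm_div_self ?_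
  obtain ⟨i, hi⟩ := hw
  refine lt_of_lt_of_le ?_ (abs_le_l2norm _ i)
  refine lt_of_lt_of_le ?_ (le_abs_self _)
  have h1 := div_nonneg (hy i) (l2norm_nonneg y)
  have h2 := div_nonneg (hy' i) (l2norm_nonneg y')
  unfold candidateSum
  linarith

/-- For the normalized iterates u, u' the ratio ‖y'‖/‖y‖ equals ⟨u', M u⟩. At z = w + u + u' the
product of the two head variables contains both cross terms of u and u', and the remaining variables
are at least w; as c ≥ 0, the ratio is at most the value at z. Normalizing z, with ‖z‖ ≤ 4, costs
4^(r+2) by homogeneity. -/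
lemma l2norm_mulVec_le {ι : Type*} [Fintype ι] (c : ι → ℝ) (hc : ∀ e, 0 ≤ c e)
    (i₀ i₁ : ι → Fin n) (R : ι → Fin n → ℕ) {r : ℕ} (hR : ∀ e, ∑ i, R e i = r)
    {w y : Fin n → ℝ} (hw : ∀ i, 0 < w i) (hw4 : ∑ i, w i ^ 2 ≤ 4) (hy : ∀ i, 0 ≤ y i)
    {y' : Fin n → ℝ}
    (hy' : y' = (edgeMatrix (fun e => c e * ∏ i, w i ^ R e i) i₀ i₁).mulVec y) :
    l2norm y' ≤ 4 ^ (r + 2) * (∑ e, c e * (candidate w y y' (i₀ e) * candidate w y y' (i₁ e) *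
      ∏ i, candidate w y y' i ^ R e i)) * l2norm y := by
  set P : ι → ℝ := fun e => c e * ∏ i, w i ^ R e i with hP
  have hP0 : ∀ e, 0 ≤ P e := fun e =>
    mul_nonneg (hc e) (Finset.prod_nonneg fun i _ => pow_nonneg (hw i).le _)
  have hy'0 : ∀ i, 0 ≤ y' i := fun i => by
    rw [hy']
    exact mulVec_nonneg (edgeMatrix_nonneg P i₀ i₁ hP0) hy i
  rcases (l2norm_nonneg y).eq_or_lt with h0 | hypos
  · have : y = 0 := by ext i; exact eq_zero_of_l2norm_eq_zero h0.symm i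
    rw [hy', ← h0, this]
    simp [l2norm]
  set u : Fin n → ℝ := fun i => y i / l2norm y with hu
  set u' : Fin n → ℝ := fun i => y' i / l2norm y' with hu'
  have hu0 : ∀ i, 0 ≤ u i := fun i => div_nonneg (hy i) (l2norm_nonneg y)
  have hu'0 : ∀ i, 0 ≤ u' i := fun i => div_nonneg (hy'0 i) (l2norm_nonneg y')
  set z := candidateSum w y y' with hz
  have hzi : ∀ i, z i = w i + u i + u' i := fun i => rfl
  have hz0 : ∀ i, 0 ≤ z i := fun i => by
    have := hu0 i; have := hu'0 i; have := (hw i).le; rw [hzi]; positivity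
  set F : (Fin n → ℝ) → ℝ := fun x => ∑ e, c e * (x (i₀ e) * x (i₁ e) * ∏ i, x i ^ R e i)
    with hF
  have hzn : l2norm z ≤ 4 := by
    rw [l2norm, Real.sqrt_le_left (by norm_num)]
    -- (w + u + u')² ≤ 2w² + 4u² + 4u'², and the sums are at most 8 + 4 + 4 = 16.
    calc ∑ i, z i ^ 2 ≤ ∑ i, (2 * w i ^ 2 + 4 * u i ^ 2 + 4 * u' i ^ 2) := by
          refine Finset.sum_le_sum fun i _ => ?_
          rw [hzi]
          nlinarith [sq_nonneg (w i - (u i + u' i)), sq_nonneg (u i - u' i)]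
      _ = 2 * ∑ i, w i ^ 2 + 4 * ∑ i, u i ^ 2 + 4 * ∑ i, u' i ^ 2 := by
          simp only [Finset.sum_add_distrib, Finset.mul_sum]
      _ ≤ 2 * 4 + 4 * 1 + 4 * 1 := by
          have h1 : ∑ i, u i ^ 2 ≤ 1 := l2norm_div_self_sq_le y
          have h2 : ∑ i, u' i ^ 2 ≤ 1 := l2norm_div_self_sq_le y'
          linarith
      _ = 4 ^ 2 := by norm_num
  have hlow : l2norm y' / l2norm y ≤ F z := by
    calc l2norm y' / l2norm y = ∑ i, u' i * (edgeMatrix P i₀ i₁).mulVec u i := by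
          have e1 : u = (1 / l2norm y) • y := by ext i; simp [hu]; ring
          rw [e1, Matrix.mulVec_smul, ← hy']
          have : ∀ i, u' i * ((1 / l2norm y) • y') i = y' i ^ 2 * (1 / (l2norm y' * l2norm y)) :=
            fun i => by
              simp only [hu', Pi.smul_apply, smul_eq_mul, mul_inv, div_eq_mul_inv]; ring
          simp_rw [this]
          rw [← Finset.sum_mul, ← l2norm_sq]
          rcases (l2norm_nonneg y').eq_or_lt with h0 | h0
          · rw [← h0]; simp
          · field_simp
      _ = ∑ e, P e * (u (i₁ e) * u' (i₀ e) + u (i₀ e) * u' (i₁ e)) :=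
          dotProduct_edgeMatrix_mulVec P i₀ i₁ u u'
      _ ≤ F z := by
          refine Finset.sum_le_sum fun e _ => ?_
          simp only [hP]
          rw [mul_assoc]
          refine mul_le_mul_of_nonneg_left ?_ (hc e)
          rw [mul_comm]
          have h1 : ∏ i, w i ^ R e i ≤ ∏ i, z i ^ R e i :=
            Finset.prod_le_prod (fun i _ => pow_nonneg (hw i).le _) fun i _ =>
              pow_le_pow_left₀ (hw i).le (by
                have := hu0 i; have := hu'0 i; rw [hzi]; linarith) _
          have h2 : u (i₁ e) * u' (i₀ e) + u (i₀ e) * u' (i₁ e) ≤ z (i₀ e) * z (i₁ e) := by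
            rw [hzi, hzi]
            have a1 := hu0 (i₀ e); have a2 := hu0 (i₁ e)
            have b1 := hu'0 (i₀ e); have b2 := hu'0 (i₁ e)
            have c1 := (hw (i₀ e)).le; have c2 := (hw (i₁ e)).le
            have : (w (i₀ e) + u (i₀ e) + u' (i₀ e)) * (w (i₁ e) + u (i₁ e) + u' (i₁ e)) =
              u (i₁ e) * u' (i₀ e) + u (i₀ e) * u' (i₁ e) + (w (i₀ e) * w (i₁ e) +
              w (i₀ e) * u (i₁ e) + w (i₀ e) * u' (i₁ e) + u (i₀ e) * w (i₁ e) +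
              u (i₀ e) * u (i₁ e) + u' (i₀ e) * w (i₁ e) + u' (i₀ e) * u' (i₁ e)) := by ring
            rw [this]
            exact le_add_of_nonneg_right (by positivity)
          exact mul_le_mul h2 h1 (Finset.prod_nonneg fun i _ => pow_nonneg (hw i).le _)
            (mul_nonneg (hz0 _) (hz0 _))
  have hscale : F (candidate w y y') = F z / l2norm z ^ (r + 2) := by
    simp only [hF]
    rw [Finset.sum_div]
    refine Finset.sum_congr rfl fun e _ => ?_
    have : ∏ i, candidate w y y' i ^ R e i = (∏ i, z i ^ R e i) / l2norm z ^ r := by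
      rw [← hR e, ← Finset.prod_pow_eq_pow_sum, ← Finset.prod_div_distrib]
      exact Finset.prod_congr rfl fun i _ => div_pow _ _ _
    rw [this]
    simp only [candidate, ← hz]
    rw [pow_add]
    simp only [div_eq_mul_inv, mul_inv, sq]
    ring
  have hFz : 0 ≤ F z := le_trans (div_nonneg (l2norm_nonneg _) (l2norm_nonneg _)) hlow
  have hzpos : 0 < l2norm z ∨ l2norm z = 0 := (l2norm_nonneg z).lt_or_eq'.imp id id
  rw [div_le_iff₀ hypos] at hlow
  refine hlow.trans ?_
  refine mul_le_mul_of_nonneg_right ?_ hypos.le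
  change F z ≤ 4 ^ (r + 2) * F (candidate w y y')
  rw [hscale]
  rcases hzpos with h | h
  · rw [mul_div_assoc', le_div_iff₀ (by positivity), mul_comm]
    have := pow_le_pow_left₀ h.le hzn (r + 2)
    gcongr
  · exfalso
    obtain ⟨i⟩ : Nonempty (Fin n) := by
      by_contra hne
      rw [not_nonempty_iff] at hne
      simp [l2norm] at hypos
    have h1 := eq_zero_of_l2norm_eq_zero h i
    have := hu0 i; have := hu'0 i; have := hw i
    rw [hzi] at h1
    linarith

end SoS

/-! ### A language with named counters and arrays, compiled to the real RAM -/

namespace RealRAM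

/-- Memory with named counters and sixteen named arrays. -/
structure HState where
  nat : ℕ → ℕ
  arr : Fin 16 → ℕ → ℝ

/-- Write a counter. -/
def HState.writeNat (h : HState) (r v : ℕ) : HState where
  nat := Function.update h.nat r v
  arr := h.arr

/-- Write an array entry. -/
def HState.writeArr (h : HState) (k : Fin 16) (i : ℕ) (v : ℝ) : HState where
  nat := h.nat
  arr := Function.update h.arr k (Function.update (h.arr k) i v)

@[simp] lemma HState.writeNat_nat (h : HState) (r v x : ℕ) :
    (h.writeNat r v).nat x = if x = r then v else h.nat x := by
  simp [HState.writeNat, Function.update_apply]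

@[simp] lemma HState.writeNat_arr (h : HState) (r v : ℕ) : (h.writeNat r v).arr = h.arr := rfl

@[simp] lemma HState.writeArr_nat (h : HState) (k : Fin 16) (i : ℕ) (v : ℝ) :
    (h.writeArr k i v).nat = h.nat := rfl

@[simp] lemma HState.writeArr_arr (h : HState) (k : Fin 16) (i : ℕ) (v : ℝ) (l : Fin 16) (j : ℕ) :
    (h.writeArr k i v).arr l j = if l = k ∧ j = i then v else h.arr l j := by
  by_cases hl : l = k
  · subst hl; simp [HState.writeArr, Function.update_apply]
  · simp [HState.writeArr, hl]

/-- The arithmetic operations on real numbers. -/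
inductive ROp : Type
  | add | sub | mul | div

/-- The meaning of an arithmetic operation. -/
noncomputable def ROp.eval : ROp → ℝ → ℝ → ℝ
  | add, x, y => x + y
  | sub, x, y => x - y
  | mul, x, y => x * y
  | div, x, y => x / y

/-- The RAM instruction of an arithmetic operation. -/
def ROp.instr : ROp → ℕ → ℕ → ℕ → Program
  | add => .addReal
  | sub => .subReal
  | mul => .mulReal
  | div => .divReal

/-- Commands. An array entry is given by the array and the counter that holds the index. -/
inductive Cmd : Type
  | set (r k : ℕ)
  | add (r a b : ℕ)
  | sub (r a b : ℕ)
  | cast (k : Fin 16) (i a : ℕ)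
  | op (o : ROp) (k : Fin 16) (i : ℕ) (k₁ : Fin 16) (i₁ : ℕ) (k₂ : Fin 16) (i₂ : ℕ)
  | sqrt (k : Fin 16) (i : ℕ) (k₁ : Fin 16) (i₁ : ℕ)
  | seq (P Q : Cmd)
  | ifN (a b : ℕ) (P Q : Cmd)
  | ifR (k₁ : Fin 16) (i₁ : ℕ) (k₂ : Fin 16) (i₂ : ℕ) (P Q : Cmd)
  | loop (a : ℕ) (P : Cmd)

namespace Cmd

open Classical in
/-- The state in which a command stops. -/
noncomputable def run : Cmd → HState → HState
  | set r k, h => h.writeNat r k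
  | add r a b, h => h.writeNat r (h.nat a + h.nat b)
  | sub r a b, h => h.writeNat r (h.nat a - h.nat b)
  | cast k i a, h => h.writeArr k (h.nat i) (h.nat a : ℝ)
  | op o k i k₁ i₁ k₂ i₂, h =>
      h.writeArr k (h.nat i) (o.eval (h.arr k₁ (h.nat i₁)) (h.arr k₂ (h.nat i₂)))
  | sqrt k i k₁ i₁, h => h.writeArr k (h.nat i) (Real.sqrt (h.arr k₁ (h.nat i₁)))
  | seq P Q, h => Q.run (P.run h)
  | ifN a b P Q, h => if h.nat a ≤ h.nat b then P.run h else Q.run h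
  | ifR k₁ i₁ k₂ i₂ P Q, h =>
      if h.arr k₁ (h.nat i₁) ≤ h.arr k₂ (h.nat i₂) then P.run h else Q.run h
  | loop a P, h => P.run^[h.nat a] h

/-- Whether a command contains an assignment to a counter. -/
def modN : Cmd → ℕ → Bool
  | set r _, x => x == r
  | add r _ _, x => x == r
  | sub r _ _, x => x == r
  | seq P Q, x => P.modN x || Q.modN x
  | ifN _ _ P Q, x => P.modN x || Q.modN x
  | ifR _ _ _ _ P Q, x => P.modN x || Q.modN x
  | loop _ P, x => P.modN x
  | _, _ => false

/-- Whether a command contains an assignment to an array. -/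
def modA : Cmd → Fin 16 → Bool
  | cast k _ _, x => x == k
  | op _ k _ _ _ _ _, x => x == k
  | sqrt k _ _ _, x => x == k
  | seq P Q, x => P.modA x || Q.modA x
  | ifN _ _ P Q, x => P.modA x || Q.modA x
  | ifR _ _ _ _ P Q, x => P.modA x || Q.modA x
  | loop _ P, x => P.modA x
  | _, _ => false

/-- The second state agrees with the first outside of the memory that a command may change. -/
structure Frame (c : Cmd) (h g : HState) : Prop where
  nat : ∀ x, c.modN x = false → g.nat x = h.nat x
  arr : ∀ k, c.modA k = false → g.arr k = h.arr k

lemma frame_iterate {P : Cmd} (hP : ∀ h, P.Frame h (P.run h)) (j : ℕ) (h : HState) :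
    P.Frame h (P.run^[j] h) := by
  induction j with
  | zero => exact ⟨fun _ _ => rfl, fun _ _ => rfl⟩
  | succ j ih =>
    rw [Function.iterate_succ_apply']
    exact ⟨fun x hx => ((hP _).nat x hx).trans (ih.nat x hx),
      fun k hk => ((hP _).arr k hk).trans (ih.arr k hk)⟩

/-- A syntactic frame rule: preservation of memory reduces to evaluating `modN` and `modA`, mostly
by `rfl`. -/
theorem frame_run (c : Cmd) (h : HState) : c.Frame h (c.run h) := by
  induction c generalizing h with
  | set r k => exact ⟨fun x hx => by simp_all [modN, run], fun _ _ => rfl⟩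
  | add r a b => exact ⟨fun x hx => by simp_all [modN, run], fun _ _ => rfl⟩
  | sub r a b => exact ⟨fun x hx => by simp_all [modN, run], fun _ _ => rfl⟩
  | cast k i a => exact ⟨fun _ _ => rfl, fun l hl => by ext j; simp_all [modA, run]⟩
  | op o k i k₁ i₁ k₂ i₂ => exact ⟨fun _ _ => rfl, fun l hl => by ext j; simp_all [modA, run]⟩
  | sqrt k i k₁ i₁ => exact ⟨fun _ _ => rfl, fun l hl => by ext j; simp_all [modA, run]⟩
  | seq P Q hP hQ =>
    refine ⟨fun x hx => ?_, fun k hk => ?_⟩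
    · simp only [modN, Bool.or_eq_false_iff] at hx
      exact ((hQ _).nat x hx.2).trans ((hP _).nat x hx.1)
    · simp only [modA, Bool.or_eq_false_iff] at hk
      exact ((hQ _).arr k hk.2).trans ((hP _).arr k hk.1)
  | ifN a b P Q hP hQ =>
    refine ⟨fun x hx => ?_, fun k hk => ?_⟩
    · simp only [modN, Bool.or_eq_false_iff] at hx
      simp only [run]
      split_ifs
      exacts [(hP _).nat x hx.1, (hQ _).nat x hx.2]
    · simp only [modA, Bool.or_eq_false_iff] at hk
      simp only [run]
      split_ifs
      exacts [(hP _).arr k hk.1, (hQ _).arr k hk.2]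
  | ifR k₁ i₁ k₂ i₂ P Q hP hQ =>
    refine ⟨fun x hx => ?_, fun k hk => ?_⟩
    · simp only [modN, Bool.or_eq_false_iff] at hx
      simp only [run]
      split_ifs
      exacts [(hP _).nat x hx.1, (hQ _).nat x hx.2]
    · simp only [modA, Bool.or_eq_false_iff] at hk
      simp only [run]
      split_ifs
      exacts [(hP _).arr k hk.1, (hQ _).arr k hk.2]
  | loop a P hP => exact ⟨(frame_iterate hP _ h).nat, (frame_iterate hP _ h).arr⟩

/-- Put the address of an array entry into a cell; cell `7` holds the start of the arrays. -/
def address (t : ℕ) (k : Fin 16) (v : ℕ) : Program :=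
  .seq (.addNat t (v + 8) (v + 8)) (.seq (.addNat t t t) (.seq (.addNat t t t)
    (.seq (.addNat t t t) (.seq (.addNat t t 7) (.seq (.setNat 3 k) (.addNat t t 3))))))

/-- Compile a command. Counters are moved by eight cells, and the cells `3, 4, 5, 6` are used for
addresses. -/
def compile : Cmd → Program
  | set r k => .setNat (r + 8) k
  | add r a b => .addNat (r + 8) (a + 8) (b + 8)
  | sub r a b => .subNat (r + 8) (a + 8) (b + 8)
  | cast k i a => .seq (address 4 k i) (.castReal 4 (a + 8))
  | op o k i k₁ i₁ k₂ i₂ =>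
      .seq (address 4 k i) (.seq (address 5 k₁ i₁) (.seq (address 6 k₂ i₂) (o.instr 4 5 6)))
  | sqrt k i k₁ i₁ => .seq (address 4 k i) (.seq (address 5 k₁ i₁) (.sqrtReal 4 5))
  | seq P Q => .seq P.compile Q.compile
  | ifN a b P Q => .ifNat (a + 8) (b + 8) P.compile Q.compile
  | ifR k₁ i₁ k₂ i₂ P Q =>
      .seq (address 4 k₁ i₁) (.seq (address 5 k₂ i₂) (.ifReal 4 5 P.compile Q.compile))
  | loop a P => .loop (a + 8) P.compile

/-- A RAM state represents a state of named memory, with arrays that start at `D`. -/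
structure Sim (D : ℕ) (s : State) (h : HState) : Prop where
  base : s.nat 7 = D
  nat : ∀ r, s.nat (r + 8) = h.nat r
  arr : ∀ (k : Fin 16) (i : ℕ), s.real (D + 16 * i + k) = h.arr k i

/-- Four doublings multiply the index by 16, so the sixteen arrays are interleaved behind the base
address. -/
lemma address_run (t : ℕ) (k : Fin 16) (v : ℕ) (s : State) (ht : 3 < t) (ht' : t < 7) :
    ((address t k v).run s).real = s.real ∧
      ((address t k v).run s).nat t = s.nat 7 + 16 * s.nat (v + 8) + k ∧
      ∀ x, x ≠ 3 → x ≠ t → ((address t k v).run s).nat x = s.nat x := by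
  refine ⟨rfl, ?_, fun x hx hxt => ?_⟩
  · have h1 : t ≠ 3 := by omega
    have h2 : (7 : ℕ) ≠ t := by omega
    simp [address, Program.run, State.writeNat, h1, h2]
    omega
  · simp [address, Program.run, State.writeNat, Function.update_apply, hx, hxt]

lemma address_steps (t : ℕ) (k : Fin 16) (v : ℕ) (s : State) : (address t k v).steps s = 7 := rfl

lemma Sim.address {D : ℕ} {s : State} {h : HState} (hs : Sim D s h) (t : ℕ) (k : Fin 16) (v : ℕ)
    (ht : 3 < t) (ht' : t < 7) : Sim D ((address t k v).run s) h := by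
  obtain ⟨h1, h2, h3⟩ := address_run t k v s ht ht'
  refine ⟨?_, fun r => ?_, fun l i => ?_⟩
  · rw [h3 7 (by omega) (by omega), hs.base]
  · rw [h3 _ (by omega) (by omega), hs.nat]
  · rw [h1, hs.arr]

lemma Sim.address_nat {D : ℕ} {s : State} {h : HState} (hs : Sim D s h) (t : ℕ) (k : Fin 16)
    (v : ℕ) (ht : 3 < t) (ht' : t < 7) :
    ((Cmd.address t k v).run s).nat t = D + 16 * h.nat v + k := by
  rw [(address_run t k v s ht ht').2.1, hs.base, hs.nat]

lemma Sim.address_nat_of_ne {s : State} (t : ℕ) (k : Fin 16)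
    (v : ℕ) (ht : 3 < t) (ht' : t < 7) (x : ℕ) (hx : x ≠ 3) (hxt : x ≠ t) :
    ((Cmd.address t k v).run s).nat x = s.nat x :=
  (address_run t k v s ht ht').2.2 x hx hxt

lemma Sim.writeNat {D : ℕ} {s : State} {h : HState} (hs : Sim D s h) (r v : ℕ) :
    Sim D (s.writeNat (r + 8) v) (h.writeNat r v) := by
  refine ⟨?_, fun x => ?_, hs.arr⟩
  · simp only [State.writeNat]
    rw [Function.update_of_ne (by omega), hs.base]
  · simp [State.writeNat, Function.update_apply, hs.nat]

lemma Sim.writeReal {D : ℕ} {s : State} {h : HState} (hs : Sim D s h) (k : Fin 16) (i : ℕ)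
    (v : ℝ) : Sim D (s.writeReal (D + 16 * i + k) v) (h.writeArr k i v) := by
  refine ⟨hs.base, hs.nat, fun l j => ?_⟩
  simp only [State.writeReal, Function.update_apply, HState.writeArr_arr, hs.arr, Fin.ext_iff]
  congr 1
  apply propext
  have := k.isLt
  have := l.isLt
  omega

theorem Sim.run {D : ℕ} (c : Cmd) {s : State} {h : HState} (hs : Sim D s h) :
    Sim D (c.compile.run s) (c.run h) := by
  induction c generalizing s h with
  | set r k => exact hs.writeNat r k
  | add r a b =>
    simp only [compile, Program.run, Cmd.run, ← hs.nat]
    exact hs.writeNat r _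
  | sub r a b =>
    simp only [compile, Program.run, Cmd.run, ← hs.nat]
    exact hs.writeNat r _
  | cast k i a =>
    have h1 := hs.address 4 k i (by omega) (by omega)
    simp only [compile, Program.run, Cmd.run]
    rw [hs.address_nat 4 k i (by omega) (by omega), h1.nat]
    exact h1.writeReal k _ _
  | op o k i k₁ i₁ k₂ i₂ =>
    have h1 := hs.address 4 k i (by omega) (by omega)
    have h2 := h1.address 5 k₁ i₁ (by omega) (by omega)
    have h3 := h2.address 6 k₂ i₂ (by omega) (by omega)
    have e4 := hs.address_nat 4 k i (by omega) (by omega)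
    have e5 := h1.address_nat 5 k₁ i₁ (by omega) (by omega)
    have e6 := h2.address_nat 6 k₂ i₂ (by omega) (by omega)
    rw [← Sim.address_nat_of_ne 5 k₁ i₁ (by omega) (by omega) 4 (by omega) (by omega),
      ← Sim.address_nat_of_ne 6 k₂ i₂ (by omega) (by omega) 4 (by omega) (by omega)] at e4
    rw [← Sim.address_nat_of_ne 6 k₂ i₂ (by omega) (by omega) 5 (by omega) (by omega)] at e5
    have := h3.writeReal k (h.nat i) (o.eval (h.arr k₁ (h.nat i₁)) (h.arr k₂ (h.nat i₂)))
    cases o <;> simp only [compile, Program.run, Cmd.run, ROp.instr, e4, e5, e6, h3.arr] <;>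
      exact this
  | sqrt k i k₁ i₁ =>
    have h1 := hs.address 4 k i (by omega) (by omega)
    have h2 := h1.address 5 k₁ i₁ (by omega) (by omega)
    have e4 := hs.address_nat 4 k i (by omega) (by omega)
    have e5 := h1.address_nat 5 k₁ i₁ (by omega) (by omega)
    rw [← Sim.address_nat_of_ne 5 k₁ i₁ (by omega) (by omega) 4 (by omega) (by omega)] at e4
    simp only [compile, Program.run, Cmd.run, e4, e5, h2.arr]
    exact h2.writeReal k _ _
  | seq P Q hP hQ => exact hQ (hP hs)
  | ifN a b P Q hP hQ =>
    simp only [compile, Program.run, Cmd.run, hs.nat]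
    split_ifs
    exacts [hP hs, hQ hs]
  | ifR k₁ i₁ k₂ i₂ P Q hP hQ =>
    have h1 := hs.address 4 k₁ i₁ (by omega) (by omega)
    have h2 := h1.address 5 k₂ i₂ (by omega) (by omega)
    have e4 := hs.address_nat 4 k₁ i₁ (by omega) (by omega)
    have e5 := h1.address_nat 5 k₂ i₂ (by omega) (by omega)
    rw [← Sim.address_nat_of_ne 5 k₂ i₂ (by omega) (by omega) 4 (by omega) (by omega)] at e4
    simp only [compile, Program.run, Cmd.run, e4, e5, h2.arr]
    split_ifs
    exacts [hP h2, hQ h2]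
  | loop a P hP =>
    simp only [compile, Program.run, Cmd.run, hs.nat]
    generalize h.nat a = j
    induction j with
    | zero => exact hs
    | succ j ih =>
      rw [Function.iterate_succ_apply', Function.iterate_succ_apply']
      exact hP ih

/-- Every loop of a command is bounded by one of the given counters. -/
def LoopsIn (V : List ℕ) : Cmd → Prop
  | seq P Q => P.LoopsIn V ∧ Q.LoopsIn V
  | ifN _ _ P Q => P.LoopsIn V ∧ Q.LoopsIn V
  | ifR _ _ _ _ P Q => P.LoopsIn V ∧ Q.LoopsIn V
  | loop a P => a ∈ V ∧ P.LoopsIn V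
  | _ => True

/-- A bound for the number of steps of a compiled command all of whose loops make at most `L`
passes. -/
def cost (L : ℕ) : Cmd → ℕ
  | seq P Q => P.cost L + Q.cost L
  | ifN _ _ P Q => 1 + (P.cost L + Q.cost L)
  | ifR _ _ _ _ P Q => 15 + (P.cost L + Q.cost L)
  | loop _ P => 1 + L * (1 + P.cost L)
  | _ => 22

/-- No loop bound in `V` is ever modified, so the initial bound `L` is valid at every loop head. -/
theorem Sim.steps_le {D L : ℕ} (V : List ℕ) (c : Cmd) {s : State} {h : HState} (hs : Sim D s h)
    (hc : c.LoopsIn V) (hV : ∀ a ∈ V, c.modN a = false) (hL : ∀ a ∈ V, h.nat a ≤ L) :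
    c.compile.steps s ≤ c.cost L := by
  induction c generalizing s h with
  | set r k => simp [compile, Program.steps, cost]
  | add r a b => simp [compile, Program.steps, cost]
  | sub r a b => simp [compile, Program.steps, cost]
  | cast k i a => simp [compile, Program.steps, cost, address_steps]
  | op o k i k₁ i₁ k₂ i₂ =>
    cases o <;> simp [compile, Program.steps, cost, address_steps, ROp.instr]
  | sqrt k i k₁ i₁ => simp [compile, Program.steps, cost, address_steps]
  | seq P Q hP hQ =>
    simp only [modN, Bool.or_eq_false_iff] at hV
    have h1 := hP hs hc.1 (fun a ha => (hV a ha).1) hL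
    have h2 := hQ (hs.run P) hc.2 (fun a ha => (hV a ha).2) fun a ha => by
      rw [(frame_run P h).nat a (hV a ha).1]; exact hL a ha
    exact add_le_add h1 h2
  | ifN a b P Q hP hQ =>
    simp only [modN, Bool.or_eq_false_iff] at hV
    have h1 := hP hs hc.1 (fun a ha => (hV a ha).1) hL
    have h2 := hQ hs hc.2 (fun a ha => (hV a ha).2) hL
    simp only [compile, Program.steps, cost]
    split_ifs <;> omega
  | ifR k₁ i₁ k₂ i₂ P Q hP hQ =>
    simp only [modN, Bool.or_eq_false_iff] at hV
    have hs2 := (hs.address 4 k₁ i₁ (by omega) (by omega)).address 5 k₂ i₂ (by omega) (by omega)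
    have h1 := hP hs2 hc.1 (fun a ha => (hV a ha).1) hL
    have h2 := hQ hs2 hc.2 (fun a ha => (hV a ha).2) hL
    simp only [compile, Program.steps, cost, address_steps]
    split_ifs <;> omega
  | loop a P hP =>
    have hit : ∀ j, Sim D (P.compile.run^[j] s) (P.run^[j] h) := fun j => by
      induction j with
      | zero => exact hs
      | succ j ih =>
        rw [Function.iterate_succ_apply', Function.iterate_succ_apply']
        exact ih.run P
    simp only [compile, Program.steps, cost]
    refine Nat.add_le_add_left ?_ 1
    refine (Finset.sum_le_card_nsmul _ _ (1 + P.cost L) fun j _ => ?_).trans ?_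
    · refine Nat.add_le_add_left (hP (hit j) hc.2 hV fun a ha => ?_) 1
      rw [(frame_iterate (frame_run P) j h).nat a (hV a ha)]
      exact hL a ha
    · rw [Finset.card_range, smul_eq_mul, hs.nat]
      exact Nat.mul_le_mul_right _ (hL a hc.1)

/-- The nesting depth of loops is fixed by the command, so the cost is polynomial in `L`; a single
constant serves as factor and exponent. -/
lemma exists_cost_le (c : Cmd) : ∃ K : ℕ, ∀ L, c.cost L ≤ K * (L + 1) ^ K := by
  have mono : ∀ (K K' L : ℕ), K ≤ K' → K * (L + 1) ^ K ≤ K * (L + 1) ^ K' := fun K K' L h =>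
    Nat.mul_le_mul_left _ (Nat.pow_le_pow_right (by omega) h)
  have pair : ∀ (x y K K' L a : ℕ), x ≤ K * (L + 1) ^ K → y ≤ K' * (L + 1) ^ K' →
      a + (x + y) ≤ (a + K + K') * (L + 1) ^ (a + K + K') := fun x y K K' L a hx hy => by
    have h1 := hx.trans (mono K (a + K + K') L (by omega))
    have h2 := hy.trans (mono K' (a + K + K') L (by omega))
    have h3 : 1 ≤ (L + 1) ^ (a + K + K') := Nat.one_le_pow _ _ (by omega)
    nlinarith
  induction c with
  | seq P Q hP hQ =>
    obtain ⟨K, hK⟩ := hP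
    obtain ⟨K', hK'⟩ := hQ
    exact ⟨0 + K + K', fun L => by simpa [cost] using pair _ _ K K' L 0 (hK L) (hK' L)⟩
  | ifN a b P Q hP hQ =>
    obtain ⟨K, hK⟩ := hP
    obtain ⟨K', hK'⟩ := hQ
    exact ⟨1 + K + K', fun L => pair _ _ K K' L 1 (hK L) (hK' L)⟩
  | ifR k₁ i₁ k₂ i₂ P Q hP hQ =>
    obtain ⟨K, hK⟩ := hP
    obtain ⟨K', hK'⟩ := hQ
    exact ⟨15 + K + K', fun L => pair _ _ K K' L 15 (hK L) (hK' L)⟩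
  | loop a P hP =>
    obtain ⟨K, hK⟩ := hP
    refine ⟨K + 2, fun L => ?_⟩
    have h1 := (hK L).trans (mono K (K + 1) L (by omega))
    have h3 : 1 ≤ (L + 1) ^ (K + 1) := Nat.one_le_pow _ _ (by omega)
    have h4 : (L + 1) ^ (K + 2) = (L + 1) * (L + 1) ^ (K + 1) := by ring
    simp only [cost]
    rw [h4]
    calc 1 + L * (1 + P.cost L) ≤ (L + 1) * (1 + P.cost L) := by nlinarith
      _ ≤ (L + 1) * ((K + 2) * (L + 1) ^ (K + 1)) := by
        refine Nat.mul_le_mul_left _ ?_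
        nlinarith
      _ = _ := by ring
  | _ => exact ⟨22, fun L => Nat.le_mul_of_pos_right _ (by positivity)⟩

/-- `for i < a do P`, where counter `3` holds the number one. -/
def forN (i a : ℕ) (P : Cmd) : Cmd := .seq (.set i 0) (.loop a (.seq P (.add i i 3)))

/-- The loop rule. `hInv` makes the invariant blind to the loop counter, which is rewritten after
each pass; the frame hypothesis in `hstep` recovers all that the loop leaves unchanged. -/
theorem forN_induction {i a : ℕ} {P : Cmd} {h : HState} (hone : h.nat 3 = 1)
    (hi : P.modN i = false) (h3 : P.modN 3 = false) (hi3 : i ≠ 3) (hia : a ≠ i)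
    (Inv : ℕ → HState → Prop) (hInv : ∀ j g x, Inv j g → Inv j (g.writeNat i x)) (h0 : Inv 0 h)
    (hstep : ∀ j < h.nat a, ∀ g, (forN i a P).Frame h g → g.nat i = j → Inv j g →
      Inv (j + 1) (P.run g)) :
    Inv (h.nat a) ((forN i a P).run h) := by
  have key : ∀ j ≤ h.nat a, (forN i a P).Frame h ((seq P (add i i 3)).run^[j] (h.writeNat i 0)) ∧
      ((seq P (add i i 3)).run^[j] (h.writeNat i 0)).nat i = j ∧
      Inv j ((seq P (add i i 3)).run^[j] (h.writeNat i 0)) := by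
    intro j
    induction j with
    | zero =>
      intro _
      refine ⟨⟨fun x hx => ?_, fun k _ => rfl⟩, by simp, hInv _ _ _ h0⟩
      simp only [forN, modN, Bool.or_eq_false_iff, beq_eq_false_iff_ne] at hx
      simp [hx.1]
    | succ j ih =>
      intro hj
      obtain ⟨hF, hn, hI⟩ := ih (by omega)
      rw [Function.iterate_succ_apply']
      set g := (seq P (add i i 3)).run^[j] (h.writeNat i 0) with hg
      have hPF := frame_run P g
      have hg3 : g.nat 3 = 1 := by
        rw [hF.nat 3, hone]
        simp [forN, modN, h3, hi3.symm]
      have e : (seq P (add i i 3)).run g = (P.run g).writeNat i (j + 1) := by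
        simp only [run]
        rw [hPF.nat i hi, hPF.nat 3 h3, hn, hg3]
      rw [e]
      refine ⟨⟨fun x hx => ?_, fun k hk => ?_⟩, by simp, hInv _ _ _ (hstep j hj g hF hn hI)⟩
      · have hx' := hx
        simp only [forN, modN, Bool.or_eq_false_iff, beq_eq_false_iff_ne] at hx'
        rw [HState.writeNat_nat, if_neg hx'.1, hPF.nat x hx'.2.1, hF.nat x hx]
      · have hk' := hk
        simp only [forN, modA, Bool.or_eq_false_iff] at hk'
        rw [HState.writeNat_arr, hPF.arr k hk'.2.1, hF.arr k hk]
  have := (key _ le_rfl).2.2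
  have e : (forN i a P).run h = (seq P (add i i 3)).run^[h.nat a] (h.writeNat i 0) := by
    simp [forN, run, hia]
  rw [e]
  exact this

end Cmd

end RealRAM

/-! ### The rounding program -/

namespace RealRAM

/-- The digit number `s` of `a` in base `n`. -/
def dig (n a s : ℕ) : ℕ := a / n ^ s % n

/-- The coefficient of the sorted monomial with index `a`, with the variables from the third on
evaluated at `W`; zero if the index is not sorted. -/
noncomputable def entVal (n d : ℕ) (C W : ℕ → ℝ) (a : ℕ) : ℝ :=
  if ∀ s < d - 1, dig n a s ≤ dig n a (s + 1) then
    C a * ∏ s ∈ Finset.range (d - 2), W (dig n a (s + 2)) else 0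

/-- The product of the symmetric matrix of the quadratic form at `W` with the vector `Y`. -/
noncomputable def mulVal (n d : ℕ) (C W Y : ℕ → ℝ) (i : ℕ) : ℝ :=
  ∑ a ∈ Finset.range (n ^ d), ((if dig n a 0 = i then entVal n d C W a * Y (dig n a 1) else 0) +
    if dig n a 1 = i then entVal n d C W a * Y (dig n a 0) else 0)

/-- The value of the polynomial. -/
noncomputable def evalVal (n d : ℕ) (C X : ℕ → ℝ) : ℝ :=
  ∑ a ∈ Finset.range (n ^ d), entVal n d C X a * X (dig n a 0) * X (dig n a 1)

/-- The Euclidean norm of the first `n` entries. -/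
noncomputable def normVal (n : ℕ) (v : ℕ → ℝ) : ℝ := √(∑ i ∈ Finset.range n, v i ^ 2)

/-- The weights given by the first `q` digits of `e`. -/
noncomputable def weightVal (n q e i : ℕ) : ℝ :=
  √(((Finset.range q).filter fun s => dig n e s = i).card / q) + 1 / √n

/-- The iterates of the power method. -/
noncomputable def iterVal (n d : ℕ) (C W : ℕ → ℝ) : ℕ → ℕ → ℝ
  | 0 => fun _ => 1
  | t + 1 => mulVal n d C W (iterVal n d C W t)

/-- The unnormalized test points. -/
noncomputable def sumVal (n d : ℕ) (C W : ℕ → ℝ) (t i : ℕ) : ℝ :=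
  W i + iterVal n d C W t i / normVal n (iterVal n d C W t) +
    iterVal n d C W (t + 1) i / normVal n (iterVal n d C W (t + 1))

/-- The test points. -/
noncomputable def candVal (n d q : ℕ) (C : ℕ → ℝ) (e t i : ℕ) : ℝ :=
  sumVal n d C (weightVal n q e) t i / normVal n (sumVal n d C (weightVal n q e) t)

/-- Digits are below n, so vectors are read only at their first n entries; what an array holds
beyond them is irrelevant. The same applies to the next three lemmas. -/
lemma entVal_congr {n d : ℕ} (hn : 0 < n) {C W W' : ℕ → ℝ} (h : ∀ i < n, W i = W' i) (a : ℕ) :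
    entVal n d C W a = entVal n d C W' a := by
  simp only [entVal]
  congr 2
  exact Finset.prod_congr rfl fun s _ => h _ (Nat.mod_lt _ hn)

lemma mulVal_congr {n d : ℕ} (hn : 0 < n) {C W W' Y Y' : ℕ → ℝ} (h : ∀ i < n, W i = W' i)
    (hY : ∀ i < n, Y i = Y' i) (i : ℕ) : mulVal n d C W Y i = mulVal n d C W' Y' i := by
  simp only [mulVal]
  refine Finset.sum_congr rfl fun a _ => ?_
  rw [entVal_congr hn h, hY (dig n a 0) (Nat.mod_lt _ hn), hY (dig n a 1) (Nat.mod_lt _ hn)]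

lemma evalVal_congr {n d : ℕ} (hn : 0 < n) {C X X' : ℕ → ℝ} (h : ∀ i < n, X i = X' i) :
    evalVal n d C X = evalVal n d C X' := by
  simp only [evalVal]
  refine Finset.sum_congr rfl fun a _ => ?_
  rw [entVal_congr hn h, h (dig n a 0) (Nat.mod_lt _ hn), h (dig n a 1) (Nat.mod_lt _ hn)]

lemma normVal_congr {n : ℕ} {v v' : ℕ → ℝ} (h : ∀ i < n, v i = v' i) :
    normVal n v = normVal n v' := by
  simp only [normVal]
  congr 1
  exact Finset.sum_congr rfl fun i hi => by rw [h i (Finset.mem_range.1 hi)]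

namespace Cmd

@[simp] lemma run_set (r k : ℕ) (h : HState) : (set r k).run h = h.writeNat r k := rfl

@[simp] lemma run_add (r a b : ℕ) (h : HState) :
    (add r a b).run h = h.writeNat r (h.nat a + h.nat b) := rfl

@[simp] lemma run_sub (r a b : ℕ) (h : HState) :
    (sub r a b).run h = h.writeNat r (h.nat a - h.nat b) := rfl

@[simp] lemma run_cast (k : Fin 16) (i a : ℕ) (h : HState) :
    (cast k i a).run h = h.writeArr k (h.nat i) (h.nat a : ℝ) := rfl

@[simp] lemma run_op (o : ROp) (k : Fin 16) (i : ℕ) (k₁ : Fin 16) (i₁ : ℕ) (k₂ : Fin 16) (i₂ : ℕ)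
    (h : HState) : (op o k i k₁ i₁ k₂ i₂).run h =
      h.writeArr k (h.nat i) (o.eval (h.arr k₁ (h.nat i₁)) (h.arr k₂ (h.nat i₂))) := rfl

@[simp] lemma run_sqrt (k : Fin 16) (i : ℕ) (k₁ : Fin 16) (i₁ : ℕ) (h : HState) :
    (sqrt k i k₁ i₁).run h = h.writeArr k (h.nat i) √(h.arr k₁ (h.nat i₁)) := rfl

@[simp] lemma run_seq (P Q : Cmd) (h : HState) : (seq P Q).run h = Q.run (P.run h) := rfl

lemma run_loop (a : ℕ) (P : Cmd) (h : HState) : (loop a P).run h = P.run^[h.nat a] h := rfl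

open Classical in
@[simp] lemma run_ifN (a b : ℕ) (P Q : Cmd) (h : HState) :
    (ifN a b P Q).run h = if h.nat a ≤ h.nat b then P.run h else Q.run h := by
  simp only [run]

open Classical in
@[simp] lemma run_ifR (k₁ : Fin 16) (i₁ : ℕ) (k₂ : Fin 16) (i₂ : ℕ) (P Q : Cmd) (h : HState) :
    (ifR k₁ i₁ k₂ i₂ P Q).run h =
      if h.arr k₁ (h.nat i₁) ≤ h.arr k₂ (h.nat i₂) then P.run h else Q.run h := rfl

/-- A command without effect on the counters and arrays in use. -/
def skip : Cmd := .set 21 0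

/-- Counter `13` becomes counter `11` modulo counter `0`, and counter `11` is divided by
counter `0`. -/
def divmod : Cmd :=
  .seq (.set 12 0) <| .seq (.loop 4 (.ifN 0 11 (.seq (.sub 11 11 0) (.add 12 12 3)) skip)) <|
    .seq (.add 13 11 7) (.add 11 12 7)

/-- The scalar in array `7` becomes the entry with index in counter `15` at the vector `k`. The
first two digits are left in the counters `16`, `17`. -/
def entry (k : Fin 16) : Cmd :=
  .seq (.add 11 15 7) <| .seq divmod <| .seq (.add 16 13 7) <| .seq divmod <|
  .seq (.add 17 13 7) <| .seq (.add 18 13 7) <| .seq (.cast 7 7 7) <|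
  .seq (.op .add 7 7 7 7 1 15) <| .seq (.ifN 16 17 skip (.cast 7 7 7)) <|
  forN 10 6 <| .seq divmod <| .seq (.op .mul 7 7 7 7 k 13) <|
    .seq (.ifN 18 13 skip (.cast 7 7 7)) (.add 18 13 7)

/-- The scalar in array `s` becomes the norm of the vector `k`. -/
def norm (s k : Fin 16) : Cmd :=
  .seq (.cast s 7 7) <| .seq (forN 8 0 <| .seq (.op .mul 13 7 k 8 k 8) (.op .add s 7 s 7 13 7)) <|
    .sqrt s 7 s 7

/-- The weights for the digits of counter `9` are written into array `2`. -/
def weights : Cmd :=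
  .seq (forN 8 0 (.cast 2 8 7)) <| .seq (.add 11 9 7) <| .seq (.cast 14 7 3) <|
  .seq (forN 10 2 (.seq divmod (.op .add 2 13 2 13 14 7))) <|
  forN 8 0 <| .seq (.cast 13 7 2) <| .seq (.op .div 2 8 2 8 13 7) <| .seq (.sqrt 2 8 2 8) <|
    .seq (.cast 13 7 0) <| .seq (.sqrt 13 7 13 7) <| .seq (.op .div 13 7 14 7 13 7) <|
    .op .add 2 8 2 8 13 7

/-- Array `4` becomes the product of the matrix at array `2` with array `3`. -/
def mulM : Cmd :=
  .seq (forN 8 0 (.cast 4 8 7)) <|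
  forN 15 5 <| .seq (entry 2) <| .seq (.op .mul 13 7 7 7 3 17) <|
    .seq (.op .add 4 16 4 16 13 7) <| .seq (.op .mul 13 7 7 7 3 16) <| .op .add 4 17 4 17 13 7

/-- The scalar in array `11` becomes the value of the polynomial at array `5`. -/
def evalX : Cmd :=
  .seq (.cast 11 7 7) <|
  forN 15 5 <| .seq (entry 5) <| .seq (.op .mul 7 7 7 7 5 16) <|
    .seq (.op .mul 7 7 7 7 5 17) <| .op .add 11 7 11 7 7 7

/-- Array `5` becomes the test point for the arrays `2, 3, 4`. -/
def point : Cmd :=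
  .seq (norm 8 3) <| .seq (norm 9 4) <|
  .seq (forN 8 0 <| .seq (.op .div 13 7 3 8 8 7) <| .seq (.op .add 5 8 2 8 13 7) <|
    .seq (.op .div 13 7 4 8 9 7) (.op .add 5 8 5 8 13 7)) <|
  .seq (norm 10 5) <| forN 8 0 (.op .div 5 8 5 8 10 7)

/-- Copy array `l` to array `k`. -/
def copy (k l : Fin 16) : Cmd := forN 8 0 (.seq (.cast 13 7 7) (.op .add k 8 l 8 13 7))

/-- One round of the power method. -/
def round : Cmd :=
  .seq mulM <| .seq point <| .seq evalX <|
  .seq (.ifR 11 7 12 7 skip (.seq (copy 6 5) (.seq (.cast 13 7 7) (.op .add 12 7 11 7 13 7)))) <|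
  copy 3 4

/-- The search for the best test point. -/
def search : Cmd :=
  .seq (.cast 14 7 3) <| .seq (.cast 13 7 7) <| .seq (.op .sub 12 7 13 7 14 7) <|
  forN 9 4 <| .seq weights <| .seq (forN 8 0 (.cast 3 8 3)) <| forN 14 0 round

end Cmd

end RealRAM

/-! ### Correctness of digit extraction and coefficient lookup. -/

namespace RealRAM

namespace Cmd

/-- The constants of the search: `n`, `q`, `1`, `L`, `n ^ d`, `d - 2` and `0`. -/
structure Consts (n d q L : ℕ) (h : HState) : Prop where
  eq_n : h.nat 0 = n
  eq_q : h.nat 2 = q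
  eq_one : h.nat 3 = 1
  eq_L : h.nat 4 = L
  eq_D : h.nat 5 = n ^ d
  eq_d : h.nat 6 = d - 2
  eq_zero : h.nat 7 = 0

variable {n d q L : ℕ} {h : HState}

lemma Consts.of_frame (hc : Consts n d q L h) {c : Cmd} {g : HState} (hF : c.Frame h g)
    (h0 : ([0, 2, 3, 4, 5, 6, 7].all fun x => !c.modN x) = true) : Consts n d q L g := by
  simp only [List.all_cons, Bool.and_eq_true, Bool.not_eq_true'] at h0
  obtain ⟨h0, h2, h3, h4, h5, h6, h7, -⟩ := h0
  exact ⟨(hF.nat _ h0).trans hc.eq_n, (hF.nat _ h2).trans hc.eq_q, (hF.nat _ h3).trans hc.eq_one,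
    (hF.nat _ h4).trans hc.eq_L, (hF.nat _ h5).trans hc.eq_D, (hF.nat _ h6).trans hc.eq_d,
    (hF.nat _ h7).trans hc.eq_zero⟩

lemma Consts.run (hc : Consts n d q L h) (c : Cmd)
    (h0 : ([0, 2, 3, 4, 5, 6, 7].all fun x => !c.modN x) = true) : Consts n d q L (c.run h) :=
  hc.of_frame (frame_run c h) h0

lemma Consts.writeNat (hc : Consts n d q L h) (r v : ℕ)
    (h0 : ([0, 2, 3, 4, 5, 6, 7].all fun x => !(x == r)) = true) :
    Consts n d q L (h.writeNat r v) :=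
  hc.run (set r v) h0

/-- Division by repeated subtraction with always `L` passes, idle once the remainder is below n.
Remainder plus n times quotient is invariant, and until then each pass raises the quotient by one; a
dividend of at most `L` is exhausted in time. -/
lemma divmod_spec (hc : Consts n d q L h) (hn : 0 < n) (hx : h.nat 11 ≤ L) :
    (divmod.run h).nat 11 = h.nat 11 / n ∧ (divmod.run h).nat 13 = h.nat 11 % n := by
  set P : Cmd := .ifN 0 11 (.seq (.sub 11 11 0) (.add 12 12 3)) skip with hP
  have key : ∀ j, (P.run^[j] (h.writeNat 12 0)).nat 0 = n ∧
      (P.run^[j] (h.writeNat 12 0)).nat 3 = 1 ∧ (P.run^[j] (h.writeNat 12 0)).nat 7 = 0 ∧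
      (P.run^[j] (h.writeNat 12 0)).nat 11 + n * (P.run^[j] (h.writeNat 12 0)).nat 12 =
        h.nat 11 ∧
      ((P.run^[j] (h.writeNat 12 0)).nat 11 < n ∨ (P.run^[j] (h.writeNat 12 0)).nat 12 = j) := by
    intro j
    induction j with
    | zero => simp [hc.eq_n, hc.eq_one, hc.eq_zero]
    | succ j ih =>
      rw [Function.iterate_succ_apply']
      obtain ⟨a0, a3, a7, a, b⟩ := ih
      set g := P.run^[j] (h.writeNat 12 0)
      simp only [hP, skip, run_ifN, a0]
      split_ifs with hle
      · simp only [run_seq, run_sub, run_add, HState.writeNat_nat, a0, a3, a7]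
        norm_num
        constructor
        · rw [← a, mul_add]; omega
        · right; omega
      · simp [a0, a3, a7, a]
        left; omega
  obtain ⟨a0, a3, a7, a, b⟩ := key L
  have e : divmod.run h = ((P.run^[L] (h.writeNat 12 0)).writeNat 13
      ((P.run^[L] (h.writeNat 12 0)).nat 11)).writeNat 11
      ((P.run^[L] (h.writeNat 12 0)).nat 12) := by
    simp only [divmod, run_seq, run_set, run_loop]
    rw [show (h.writeNat 12 0).nat 4 = L by simp [hc.eq_L], ← hP]
    simp [a7]
  set g := P.run^[L] (h.writeNat 12 0)
  have hlt : g.nat 11 < n := by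
    rcases b with b | b
    · exact b
    · by_contra hge
      rw [b] at a
      have : L ≤ n * L := Nat.le_mul_of_pos_left _ hn
      omega
  rw [e]
  simp only [HState.writeNat_nat]
  norm_num
  rw [← a]
  constructor
  · rw [Nat.add_mul_div_left _ _ hn, Nat.div_eq_of_lt hlt, zero_add]
  · rw [Nat.add_mul_mod_self_left, Nat.mod_eq_of_lt hlt]

lemma divmod_nat (h : HState) (x : ℕ) (hx : divmod.modN x = false) :
    (divmod.run h).nat x = h.nat x := (frame_run divmod h).nat x hx

@[simp] lemma divmod_arr (h : HState) : (divmod.run h).arr = h.arr := by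
  ext k i
  rw [(frame_run divmod h).arr k rfl]

lemma entry_spec (hc : Consts n d q L h) (hn : 0 < n) (hd : 2 ≤ d) {k : Fin 16} (hk : k ≠ 7)
    (ha : h.nat 15 ≤ L) :
    ((entry k).run h).arr 7 0 = entVal n d (h.arr 1) (h.arr k) (h.nat 15) ∧
      ((entry k).run h).nat 16 = dig n (h.nat 15) 0 ∧
      ((entry k).run h).nat 17 = dig n (h.nat 15) 1 := by
  set a := h.nat 15 with ha'
  set h1 := h.writeNat 11 (h.nat 15 + h.nat 7) with hh1
  have c1 : Consts n d q L h1 := hc.writeNat _ _ rfl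
  have e1 : h1.nat 11 = a := by simp [hh1, hc.eq_zero, ha']
  obtain ⟨d1, m1⟩ := divmod_spec c1 hn (e1 ▸ ha)
  set h2 := (divmod.run h1).writeNat 16 ((divmod.run h1).nat 13 + (divmod.run h1).nat 7) with hh2
  have c2 : Consts n d q L h2 := (c1.run divmod rfl).writeNat _ _ rfl
  have e2 : h2.nat 11 = a / n := by simp [hh2, d1, e1]
  have i2 : h2.nat 16 = dig n a 0 := by
    simp [hh2, m1, e1, dig, (c1.run divmod rfl).eq_zero]
  have f2 : h2.nat 15 = a := by
    simp only [hh2, HState.writeNat_nat]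
    rw [if_neg (by norm_num), divmod_nat _ _ rfl]
    simp [hh1, ha']
  obtain ⟨d2, m2⟩ := divmod_spec c2 hn (e2 ▸ (Nat.div_le_self a n).trans ha)
  have c3 := c2.run divmod rfl
  have z3 := c3.eq_zero
  have i3 : (divmod.run h2).nat 16 = dig n a 0 := by rw [divmod_nat _ _ rfl, i2]
  have f3 : (divmod.run h2).nat 15 = a := by rw [divmod_nat _ _ rfl, f2]
  have m3 : (divmod.run h2).nat 13 = dig n a 1 := by rw [m2, e2, dig, pow_one]
  have d3 : (divmod.run h2).nat 11 = a / n ^ 2 := by rw [d2, e2, Nat.div_div_eq_div_mul, sq]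
  have a3 : (divmod.run h2).arr = h.arr := by simp [hh2, hh1]
  set h3 := divmod.run h2 with hh3
  set h4 := (((h3.writeNat 17 (dig n a 1)).writeNat 18 (dig n a 1)).writeArr 7 0 0).writeArr 7 0
    (h.arr 1 a) with hh4
  have c4 : Consts n d q L h4 :=
    (c3.writeNat 17 (dig n a 1) rfl).writeNat 18 (dig n a 1) rfl |>.run (.cast 7 7 7) rfl
      |> fun hc => ⟨hc.eq_n, hc.eq_q, hc.eq_one, hc.eq_L, hc.eq_D, hc.eq_d, hc.eq_zero⟩
  set h5 := (ifN 16 17 skip (.cast 7 7 7)).run h4 with hh5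
  have c5 : Consts n d q L h5 := c4.run _ rfl
  have F5 := frame_run (ifN 16 17 skip (.cast 7 7 7)) h4
  rw [← hh5] at F5
  have n5 : ∀ x, x ≠ 21 → h5.nat x = h4.nat x := fun x hx => F5.nat x (by simp [modN, skip, hx])
  have g11 : h5.nat 11 = a / n ^ 2 := by rw [n5 _ (by omega)]; simp [hh4, d3]
  have g16 : h5.nat 16 = dig n a 0 := by rw [n5 _ (by omega)]; simp [hh4, i3]
  have g17 : h5.nat 17 = dig n a 1 := by rw [n5 _ (by omega)]; simp [hh4]
  have g18 : h5.nat 18 = dig n a 1 := by rw [n5 _ (by omega)]; simp [hh4]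
  have ak : h5.arr k = h.arr k := by
    rw [F5.arr k (by simp [modA, skip, hk])]
    ext j
    simp [hh4, hk, a3]
  have a7 : h5.arr 7 0 = if dig n a 0 ≤ dig n a 1 then h.arr 1 a else 0 := by
    rw [hh5, run_ifN]
    simp only [hh4, HState.writeArr_nat, HState.writeNat_nat, i3]
    norm_num
    split_ifs
    · simp [skip]
    · simp [z3]
  set B : Cmd := .seq divmod <| .seq (.op .mul 7 7 7 7 k 13) <|
    .seq (.ifN 18 13 skip (.cast 7 7 7)) (.add 18 13 7) with hB
  have hrun : (entry k).run h = (forN 10 6 B).run h5 := by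
    simp only [entry, run_seq, run_add, run_cast, run_op]
    rw [← hh1, ← hh2, ← hh3, ← hB, hh5, hh4]
    simp only [HState.writeNat_nat, HState.writeArr_nat, HState.writeArr_arr, z3, m3, f3,
      HState.writeNat_arr, ROp.eval, a3]
    norm_num
    simp
  have hF := frame_run (forN 10 6 B) h5
  rw [hrun, hF.nat 16 rfl, hF.nat 17 rfl]
  refine ⟨?_, g16, g17⟩
  -- After j passes the digits 0, …, j + 1 have been compared, and counter 18 keeps the last one. A
  -- descent sets the scalar to zero, which absorbs all later factors.
  have := forN_induction (i := 10) (a := 6) (P := B) (h := h5) c5.eq_one rfl rfl (by norm_num)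
    (by norm_num) (fun j g => g.nat 11 = a / n ^ (j + 2) ∧ g.nat 18 = dig n a (j + 1) ∧
      g.arr 7 0 = if ∀ s < j + 1, dig n a s ≤ dig n a (s + 1) then
        h.arr 1 a * ∏ s ∈ Finset.range j, h.arr k (dig n a (s + 2)) else 0)
    (fun j g x hg => by simpa using hg) ⟨g11, g18, by simpa using a7⟩ ?_
  · rw [this.2.2, c5.eq_d, entVal]
    congr 1
    rw [show d - 2 + 1 = d - 1 by omega]
  · rintro j hj g hFg - ⟨b1, b2, b3⟩
    have cg : Consts n d q L g := c5.of_frame hFg rfl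
    have gk : g.arr k = h.arr k := by
      rw [hFg.arr k (by simp [forN, hB, modA, skip, divmod, hk]), ak]
    obtain ⟨dd, mm⟩ := divmod_spec cg hn (b1 ▸ (Nat.div_le_self a _).trans ha)
    have z := (cg.run divmod rfl).eq_zero
    rw [b1, Nat.div_div_eq_div_mul, ← pow_succ] at dd
    rw [b1] at mm
    have b2' : (divmod.run g).nat 18 = dig n a (j + 1) := by rw [divmod_nat _ _ rfl, b2]
    have mm' : (divmod.run g).nat 13 = dig n a (j + 2) := mm
    simp only [hB, run_seq, run_op, run_ifN, run_add, run_cast, skip, run_set,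
      HState.writeArr_nat, b2', mm', z, divmod_arr, ROp.eval, gk, b3]
    refine ⟨?_, ?_, ?_⟩
    · split_ifs <;> simp [dd]
    · split_ifs <;> simp [mm', z]
    · rw [HState.writeNat_arr, Finset.prod_range_succ, ← mul_assoc]
      have : (∀ s < j + 1 + 1, dig n a s ≤ dig n a (s + 1)) ↔
          (∀ s < j + 1, dig n a s ≤ dig n a (s + 1)) ∧ dig n a (j + 1) ≤ dig n a (j + 2) := by
        constructor
        · exact fun H => ⟨fun s hs => H s (by omega), H (j + 1) (by omega)⟩
        · rintro ⟨H1, H2⟩ s hs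
          rcases Nat.lt_succ_iff_lt_or_eq.1 hs with h | rfl
          exacts [H1 s h, H2]
      simp only [this]
      by_cases H1 : ∀ s < j + 1, dig n a s ≤ dig n a (s + 1) <;>
        by_cases H2 : dig n a (j + 1) ≤ dig n a (j + 2) <;>
        simp only [H1, H2, and_true, and_false, if_true, if_false] <;> simp

end Cmd

end RealRAM

/-! ### Correctness of the vector subroutines. -/

namespace RealRAM

namespace Cmd

variable {n d q L : ℕ} {h : HState}

lemma norm_spec (hc : Consts n d q L h) {s k : Fin 16} (hs : s ≠ 13) (hk : k ≠ 13) (hks : k ≠ s) :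
    ((norm s k).run h).arr s 0 = normVal n (h.arr k) := by
  set h1 := (cast s 7 7).run h with hh1
  have c1 : Consts n d q L h1 := hc.run _ rfl
  have ak : h1.arr k = h.arr k := by ext i; simp [hh1, hks]
  have as : h1.arr s 0 = 0 := by simp [hh1, hc.eq_zero]
  set B : Cmd := .seq (.op .mul 13 7 k 8 k 8) (.op .add s 7 s 7 13 7) with hB
  have := forN_induction (i := 8) (a := 0) (P := B) (h := h1) c1.eq_one rfl rfl (by norm_num)
    (by norm_num) (fun j g => g.arr s 0 = ∑ i ∈ Finset.range j, h.arr k i ^ 2)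
    (fun j g x hg => hg) (by simpa using as) ?_
  · simp only [norm, run_seq, ← hh1, ← hB, run_sqrt, HState.writeArr_arr]
    rw [(frame_run (forN 8 0 B) h1).nat 7 rfl, c1.eq_zero, this, c1.eq_n]
    simp [normVal]
  · intro j hj g hF hg8 hg
    have cg : Consts n d q L g := c1.of_frame hF rfl
    have gk : g.arr k = h.arr k := by
      rw [hF.arr k (by simp [forN, hB, modA, hks, hk]), ak]
    simp [hB, cg.eq_zero, ROp.eval, hg, gk, hg8, hs, Finset.sum_range_succ, sq]

lemma weights_spec (hc : Consts n d q L h) (hn : 0 < n) (he : h.nat 9 ≤ L) :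
    ∀ i < n, (weights.run h).arr 2 i = weightVal n q (h.nat 9) i := by
  set e := h.nat 9 with he'
  set h1 := (forN 8 0 (.cast 2 8 7)).run h with hh1
  have F1 := frame_run (forN 8 0 (.cast 2 8 7)) h
  rw [← hh1] at F1
  have c1 : Consts n d q L h1 := hc.of_frame F1 rfl
  have a1 : ∀ i < n, h1.arr 2 i = 0 := by
    have := forN_induction (i := 8) (a := 0) (P := .cast 2 8 7) (h := h) hc.eq_one rfl rfl
      (by norm_num) (by norm_num) (fun j g => ∀ i < j, g.arr 2 i = 0)
      (fun j g x hg => hg) (by simp) fun j _ g hF hg8 hg i hi => by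
        have cg : Consts n d q L g := hc.of_frame hF rfl
        simp only [run_cast, hg8, cg.eq_zero, HState.writeArr_arr]
        split_ifs with h0
        · simp
        · exact hg i (by simp at h0; omega)
    rwa [hc.eq_n] at this
  set h2 := (cast 14 7 3).run ((add 11 9 7).run h1) with hh2
  have c2 : Consts n d q L h2 := (c1.run (add 11 9 7) rfl).run (cast 14 7 3) rfl
  have e2 : h2.nat 11 = e := by simp [hh2, F1.nat 9 rfl, c1.eq_zero, he']
  have a2 : ∀ i < n, h2.arr 2 i = 0 := fun i hi => by simpa [hh2] using a1 i hi
  have o2 : h2.arr 14 0 = 1 := by simp [hh2, c1.eq_zero, c1.eq_one]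
  set B : Cmd := seq divmod (.op .add 2 13 2 13 14 7) with hB
  set h3 := (forN 10 2 B).run h2 with hh3
  have F3 := frame_run (forN 10 2 B) h2
  rw [← hh3] at F3
  have c3 : Consts n d q L h3 := c2.of_frame F3 rfl
  have o3 : h3.arr 14 0 = 1 := by rw [F3.arr 14 rfl, o2]
  have a3 : ∀ i < n, h3.arr 2 i =
      (((Finset.range q).filter fun s => dig n e s = i).card : ℝ) := by
    have := forN_induction (i := 10) (a := 2) (P := B) (h := h2) c2.eq_one rfl rfl
      (by norm_num) (by norm_num) (fun j g => g.nat 11 = e / n ^ j ∧ ∀ i < n, g.arr 2 i =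
        (((Finset.range j).filter fun s => dig n e s = i).card : ℝ))
      (fun j g x hg => by simpa using hg) (by simpa [e2] using a2)
      fun j _ g hF _ ⟨hg1, hg2⟩ => by
        have cg : Consts n d q L g := c2.of_frame hF rfl
        obtain ⟨dd, mm⟩ := divmod_spec cg hn (hg1 ▸ (Nat.div_le_self _ _).trans he)
        have cz := cg.run divmod rfl
        have g14 : g.arr 14 0 = 1 := by rw [hF.arr 14 rfl, o2]
        refine ⟨?_, fun i hi => ?_⟩
        · simp [hB, dd, hg1, Nat.div_div_eq_div_mul, pow_succ]
        · rw [hg1] at mm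
          have mm' : (divmod.run g).nat 13 = dig n e j := mm
          simp only [hB, run_seq, run_op, HState.writeArr_arr, mm', ROp.eval, divmod_arr,
            cz.eq_zero, g14]
          rw [Finset.range_add_one, Finset.filter_insert]
          by_cases hij : dig n e j = i
          · rw [hij, if_pos (by simp), if_pos rfl, hg2 i hi, Finset.card_insert_of_notMem (by simp)]
            push_cast
            ring
          · rw [if_neg (by simp [Ne.symm hij]), if_neg hij, hg2 i hi]
    rw [c2.eq_q] at this
    exact this.2
  set A : Cmd := .seq (.cast 13 7 2) <| .seq (.op .div 2 8 2 8 13 7) <| .seq (.sqrt 2 8 2 8) <|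
    .seq (.cast 13 7 0) <| .seq (.sqrt 13 7 13 7) <| .seq (.op .div 13 7 14 7 13 7) <|
    .op .add 2 8 2 8 13 7 with hA
  -- The array is rewritten in place: entries from j on still hold the digit counts.
  have := forN_induction (i := 8) (a := 0) (P := A) (h := h3) c3.eq_one rfl rfl
      (by norm_num) (by norm_num) (fun j g => (∀ i < j, g.arr 2 i = weightVal n q e i) ∧
        ∀ i, j ≤ i → g.arr 2 i = h3.arr 2 i)
      (fun j g x hg => hg) (by simp) ?_
  · rw [c3.eq_n] at this
    have hrun : weights.run h = (forN 8 0 A).run h3 := rfl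
    rw [hrun]
    exact this.1
  · intro j hj g hF hg8 hg
    rw [c3.eq_n] at hj
    have cg : Consts n d q L g := c3.of_frame hF rfl
    have g14 : g.arr 14 0 = 1 := by rw [hF.arr 14 rfl, o3]
    have gj : g.arr 2 j = _ := (hg.2 j le_rfl).trans (a3 j hj)
    have hrun : ∀ i, (A.run g).arr 2 i = if i = j then weightVal n q e j else g.arr 2 i := by
      intro i
      simp [hA, ROp.eval, cg.eq_zero, hg8, g14, gj, cg.eq_q, cg.eq_n, weightVal]
      split_ifs <;> rfl
    refine ⟨fun i hi => ?_, fun i hi => ?_⟩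
    · rw [hrun]
      split_ifs with hij
      · rw [hij]
      · exact hg.1 i (by omega)
    · rw [hrun, if_neg (by omega), hg.2 i (by omega)]

lemma mulM_spec (hc : Consts n d q L h) (hn : 0 < n) (hd : 2 ≤ d) (hL : n ^ d ≤ L) :
    ∀ i < n, (mulM.run h).arr 4 i = mulVal n d (h.arr 1) (h.arr 2) (h.arr 3) i := by
  set h1 := (forN 8 0 (.cast 4 8 7)).run h with hh1
  have F1 := frame_run (forN 8 0 (.cast 4 8 7)) h
  rw [← hh1] at F1
  have c1 : Consts n d q L h1 := hc.of_frame F1 rfl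
  have a1 : ∀ i < n, h1.arr 4 i = 0 := by
    have := forN_induction (i := 8) (a := 0) (P := .cast 4 8 7) (h := h) hc.eq_one rfl rfl
      (by norm_num) (by norm_num) (fun j g => ∀ i < j, g.arr 4 i = 0)
      (fun j g x hg => hg) (by simp) fun j _ g hF hg8 hg i hi => by
        have cg : Consts n d q L g := hc.of_frame hF rfl
        simp only [run_cast, hg8, cg.eq_zero, HState.writeArr_arr]
        split_ifs with h0
        · simp
        · exact hg i (by simp at h0; omega)
    rwa [hc.eq_n] at this
  set B : Cmd := .seq (entry 2) <| .seq (.op .mul 13 7 7 7 3 17) <|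
    .seq (.op .add 4 16 4 16 13 7) <| .seq (.op .mul 13 7 7 7 3 16) <| .op .add 4 17 4 17 13 7
    with hB
  have := forN_induction (i := 15) (a := 5) (P := B) (h := h1) c1.eq_one rfl rfl
      (by norm_num) (by norm_num) (fun j g => ∀ i < n, g.arr 4 i = ∑ a ∈ Finset.range j,
        ((if dig n a 0 = i then entVal n d (h.arr 1) (h.arr 2) a * h.arr 3 (dig n a 1) else 0) +
        if dig n a 1 = i then entVal n d (h.arr 1) (h.arr 2) a * h.arr 3 (dig n a 0) else 0))
      (fun j g x hg => hg) (by simpa using a1) ?_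
  · rw [c1.eq_D] at this
    exact this
  · intro j hj g hF hg15 hg i hi
    rw [c1.eq_D] at hj
    have cg : Consts n d q L g := c1.of_frame hF rfl
    obtain ⟨e1, e2, e3⟩ := entry_spec cg hn hd (k := 2) (by decide) (hg15 ▸ hj.le.trans hL)
    have FE := frame_run (entry 2) g
    have ce : Consts n d q L ((entry 2).run g) := cg.of_frame FE rfl
    rw [hg15] at e1 e2 e3
    rw [hF.arr 1 rfl, hF.arr 2 rfl, F1.arr 1 rfl, F1.arr 2 rfl] at e1
    have a3 : ((entry 2).run g).arr 3 = h.arr 3 := by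
      rw [FE.arr 3 rfl, hF.arr 3 rfl, F1.arr 3 rfl]
    have a4 : ((entry 2).run g).arr 4 = g.arr 4 := FE.arr 4 rfl
    rw [Finset.sum_range_succ, ← hg i hi]
    simp only [hB, run_seq]
    set g' := (entry 2).run g
    simp only [run_op, HState.writeArr_arr, HState.writeArr_nat, ROp.eval,
      ce.eq_zero, e1, e2, e3, a3, a4]
    simp
    -- The two updates hit the rows of the first two digits; if these coincide, both must count.
    by_cases h0 : dig n j 0 = i <;> by_cases h1 : dig n j 1 = i
    · simp [h0, h1, add_assoc]
    · simp [h0, h1, Ne.symm h1]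
    · simp [h0, h1, Ne.symm h0]
    · simp [h0, h1, Ne.symm h0, Ne.symm h1]

lemma evalX_spec (hc : Consts n d q L h) (hn : 0 < n) (hd : 2 ≤ d) (hL : n ^ d ≤ L) :
    (evalX.run h).arr 11 0 = evalVal n d (h.arr 1) (h.arr 5) := by
  set h1 := (cast 11 7 7).run h with hh1
  have F1 := frame_run (cast 11 7 7) h
  rw [← hh1] at F1
  have c1 : Consts n d q L h1 := hc.of_frame F1 rfl
  have a1 : h1.arr 11 0 = 0 := by simp [hh1, hc.eq_zero]
  set B : Cmd := .seq (entry 5) <| .seq (.op .mul 7 7 7 7 5 16) <|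
    .seq (.op .mul 7 7 7 7 5 17) <| .op .add 11 7 11 7 7 7
    with hB
  have := forN_induction (i := 15) (a := 5) (P := B) (h := h1) c1.eq_one rfl rfl
      (by norm_num) (by norm_num) (fun j g => g.arr 11 0 = ∑ a ∈ Finset.range j,
        entVal n d (h.arr 1) (h.arr 5) a * h.arr 5 (dig n a 0) * h.arr 5 (dig n a 1))
      (fun j g x hg => hg) (by simpa using a1) ?_
  · rw [c1.eq_D] at this
    exact this
  · intro j hj g hF hg15 hg
    rw [c1.eq_D] at hj
    have cg : Consts n d q L g := c1.of_frame hF rfl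
    obtain ⟨e1, e2, e3⟩ := entry_spec cg hn hd (k := 5) (by decide) (hg15 ▸ hj.le.trans hL)
    have FE := frame_run (entry 5) g
    have ce : Consts n d q L ((entry 5).run g) := cg.of_frame FE rfl
    rw [hg15] at e1 e2 e3
    rw [hF.arr 1 rfl, hF.arr 5 rfl, F1.arr 1 rfl, F1.arr 5 rfl] at e1
    have a5 : ((entry 5).run g).arr 5 = h.arr 5 := by
      rw [FE.arr 5 rfl, hF.arr 5 rfl, F1.arr 5 rfl]
    have a11 : ((entry 5).run g).arr 11 = g.arr 11 := FE.arr 11 rfl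
    rw [Finset.sum_range_succ, ← hg]
    simp only [hB, run_seq]
    set g' := (entry 5).run g
    simp only [run_op, HState.writeArr_arr, HState.writeArr_nat, ROp.eval,
      ce.eq_zero, e1, e2, e3, a5, a11]
    simp

lemma point_spec (hc : Consts n d q L h) : ∀ i < n, (point.run h).arr 5 i =
    (h.arr 2 i + h.arr 3 i / normVal n (h.arr 3) + h.arr 4 i / normVal n (h.arr 4)) /
      normVal n (fun i => h.arr 2 i + h.arr 3 i / normVal n (h.arr 3) +
        h.arr 4 i / normVal n (h.arr 4)) := by
  have n1 := norm_spec hc (s := 8) (k := 3) (by decide) (by decide) (by decide)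
  have F1 := frame_run (norm 8 3) h
  set h1 := (norm 8 3).run h
  have c1 : Consts n d q L h1 := hc.of_frame F1 rfl
  have n2 := norm_spec c1 (s := 9) (k := 4) (by decide) (by decide) (by decide)
  have F2 := frame_run (norm 9 4) h1
  set h2 := (norm 9 4).run h1 with hh2
  have c2 : Consts n d q L h2 := c1.of_frame F2 rfl
  rw [F1.arr 4 rfl] at n2
  rw [← F2.arr 8 rfl] at n1
  have a2 : h2.arr 2 = h.arr 2 := by rw [F2.arr 2 rfl, F1.arr 2 rfl]
  have a3 : h2.arr 3 = h.arr 3 := by rw [F2.arr 3 rfl, F1.arr 3 rfl]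
  have a4 : h2.arr 4 = h.arr 4 := by rw [F2.arr 4 rfl, F1.arr 4 rfl]
  set B : Cmd := .seq (.op .div 13 7 3 8 8 7) <| .seq (.op .add 5 8 2 8 13 7) <|
    .seq (.op .div 13 7 4 8 9 7) (.op .add 5 8 5 8 13 7) with hB
  set z : ℕ → ℝ := fun i => h.arr 2 i + h.arr 3 i / normVal n (h.arr 3) +
    h.arr 4 i / normVal n (h.arr 4) with hz
  have i3 := forN_induction (i := 8) (a := 0) (P := B) (h := h2) c2.eq_one rfl rfl
      (by norm_num) (by norm_num) (fun j g => ∀ i < j, g.arr 5 i = z i)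
      (fun j g x hg => hg) (by simp) fun j _ g hF hg8 hg i hi => by
        have cg : Consts n d q L g := c2.of_frame hF rfl
        have b2 : g.arr 2 = h.arr 2 := by rw [hF.arr 2 rfl, a2]
        have b3 : g.arr 3 = h.arr 3 := by rw [hF.arr 3 rfl, a3]
        have b4 : g.arr 4 = h.arr 4 := by rw [hF.arr 4 rfl, a4]
        have b8 : g.arr 8 0 = normVal n (h.arr 3) := by rw [hF.arr 8 rfl, n1]
        have b9 : g.arr 9 0 = normVal n (h.arr 4) := by rw [hF.arr 9 rfl, n2]
        simp only [hB, run_seq, run_op, HState.writeArr_arr, HState.writeArr_nat, ROp.eval,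
          cg.eq_zero, hg8, b2, b3, b4, b8, b9]
        simp
        by_cases hij : i = j
        · simp [hij, hz]
        · simp [hij, hg i (by omega)]
  set h3 := (forN 8 0 B).run h2 with hh3
  have F3 := frame_run (forN 8 0 B) h2
  rw [← hh3] at F3
  have c3 : Consts n d q L h3 := c2.of_frame F3 rfl
  rw [c2.eq_n] at i3
  have n4 := norm_spec c3 (s := 10) (k := 5) (by decide) (by decide) (by decide)
  rw [normVal_congr i3] at n4
  have F4 := frame_run (norm 10 5) h3
  set h4 := (norm 10 5).run h3 with hh4
  have c4 : Consts n d q L h4 := c3.of_frame F4 rfl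
  have a5 : h4.arr 5 = h3.arr 5 := F4.arr 5 rfl
  have i5 := forN_induction (i := 8) (a := 0) (P := .op .div 5 8 5 8 10 7) (h := h4) c4.eq_one rfl
      rfl (by norm_num) (by norm_num) (fun j g => (∀ i < j, g.arr 5 i = h3.arr 5 i / normVal n z) ∧
        ∀ i, j ≤ i → g.arr 5 i = h3.arr 5 i)
      (fun j g x hg => hg) (by simp [a5]) fun j _ g hF hg8 hg => by
        have cg : Consts n d q L g := c4.of_frame hF rfl
        have b10 : g.arr 10 0 = normVal n z := by rw [hF.arr 10 rfl, n4]
        have hr : ∀ i, ((op .div 5 8 5 8 10 7).run g).arr 5 i =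
            if i = j then h3.arr 5 j / normVal n z else g.arr 5 i := fun i => by
          simp [ROp.eval, cg.eq_zero, hg8, b10, hg.2 j le_rfl]
        refine ⟨fun i hi => ?_, fun i hi => ?_⟩
        · rw [hr]
          split_ifs with hij
          · rw [hij]
          · exact hg.1 i (by omega)
        · rw [hr, if_neg (by omega), hg.2 i (by omega)]
  rw [c4.eq_n] at i5
  intro i hi
  have := i5.1 i hi
  rw [i3 i hi] at this
  exact this

lemma copy_spec (hc : Consts n d q L h) {k l : Fin 16} (hkl : l ≠ k) (hk : k ≠ 13) (hl : l ≠ 13) :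
    ∀ i < n, ((copy k l).run h).arr k i = h.arr l i := by
  have := forN_induction (i := 8) (a := 0) (P := .seq (.cast 13 7 7) (.op .add k 8 l 8 13 7))
    (h := h) hc.eq_one rfl rfl (by norm_num) (by norm_num) (fun j g => ∀ i < j,
      g.arr k i = h.arr l i) (fun j g x hg => hg) (by simp) fun j _ g hF hg8 hg i hi => by
        have cg : Consts n d q L g := hc.of_frame hF rfl
        have gl : g.arr l = h.arr l := hF.arr l (by simp [forN, modA, hkl, hl])
        simp [cg.eq_zero, hg8, gl, ROp.eval, hk, hl]
        split_ifs with hij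
        · rw [hij]
        · exact hg i (by omega)
  rwa [hc.eq_n] at this

end Cmd

end RealRAM

/-! ### Correctness of the search for the best test point. -/

namespace RealRAM

namespace Cmd

variable {n d q L : ℕ} {h : HState}

/-- The value of the polynomial at a test point. -/
noncomputable def testVal (n d q : ℕ) (C : ℕ → ℝ) (e t : ℕ) : ℝ :=
  evalVal n d C (candVal n d q C e t)

/-- Array `6` holds the best of the test points in `S`, and array `12` its value. -/
structure Best (n d q : ℕ) (C : ℕ → ℝ) (S : ℕ → ℕ → Prop) (h : HState) : Prop where
  mem : h.arr 12 0 = -1 ∨ ∃ e t, (∀ i < n, h.arr 6 i = candVal n d q C e t i) ∧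
    h.arr 12 0 = testVal n d q C e t
  le : ∀ e t, S e t → testVal n d q C e t ≤ h.arr 12 0

lemma Best.congr {C : ℕ → ℝ} {S : ℕ → ℕ → Prop} {g : HState} (hb : Best n d q C S h)
    (h6 : g.arr 6 = h.arr 6) (h12 : g.arr 12 = h.arr 12) : Best n d q C S g :=
  ⟨by rw [h6, h12]; exact hb.mem, by rw [h12]; exact hb.le⟩

/-- Replace the best test point by the current one if the latter is better. -/
lemma update_spec (hc : Consts n d q L h) {e t : ℕ} {C : ℕ → ℝ} {S : ℕ → ℕ → Prop}
    (hb : Best n d q C S h) (hv : h.arr 11 0 = testVal n d q C e t)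
    (hx : ∀ i < n, h.arr 5 i = candVal n d q C e t i) :
    Best n d q C (fun e' t' => S e' t' ∨ e' = e ∧ t' = t)
      ((ifR 11 7 12 7 skip (.seq (copy 6 5) (.seq (.cast 13 7 7)
        (.op .add 12 7 11 7 13 7)))).run h) := by
  rw [run_ifR, hc.eq_zero, hv]
  split_ifs with hle
  · refine ⟨hb.mem, fun e' t' hS => ?_⟩
    rcases hS with hS | ⟨rfl, rfl⟩
    · exact hb.le _ _ hS
    · exact hle
  · have Fc := frame_run (copy 6 5) h
    have cc : Consts n d q L ((copy 6 5).run h) := hc.of_frame Fc rfl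
    have sc := copy_spec hc (k := 6) (l := 5) (by decide) (by decide) (by decide)
    rw [run_seq]
    generalize (copy 6 5).run h = g at *
    have a11 : g.arr 11 0 = testVal n d q C e t := by rw [Fc.arr 11 rfl, hv]
    have e12 : ((seq (.cast 13 7 7) (.op .add 12 7 11 7 13 7)).run g).arr 12 0 =
        testVal n d q C e t := by
      simp [cc.eq_zero, ROp.eval, a11]
    refine ⟨Or.inr ⟨e, t, fun i hi => ?_, e12⟩, fun e' t' hS => ?_⟩
    · simp [sc i hi, hx i hi]
    · rw [e12]
      rcases hS with hS | ⟨rfl, rfl⟩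
      · exact (hb.le _ _ hS).trans (not_le.1 hle).le
      · exact le_rfl

lemma round_spec (hc : Consts n d q L h) (hn : 0 < n) (hd : 2 ≤ d) (hL : n ^ d ≤ L) {e t : ℕ}
    {C : ℕ → ℝ} (hC : h.arr 1 = C) (hW : ∀ i < n, h.arr 2 i = weightVal n q e i)
    (hY : ∀ i < n, h.arr 3 i = iterVal n d C (weightVal n q e) t i) {S : ℕ → ℕ → Prop}
    (hb : Best n d q C S h) :
    (∀ i < n, (round.run h).arr 3 i = iterVal n d C (weightVal n q e) (t + 1) i) ∧
      Best n d q C (fun e' t' => S e' t' ∨ e' = e ∧ t' = t) (round.run h) := by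
  have s1 := mulM_spec hc hn hd hL
  have F1 := frame_run mulM h
  set h1 := mulM.run h
  have c1 : Consts n d q L h1 := hc.of_frame F1 rfl
  have y1 : ∀ i < n, h1.arr 4 i = iterVal n d C (weightVal n q e) (t + 1) i := fun i hi => by
    rw [s1 i hi, hC, iterVal, mulVal_congr hn hW hY]
  have s2 := point_spec c1
  have F2 := frame_run point h1
  set h2 := point.run h1
  have c2 : Consts n d q L h2 := c1.of_frame F2 rfl
  have w1 : ∀ i < n, h1.arr 2 i = weightVal n q e i := by rwa [F1.arr 2 rfl]
  have z1 : ∀ i < n, h1.arr 3 i = iterVal n d C (weightVal n q e) t i := by rwa [F1.arr 3 rfl]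
  have x2 : ∀ i < n, h2.arr 5 i = candVal n d q C e t i := fun i hi => by
    have hs : ∀ i < n, h1.arr 2 i + h1.arr 3 i / normVal n (h1.arr 3) +
        h1.arr 4 i / normVal n (h1.arr 4) = sumVal n d C (weightVal n q e) t i := fun i hi => by
      rw [w1 i hi, z1 i hi, y1 i hi, normVal_congr z1, normVal_congr y1, sumVal]
    rw [s2 i hi, hs i hi, normVal_congr hs, candVal]
  have s3 := evalX_spec c2 hn hd hL
  have F3 := frame_run evalX h2
  set h3 := evalX.run h2
  have c3 : Consts n d q L h3 := c2.of_frame F3 rfl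
  rw [F2.arr 1 rfl, F1.arr 1 rfl, hC, evalVal_congr hn x2] at s3
  have b3 : Best n d q C S h3 := hb.congr
    (by rw [F3.arr 6 rfl, F2.arr 6 rfl, F1.arr 6 rfl])
    (by rw [F3.arr 12 rfl, F2.arr 12 rfl, F1.arr 12 rfl])
  have x3 : ∀ i < n, h3.arr 5 i = candVal n d q C e t i := by rwa [F3.arr 5 rfl]
  set I : Cmd := .ifR 11 7 12 7 skip (.seq (copy 6 5) (.seq (.cast 13 7 7)
    (.op .add 12 7 11 7 13 7))) with hI
  have F4 := frame_run I h3
  have b4 := update_spec c3 b3 s3 x3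
  rw [← hI] at b4
  set h4 := I.run h3
  have c4 : Consts n d q L h4 := c3.of_frame F4 rfl
  have F5 := frame_run (copy 3 4) h4
  have s5 := copy_spec c4 (k := 3) (l := 4) (by decide) (by decide) (by decide)
  have hrun : round.run h = (copy 3 4).run h4 := rfl
  rw [hrun]
  refine ⟨fun i hi => ?_, b4.congr (F5.arr 6 rfl) (F5.arr 12 rfl)⟩
  rw [s5 i hi, F4.arr 4 rfl, F3.arr 4 rfl, F2.arr 4 rfl, y1 i hi]

theorem search_spec (hc : Consts n d q L h) (hn : 0 < n) (hd : 2 ≤ d) (hL : n ^ d ≤ L) :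
    Best n d q (h.arr 1) (fun e t => e < L ∧ t < n) (search.run h) := by
  set C := h.arr 1 with hC
  set J : Cmd := .seq (.cast 14 7 3) <| .seq (.cast 13 7 7) (.op .sub 12 7 13 7 14 7) with hJ
  have F1 := frame_run J h
  set h1 := J.run h with hh1
  have c1 : Consts n d q L h1 := hc.of_frame F1 rfl
  -- A sentinel below every test value, as these are non-negative for non-negative coefficients.
  have a12 : h1.arr 12 0 = -1 := by simp [hh1, hJ, hc.eq_zero, hc.eq_one, ROp.eval]
  set B : Cmd := .seq weights <| .seq (forN 8 0 (.cast 3 8 3)) <| forN 14 0 round with hB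
  have hrun : search.run h = (forN 9 4 B).run h1 := rfl
  rw [hrun]
  have := forN_induction (i := 9) (a := 4) (P := B) (h := h1) c1.eq_one rfl rfl (by norm_num)
    (by norm_num) (fun j g => Best n d q C (fun e t => e < j ∧ t < n) g)
    (fun j g x hg => hg.congr rfl rfl) ⟨Or.inl a12, fun e t H => absurd H.1 (by omega)⟩ ?_
  · rwa [c1.eq_L] at this
  · intro e he g hF hg9 hg
    rw [c1.eq_L] at he
    have cg : Consts n d q L g := c1.of_frame hF rfl
    have g1 : g.arr 1 = C := by rw [hF.arr 1 rfl, F1.arr 1 rfl]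
    have s2 := weights_spec cg hn (hg9 ▸ he.le)
    rw [hg9] at s2
    have F2 := frame_run weights g
    set g2 := weights.run g
    have c2 : Consts n d q L g2 := cg.of_frame F2 rfl
    have s3 := forN_induction (i := 8) (a := 0) (P := .cast 3 8 3) (h := g2) c2.eq_one rfl rfl
      (by norm_num) (by norm_num) (fun j g => ∀ i < j, g.arr 3 i = 1)
      (fun j g x hg => hg) (by simp) fun j _ g hF hg8 hg i hi => by
        have cg : Consts n d q L g := c2.of_frame hF rfl
        simp [hg8, cg.eq_one]
        intro hij
        exact hg i (by omega)
    rw [c2.eq_n] at s3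
    have F3 := frame_run (forN 8 0 (.cast 3 8 3)) g2
    set g3 := (forN 8 0 (.cast 3 8 3)).run g2
    have c3 : Consts n d q L g3 := c2.of_frame F3 rfl
    -- The pairs tested so far form an initial segment in lexicographic order, while array 3 carries
    -- the current iterate.
    have s4 := forN_induction (i := 14) (a := 0) (P := round) (h := g3) c3.eq_one rfl rfl
      (by norm_num) (by norm_num)
      (fun j k => (∀ i < n, k.arr 3 i = iterVal n d C (weightVal n q e) j i) ∧
        Best n d q C (fun e' t' => (e' < e ∧ t' < n) ∨ (e' = e ∧ t' < j)) k)
      (fun j g x hg => ⟨hg.1, hg.2.congr rfl rfl⟩) ?_ ?_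
    · rw [c3.eq_n] at s4
      refine ⟨s4.2.mem, fun e' t' H => s4.2.le e' t' ?_⟩
      rcases Nat.lt_succ_iff_lt_or_eq.1 H.1 with h' | h'
      exacts [Or.inl ⟨h', H.2⟩, Or.inr ⟨h', H.2⟩]
    · refine ⟨fun i hi => by rw [s3 i hi, iterVal], ?_⟩
      have hb : Best n d q C (fun e' t' => e' < e ∧ t' < n) g3 := hg.congr
        (by rw [F3.arr 6 rfl, F2.arr 6 rfl]) (by rw [F3.arr 12 rfl, F2.arr 12 rfl])
      exact ⟨hb.mem, fun e' t' H => hb.le e' t' (H.resolve_right (by omega))⟩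
    · intro j hj k hFk _ hk
      have ck : Consts n d q L k := c3.of_frame hFk rfl
      have k1 : k.arr 1 = C := by rw [hFk.arr 1 rfl, F3.arr 1 rfl, F2.arr 1 rfl, g1]
      have k2 : ∀ i < n, k.arr 2 i = weightVal n q e i := by
        rwa [hFk.arr 2 rfl, F3.arr 2 rfl]
      obtain ⟨r1, r2⟩ := round_spec ck hn hd hL k1 k2 hk.1 hk.2
      refine ⟨r1, r2.mem, fun e' t' H => r2.le e' t' ?_⟩
      rcases H with H | ⟨H1, H2⟩
      · exact Or.inl (Or.inl H)
      · rcases Nat.lt_succ_iff_lt_or_eq.1 H2 with h' | h'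
        exacts [Or.inl (Or.inr ⟨H1, h'⟩), Or.inr ⟨H1, h'⟩]

end Cmd

end RealRAM

/-! ### Setup of the constants, data movement and the assembled program. -/

namespace RealRAM

namespace Cmd

/-- Counter `r` becomes the power of counter `b` with exponent in counter `e`. -/
def pow (r b e : ℕ) : Cmd :=
  .seq (.set r 1) (.loop e (.seq (.set 20 0) (.seq (.loop b (.add 20 20 r)) (.add r 20 7))))

/-- Multiplication of counters by repeated addition. -/
lemma loop_add_run (r b : ℕ) (hr : r ≠ 20) (h : HState) (h0 : h.nat 20 = 0) :
    (loop b (add 20 20 r)).run h = h.writeNat 20 (h.nat b * h.nat r) := by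
  rw [run_loop]
  generalize h.nat b = j
  induction j with
  | zero =>
    simp only [Function.iterate_zero, id_eq, zero_mul]
    have : Function.update h.nat 20 0 = h.nat := by rw [← h0, Function.update_eq_self]
    simp [HState.writeNat, this]
  | succ j ih =>
    rw [Function.iterate_succ_apply', ih]
    simp only [run_add, HState.writeNat_nat, if_true, if_neg hr]
    simp [HState.writeNat, add_mul]

lemma pow_spec {r b e : ℕ} (hr : r ≠ 20) (hr7 : r ≠ 7) (hb : b ≠ 20) (hbr : b ≠ r)
    (her : e ≠ r) {h : HState} (hz : h.nat 7 = 0) :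
    ((pow r b e).run h).nat r = h.nat b ^ h.nat e := by
  simp only [pow, run_seq, run_set, run_loop, HState.writeNat_nat, if_neg her]
  have key : ∀ j, ((seq (set 20 0) (seq (loop b (add 20 20 r)) (add r 20 7))).run^[j]
      (h.writeNat r 1)).nat r = h.nat b ^ j := by
    intro j
    have hF := frame_iterate (frame_run (seq (set 20 0) (seq (loop b (add 20 20 r)) (add r 20 7))))
    induction j with
    | zero => simp
    | succ j ih =>
      rw [Function.iterate_succ_apply']
      have F := hF j (h.writeNat r 1)
      generalize (seq (set 20 0) (seq (loop b (add 20 20 r)) (add r 20 7))).run^[j]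
        (h.writeNat r 1) = g at *
      have gb : g.nat b = h.nat b := by
        rw [F.nat b (by simp [modN, hb, hbr])]; simp [hbr]
      have g7 : g.nat 7 = 0 := by
        rw [F.nat 7 (by simp [modN, hr7.symm])]; simp [hr7.symm, hz]
      rw [run_seq, run_seq, loop_add_run r b hr _ (by simp)]
      simp [hr, hb, ih, gb, g7, pow_succ, mul_comm]
  exact key _

/-- The computation of the constants of the search. -/
def setup : Cmd :=
  .seq (.set 3 1) <| .seq (.set 7 0) <| .seq (pow 4 0 2) <| .seq (pow 5 0 1) <|
    .seq (.set 22 2) (.sub 6 1 22)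

lemma setup_spec (h : HState) :
    Consts (h.nat 0) (h.nat 1) (h.nat 2) (h.nat 0 ^ h.nat 2) (setup.run h) := by
  simp only [setup, run_seq, run_set]
  have p1 := pow_spec (r := 4) (b := 0) (e := 2) (by norm_num) (by norm_num) (by norm_num)
    (by norm_num) (by norm_num) (h := (h.writeNat 3 1).writeNat 7 0) (by simp)
  have F1 := frame_run (pow 4 0 2) ((h.writeNat 3 1).writeNat 7 0)
  generalize (pow 4 0 2).run ((h.writeNat 3 1).writeNat 7 0) = g at *
  have p2 := pow_spec (r := 5) (b := 0) (e := 1) (by norm_num) (by norm_num) (by norm_num)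
    (by norm_num) (by norm_num) (h := g) (by rw [F1.nat 7 rfl]; simp)
  have F2 := frame_run (pow 5 0 1) g
  generalize (pow 5 0 1).run g = k at *
  have n0 : g.nat 0 = h.nat 0 := by rw [F1.nat 0 rfl]; simp
  have n1 : g.nat 1 = h.nat 1 := by rw [F1.nat 1 rfl]; simp
  have n2 : g.nat 2 = h.nat 2 := by rw [F1.nat 2 rfl]; simp
  have n3 : g.nat 3 = 1 := by rw [F1.nat 3 rfl]; simp
  have n7 : g.nat 7 = 0 := by rw [F1.nat 7 rfl]; simp
  have m := F2.nat
  constructor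
  · simpa [m 0 rfl] using n0
  · simpa [m 2 rfl] using n2
  · simpa [m 3 rfl] using n3
  · simpa [m 4 rfl] using p1
  · simpa [n0, n1] using p2
  · simp [m 1 rfl, n1]
  · simpa [m 7 rfl] using n7

end Cmd

/-- Move a block of real numbers between consecutive cells and cells with distance sixteen. -/
def moveLoop (c r a : ℕ) : Program :=
  .loop c (.seq (.addReal r a 7) (.seq (.addNat 4 4 5) (.addNat 3 3 11)))

/-- A real number is copied by adding to it the zero in the cell addressed by counter cell 7. `p`
and `p'` list targets and sources, so one statement covers both directions. `h7` protects the zero,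
and `hpp` protects sources from being overwritten. -/
lemma moveLoop_spec {c r a b m : ℕ} {s : State} (hm : s.nat c = m) (h3 : s.nat 3 = 0)
    (h4 : s.nat 4 = b) (h5 : s.nat 5 = 16) (h11 : s.nat 11 = 1)
    (hz : s.real (s.nat 7) = 0) (p p' : ℕ → ℕ)
    (hp : ∀ s' : State, ∀ j, s'.nat 3 = j → s'.nat 4 = b + 16 * j → s'.nat r = p j)
    (hp' : ∀ s' : State, ∀ j, s'.nat 3 = j → s'.nat 4 = b + 16 * j → s'.nat a = p' j)
    (hinj : Function.Injective p) (h7 : ∀ j < m, p j ≠ s.nat 7)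
    (hpp : ∀ i < m, ∀ j < m, p i ≠ p' j) :
    (∀ x, x ≠ 3 → x ≠ 4 → ((moveLoop c r a).run s).nat x = s.nat x) ∧
      (∀ j < m, ((moveLoop c r a).run s).real (p j) = s.real (p' j)) ∧
      ∀ x, (∀ j < m, x ≠ p j) → ((moveLoop c r a).run s).real x = s.real x := by
  set B : Program := .seq (.addReal r a 7) (.seq (.addNat 4 4 5) (.addNat 3 3 11)) with hB
  have key : ∀ j ≤ m, (B.run^[j] s).nat 3 = j ∧ (B.run^[j] s).nat 4 = b + 16 * j ∧
      (∀ x, x ≠ 3 → x ≠ 4 → (B.run^[j] s).nat x = s.nat x) ∧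
      (∀ i < j, (B.run^[j] s).real (p i) = s.real (p' i)) ∧
      ∀ x, (∀ i < j, x ≠ p i) → (B.run^[j] s).real x = s.real x := by
    intro j
    induction j with
    | zero => intro _; simp [h3, h4]
    | succ j ih =>
      intro hj
      obtain ⟨i3, i4, ix, ip, io⟩ := ih (by omega)
      rw [Function.iterate_succ_apply']
      generalize B.run^[j] s = g at *
      have er : g.nat r = p j := hp g j i3 i4
      have ea : g.nat a = p' j := hp' g j i3 i4
      have e7 : g.nat 7 = s.nat 7 := ix 7 (by norm_num) (by norm_num)
      have ez : g.real (s.nat 7) = 0 := by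
        rw [io _ fun i hi => (h7 i (by omega)).symm, hz]
      have es : g.real (p' j) = s.real (p' j) := io _ fun i hi => (hpp i (by omega) j hj).symm
      have hreal : (B.run g).real = Function.update g.real (p j) (s.real (p' j)) := by
        simp [hB, Program.run, State.writeNat, State.writeReal, er, ea, e7, ez, es]
      refine ⟨?_, ?_, fun x hx3 hx4 => ?_, fun i hi => ?_, fun x hx => ?_⟩
      · have : g.nat 11 = 1 := by rw [ix 11 (by norm_num) (by norm_num), h11]
        simp [hB, Program.run, State.writeNat, State.writeReal, i3, this]
      · have : g.nat 5 = 16 := by rw [ix 5 (by norm_num) (by norm_num), h5]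
        simp [hB, Program.run, State.writeNat, State.writeReal, i4, this]
        ring
      · simp [hB, Program.run, State.writeNat, State.writeReal, hx3, hx4,
          ix x hx3 hx4]
      · rw [hreal]
        rcases Nat.lt_succ_iff_lt_or_eq.1 hi with h | rfl
        · rw [Function.update_of_ne (fun H => by have := hinj H; omega), ip i h]
        · rw [Function.update_self]
      · rw [hreal, Function.update_of_ne (hx j (by omega)), io x fun i hi => hx i (by omega)]
  have := key m le_rfl
  have e : (moveLoop c r a).run s = B.run^[m] s := by rw [← hm]; rfl
  rw [e]
  exact ⟨this.2.2.1, this.2.2.2.1, this.2.2.2.2⟩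

lemma moveLoop_steps (c r a : ℕ) (s : State) :
    (moveLoop c r a).steps s = 1 + s.nat c * 4 := by
  simp [moveLoop, Program.steps]

lemma steps_seq (P Q : Program) (s : State) :
    (Program.seq P Q).steps s = P.steps s + Q.steps (P.run s) := rfl

lemma run_seq (P Q : Program) (s : State) : (Program.seq P Q).run s = Q.run (P.run s) := rfl

/-- Prepare the movement of a block that starts at entry zero of array `k`. -/
def moveInit (k : ℕ) : Program :=
  .seq (.setNat 3 0) (.seq (.setNat 5 k) (.seq (.addNat 4 7 5) (.setNat 5 16)))

/-- Copy the counters of the input to the counters of the named memory. -/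
def inputCounters : Program :=
  .seq (.addNat 8 0 3) (.seq (.addNat 9 1 3) (.addNat 10 2 3))

/-- Set the start of the arrays. -/
def arrayStart : Program := .seq (.setNat 3 0) (.addNat 7 13 3)

lemma arrayStart_steps (s : State) : arrayStart.steps s = 2 := rfl

/-- The rounding program. -/
def roundingProgram : Program :=
  .seq inputCounters <| .seq Cmd.setup.compile <|
  .seq arrayStart <| .seq (moveInit 1) <| .seq (moveLoop 7 4 3) <|
  .seq Cmd.search.compile <| .seq (moveInit 6) <| moveLoop 8 3 4

lemma moveInit_steps (k : ℕ) (s : State) : (moveInit k).steps s = 4 := rfl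

lemma inputCounters_steps (s : State) : inputCounters.steps s = 3 := rfl

lemma moveInit_nat (k : ℕ) (s : State) (x : ℕ) : ((moveInit k).run s).nat x =
    if x = 5 then 16 else if x = 4 then s.nat 7 + k else if x = 3 then 0 else s.nat x := by
  simp only [moveInit, Program.run, State.writeNat, Function.update_apply]
  split_ifs <;> simp_all

lemma steps_arith (K₁ K₂ Y a b D n : ℕ) (hY2 : 2 ≤ Y) (ha : a ≤ K₁ * (Y + 1) ^ K₁)
    (hb : b ≤ K₂ * (Y + 1) ^ K₂) (hD : D ≤ Y) (hn : n ≤ Y) :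
    3 + (a + (2 + (4 + ((1 + D * 4) + (b + (4 + (1 + n * 4))))))) ≤
      Y ^ (3 * K₁ + 3 * K₂ + 9) := by
  have hK : ∀ K, K * (Y + 1) ^ K ≤ Y ^ (3 * K) := fun K => by
    have h1 : K ≤ Y ^ K := (Nat.lt_two_pow_self (n := K)).le.trans (Nat.pow_le_pow_left hY2 K)
    have h2 : (Y + 1) ^ K ≤ (Y ^ 2) ^ K := Nat.pow_le_pow_left (by nlinarith) K
    calc K * (Y + 1) ^ K ≤ Y ^ K * (Y ^ 2) ^ K := Nat.mul_le_mul h1 h2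
      _ = Y ^ (3 * K) := by ring
  have h1 := ha.trans (hK K₁)
  have h2 := hb.trans (hK K₂)
  rw [pow_add, pow_add]
  have g1 : 1 ≤ Y ^ (3 * K₁) := Nat.one_le_pow _ _ (by omega)
  have g2 : 1 ≤ Y ^ (3 * K₂) := Nat.one_le_pow _ _ (by omega)
  have g3 : 256 * Y ≤ Y ^ 9 := by
    calc 256 * Y = 2 ^ 8 * Y := by norm_num
      _ ≤ Y ^ 8 * Y := Nat.mul_le_mul_right _ (Nat.pow_le_pow_left hY2 8)
      _ = Y ^ 9 := by ring
  generalize Y ^ (3 * K₁) = x at *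
  generalize Y ^ (3 * K₂) = y at *
  calc _ ≤ x + y + 24 * Y := by omega
    _ ≤ x * y * (256 * Y) := by
      have g4 : x ≤ x * y := Nat.le_mul_of_pos_right _ g2
      have g5 : y ≤ x * y := Nat.le_mul_of_pos_left _ g1
      generalize x * y = z at *
      nlinarith
    _ ≤ _ := Nat.mul_le_mul_left _ g3

/-- Since d ≤ q, every loop bound is at most n^q, and a cost polynomial in n^q is n^O(q); constants
are absorbed because n^q ≥ 2. The arrays start at D = n^d, directly behind the input. -/
theorem roundingProgram_spec : ∃ K : ℕ, ∀ (n d q : ℕ) (s : State), 2 ≤ d → d ≤ q → q ≤ n →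
    (∀ x, s.nat x = if x = 0 then n else if x = 1 then d else if x = 2 then q else 0) →
    (∀ a, n ^ d ≤ a → s.real a = 0) →
    roundingProgram.steps s ≤ n ^ (K * q) ∧
    ∃ h : HState, Cmd.Best n d q s.real (fun e t => e < n ^ q ∧ t < n) h ∧
      ∀ i < n, (roundingProgram.run s).real i = h.arr 6 i := by
  obtain ⟨K₁, hK₁⟩ := Cmd.exists_cost_le Cmd.setup
  obtain ⟨K₂, hK₂⟩ := Cmd.exists_cost_le Cmd.search
  refine ⟨3 * K₁ + 3 * K₂ + 9, fun n d q s hd hdq hqn hs0 hreal => ?_⟩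
  have hn : 0 < n := by omega
  have hnL : n ≤ n ^ q := Nat.le_self_pow (by omega) n
  have hDL : n ^ d ≤ n ^ q := Nat.pow_le_pow_right hn hdq
  have hnD : n ≤ n ^ d := Nat.le_self_pow (by omega) n
  set D := n ^ d with hD
  -- the counters of the input
  set s1 := inputCounters.run s with hs1
  have r1 : s1.real = s.real := rfl
  have n1 : ∀ x, s1.nat x = if x = 10 then q else if x = 9 then d else if x = 8 then n else
      s.nat x := fun x => by
    simp only [hs1, inputCounters, Program.run, State.writeNat, Function.update_apply, hs0]
    norm_num
  set k1 : HState := ⟨fun r => s1.nat (r + 8), fun k i => s1.real (0 + 16 * i + k)⟩ with hk1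
  -- The base D is not yet computed. Base 0 overlays the arrays on the input, which is harmless
  -- because the setup changes no array.
  have sim1 : Cmd.Sim 0 s1 k1 := ⟨by rw [n1, hs0]; norm_num, fun _ => rfl, fun _ _ => rfl⟩
  have k10 : k1.nat 0 = n := by simp [hk1, n1]
  have k11 : k1.nat 1 = d := by simp [hk1, n1]
  have k12 : k1.nat 2 = q := by simp [hk1, n1]
  -- the constants of the search
  have sim2 := sim1.run Cmd.setup
  have st2 : Cmd.setup.compile.steps s1 ≤ Cmd.setup.cost (n ^ q) :=
    sim1.steps_le [0, 1, 2] Cmd.setup (by simp [Cmd.setup, Cmd.pow, Cmd.LoopsIn])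
      (by simp [Cmd.setup, Cmd.pow, Cmd.modN]) (by
        simp only [List.forall_mem_cons, k10, k11, k12]
        exact ⟨hnL, by omega, by omega, by simp⟩)
  have c2 := Cmd.setup_spec k1
  rw [k10, k11, k12] at c2
  have F2 := Cmd.frame_run Cmd.setup k1
  set s2 := Cmd.setup.compile.run s1 with hs2
  have r2 : s2.real = s.real := by
    ext a
    have h1 := sim2.arr ⟨a % 16, Nat.mod_lt _ (by norm_num)⟩ (a / 16)
    rw [F2.arr _ (by simp [Cmd.setup, Cmd.pow, Cmd.modA])] at h1
    have h2 : 0 + 16 * (a / 16) + a % 16 = a := by omega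
    simp only [hk1, h2] at h1
    rw [h1, r1]
  have n2 : ∀ x, s2.nat (x + 8) = (Cmd.setup.run k1).nat x := sim2.nat
  -- the start of the arrays
  set s3 := arrayStart.run s2 with hs3
  have r3 : s3.real = s.real := r2
  have n3 : ∀ x, s3.nat x = if x = 7 then D else if x = 3 then 0 else s2.nat x := fun x => by
    have : s2.nat 13 = D := (n2 5).trans c2.eq_D
    simp [hs3, arrayStart, Program.run, State.writeNat, Function.update_apply, this]
  -- the coefficients
  set s4 := (moveInit 1).run s3 with hs4
  have r4 : s4.real = s.real := r3
  have n4 := moveInit_nat 1 s3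
  rw [← hs4] at n4
  have n47 : s4.nat 7 = D := by simp [n4, n3]
  have m5 := moveLoop_spec (c := 7) (r := 4) (a := 3) (b := D + 1) (m := D) (s := s4) n47
    (by simp [n4]) (by simp [n4, n3]) (by simp [n4])
    (by rw [n4, n3]; norm_num; exact (n2 3).trans c2.eq_one)
    (by rw [n47, r4]; exact hreal D le_rfl) (fun j => D + 1 + 16 * j) (fun j => j)
    (fun _ _ _ h => h) (fun _ _ h _ => h) (fun x y h => by simpa using h)
    (fun j _ => by rw [n47]; omega) (fun i _ j hj => by omega)
  obtain ⟨n5, p5, o5⟩ := m5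
  have st5 := moveLoop_steps 7 4 3 s4
  rw [n47] at st5
  rw [r4] at p5 o5
  set s5 := (moveLoop 7 4 3).run s4 with hs5
  set k5 : HState := ⟨fun r => s5.nat (r + 8), fun k i => s5.real (D + 16 * i + k)⟩ with hk5
  have sim5 : Cmd.Sim D s5 k5 :=
    ⟨by rw [n5 7 (by norm_num) (by norm_num), n47], fun _ => rfl, fun _ _ => rfl⟩
  have nk5 : ∀ r, k5.nat r = (Cmd.setup.run k1).nat r := fun r => by
    simp only [hk5]
    rw [n5 _ (by omega) (by omega), n4, if_neg (by omega), if_neg (by omega), if_neg (by omega),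
      n3, if_neg (by omega), if_neg (by omega), n2]
  have c5 : Cmd.Consts n d q (n ^ q) k5 :=
    ⟨by rw [nk5, c2.eq_n], by rw [nk5, c2.eq_q], by rw [nk5, c2.eq_one], by rw [nk5, c2.eq_L],
      by rw [nk5, c2.eq_D], by rw [nk5, c2.eq_d], by rw [nk5, c2.eq_zero]⟩
  have a5 : k5.arr 1 = s.real := by
    ext i
    change s5.real (D + 16 * i + 1) = s.real i
    by_cases hi : i < D
    · rw [← p5 i hi]; congr 1; ring
    · rw [o5 _ fun j hj => by omega, hreal _ (by omega), hreal _ (by omega)]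
  -- the search
  have best := Cmd.search_spec c5 hn hd hDL
  rw [a5] at best
  have sim6 := sim5.run Cmd.search
  have st6 : Cmd.search.compile.steps s5 ≤ Cmd.search.cost (n ^ q) :=
    sim5.steps_le [0, 2, 4, 5, 6] Cmd.search
      (by simp [Cmd.search, Cmd.weights, Cmd.round, Cmd.mulM, Cmd.point, Cmd.evalX, Cmd.copy,
        Cmd.norm, Cmd.entry, Cmd.divmod, Cmd.forN, Cmd.skip, Cmd.LoopsIn])
      (by decide) (by
        simp only [List.forall_mem_cons, c5.eq_n, c5.eq_q, c5.eq_L, c5.eq_D, c5.eq_d]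
        exact ⟨hnL, by omega, le_rfl, hDL, by omega, by simp⟩)
  have F6 := Cmd.frame_run Cmd.search k5
  set s6 := Cmd.search.compile.run s5 with hs6
  -- the output
  set s7 := (moveInit 6).run s6 with hs7
  have r7 : s7.real = s6.real := rfl
  have n7 := moveInit_nat 6 s6
  rw [← hs7] at n7
  have n77 : s7.nat 7 = D := by simp [n7, sim6.base]
  have n78 : s7.nat 8 = n := by
    rw [n7]; norm_num; rw [sim6.nat 0, F6.nat 0 rfl, c5.eq_n]
  have m8 := moveLoop_spec (c := 8) (r := 3) (a := 4) (b := D + 6) (m := n) (s := s7) n78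
    (by simp [n7]) (by simp [n7, sim6.base]) (by simp [n7])
    (by rw [n7]; norm_num; rw [sim6.nat 3, F6.nat 3 rfl, c5.eq_one])
    (by
      rw [n77, r7]
      -- Array 0 is never written, so its first entry, cell D, is still the zero used for copying.
      have h1 := sim6.arr 0 0
      rw [F6.arr 0 rfl] at h1
      simp only [hk5] at h1
      simp only [mul_zero, add_zero, Fin.val_zero] at h1
      rw [h1, o5 _ fun j _ => by omega, hreal _ le_rfl])
    (fun j => j) (fun j => D + 6 + 16 * j) (fun _ _ h _ => h) (fun _ _ _ h => h)
    (fun x y h => h) (fun j hj => by rw [n77]; omega) (fun i hi j _ => by omega)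
  obtain ⟨-, p8, -⟩ := m8
  have st8 := moveLoop_steps 8 3 4 s7
  rw [n78] at st8
  have hsteps : roundingProgram.steps s = 3 + (Cmd.setup.compile.steps s1 + (2 + (4 +
      ((1 + D * 4) + (Cmd.search.compile.steps s5 + (4 + (1 + n * 4))))))) := by
    simp only [roundingProgram, steps_seq]
    rw [← hs1, ← hs2, ← hs3, ← hs4, ← hs5, ← hs6, ← hs7, st5, st8, inputCounters_steps,
      arrayStart_steps, moveInit_steps, moveInit_steps]
  have hrun : roundingProgram.run s = (moveLoop 8 3 4).run s7 := by
    simp only [roundingProgram, run_seq]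
    rw [← hs1, ← hs2, ← hs3, ← hs4, ← hs5, ← hs6, ← hs7]
  refine ⟨?_, Cmd.search.run k5, best, fun i hi => ?_⟩
  · rw [hsteps]
    have e : n ^ ((3 * K₁ + 3 * K₂ + 9) * q) = (n ^ q) ^ (3 * K₁ + 3 * K₂ + 9) := by
      rw [← pow_mul, mul_comm]
    rw [e]
    exact steps_arith K₁ K₂ (n ^ q) _ _ D n (by omega) (st2.trans (hK₁ _)) (st6.trans (hK₂ _))
      hDL hnL
  · have h1 := p8 i hi
    rw [r7] at h1
    rw [← sim6.arr 6 i]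
    have : D + 16 * i + ((6 : Fin 16) : ℕ) = D + 6 + 16 * i := by
      change D + 16 * i + 6 = _
      ring
    rw [hrun, this, ← h1]

end RealRAM

/-! ### The polynomial of an input, and the approximation guarantee -/

namespace RealRAM

open MvPolynomial SoS

/-- The exponents of the monomial with a given list of variables. -/
noncomputable def tupleDegrees {n d : ℕ} (g : Fin d → Fin n) : Fin n →₀ ℕ :=
  ∑ j, Finsupp.single (g j) 1

lemma toMultiset_tupleDegrees {n d : ℕ} (g : Fin d → Fin n) :
    Finsupp.toMultiset (tupleDegrees g) = (List.ofFn g : Multiset (Fin n)) := by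
  rw [tupleDegrees, map_sum, ← Fin.univ_val_map]
  simp only [Finsupp.toMultiset_single, one_smul]
  rw [Finset.sum_eq_multiset_sum, ← Multiset.sum_map_singleton (Multiset.map g Finset.univ.val),
    Multiset.map_map]
  rfl

/-- The sorted list of the multiset of variables is its only non-decreasing enumeration. -/
lemma existsUnique_monotone_tuple {n d : ℕ} (m : Fin n →₀ ℕ) (hm : m.degree = d) :
    ∃! g : Fin d → Fin n, Monotone g ∧ tupleDegrees g = m := by
  set l := (Finsupp.toMultiset m).sort with hl
  have hlen : l.length = d := by rw [hl, Multiset.length_sort, Finsupp.card_toMultiset, ← hm]; rfl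
  have hsort : l.SortedLE := (Multiset.pairwise_sort _ _).sortedLE
  subst hlen
  refine ⟨l.get, ⟨?_, ?_⟩, ?_⟩
  · rw [← List.sortedLE_ofFn_iff, List.ofFn_get]
    exact hsort
  · apply Multiset.toFinsupp.symm.injective
    change Finsupp.toMultiset _ = Finsupp.toMultiset _
    rw [toMultiset_tupleDegrees, List.ofFn_get, hl, Multiset.sort_eq]
  · rintro g ⟨hg, hgm⟩
    apply List.ofFn_injective
    rw [List.ofFn_get]
    refine List.Perm.eq_of_sortedLE (List.sortedLE_ofFn_iff.2 hg) hsort ?_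
    rw [← Multiset.coe_eq_coe, ← toMultiset_tupleDegrees, hgm, hl, Multiset.sort_eq]

/-- The input repeats a coefficient for every ordering of its variables; the sorted ordering alone
counts it once. -/
lemma eq_sum_monotone {n d : ℕ} {f : MvPolynomial (Fin n) ℝ} (hf : f.IsHomogeneous d) :
    f = ∑ g : Fin d → Fin n, open Classical in
      monomial (tupleDegrees g) (if Monotone g then f.coeff (tupleDegrees g) else 0) := by
  classical
  ext m
  rw [coeff_sum]
  simp only [coeff_monomial]
  by_cases hm : m.degree = d
  · obtain ⟨g, ⟨hg, hgm⟩, huniq⟩ := existsUnique_monotone_tuple m hm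
    rw [Finset.sum_eq_single g]
    · simp [hg, hgm]
    · intro g' _ hne
      by_cases h1 : tupleDegrees g' = m
      · rw [if_pos h1, if_neg fun h2 => hne (huniq g' ⟨h2, h1⟩)]
      · rw [if_neg h1]
    · simp
  · rw [hf.coeff_eq_zero hm, Finset.sum_eq_zero]
    intro g _
    rw [if_neg]
    rintro rfl
    exact hm (by simp [tupleDegrees, map_sum])

variable {n d : ℕ}

/-- A digit as an index. -/
def digFin (hn : 0 < n) (a s : ℕ) : Fin n := ⟨dig n a s, Nat.mod_lt _ hn⟩

lemma finFunctionFinEquiv_symm_eq (hn : 0 < n) (a : Fin (n ^ d)) (j : Fin d) :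
    finFunctionFinEquiv.symm a j = digFin hn a j := by
  ext
  simp [finFunctionFinEquiv_symm_apply_val, digFin, dig]

lemma monotone_digits_iff (hn : 0 < n) (a : ℕ) :
    (∀ s < d - 1, dig n a s ≤ dig n a (s + 1)) ↔ Monotone fun j : Fin d => digFin hn a j := by
  constructor
  · intro H i j hij
    have key : ∀ k, (i : ℕ) ≤ k → k < d → dig n a i ≤ dig n a k := by
      intro k hik
      induction k, hik using Nat.le_induction with
      | base => intro _; exact le_rfl
      | succ k hk ih => intro hkd; exact (ih (by omega)).trans (H k (by omega))
    exact key j hij j.isLt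
  · intro H s hs
    exact H (show (⟨s, by omega⟩ : Fin d) ≤ ⟨s + 1, by omega⟩ from Nat.le_succ s)

/-- The exponents of the first two variables of a monomial. -/
def headDegrees (hn : 0 < n) (a : ℕ) (i : Fin n) : ℕ :=
  (if digFin hn a 0 = i then 1 else 0) + if digFin hn a 1 = i then 1 else 0

/-- The exponents of the other variables of a monomial. -/
def tailDegrees (n d : ℕ) (a : ℕ) (i : Fin n) : ℕ :=
  ∑ s ∈ Finset.range (d - 2), if dig n a (s + 2) = i then 1 else 0

/-- The coefficient of a monomial that is given by sorted digits. -/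
noncomputable def sortedCoeff (n d : ℕ) (C : ℕ → ℝ) (a : ℕ) : ℝ :=
  if ∀ s < d - 1, dig n a s ≤ dig n a (s + 1) then C a else 0

lemma sum_headDegrees (hn : 0 < n) (a : ℕ) : ∑ i, headDegrees hn a i = 2 := by
  simp [headDegrees, Finset.sum_add_distrib]

lemma dig_eq_iff (hn : 0 < n) (a s : ℕ) (i : Fin n) : dig n a s = i ↔ digFin hn a s = i := by
  rw [Fin.ext_iff]; rfl

lemma sum_tailDegrees (hn : 0 < n) (a : ℕ) : ∑ i, tailDegrees n d a i = d - 2 := by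
  simp only [tailDegrees, dig_eq_iff hn]
  rw [Finset.sum_comm]
  simp

lemma prod_pow_tailDegrees {R : Type*} [CommMonoid R] (hn : 0 < n) (W : Fin n → R) (a : ℕ) :
    ∏ i, W i ^ tailDegrees n d a i = ∏ s ∈ Finset.range (d - 2), W (digFin hn a (s + 2)) := by
  simp only [tailDegrees, ← Finset.prod_pow_eq_pow_sum, dig_eq_iff hn]
  rw [Finset.prod_comm]
  refine Finset.prod_congr rfl fun s _ => ?_
  simp [pow_ite]

lemma prod_pow_headDegrees {R : Type*} [CommMonoid R] (hn : 0 < n) (W : Fin n → R) (a : ℕ) :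
    ∏ i, W i ^ headDegrees hn a i = W (digFin hn a 0) * W (digFin hn a 1) := by
  simp only [headDegrees, pow_add, Finset.prod_mul_distrib]
  simp [pow_ite]

lemma xpow_headDegrees (hn : 0 < n) (a : ℕ) :
    xpow (headDegrees hn a) = X (digFin hn a 0) * X (digFin hn a 1) :=
  prod_pow_headDegrees hn _ a

lemma monomial_tupleDegrees (c : ℝ) (g : Fin d → Fin n) :
    monomial (tupleDegrees g) c = C c * ∏ j, X (g j) := by
  rw [tupleDegrees, monomial_sum_index]
  rfl

/-- The polynomial as a sum over all indices. -/
theorem eq_sum_sorted (hd : 2 ≤ d) (hn : 0 < n) (q : ℕ) {f : MvPolynomial (Fin n) ℝ}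
    (hf : f.IsHomogeneous d) :
    f = ∑ a : Fin (n ^ d), C (sortedCoeff n d (input d q f).real a) *
      (xpow (headDegrees hn a) * xpow (tailDegrees n d a)) := by
  classical
  conv_lhs => rw [eq_sum_monotone hf]
  rw [← finFunctionFinEquiv.symm.sum_comp]
  refine Finset.sum_congr rfl fun a _ => ?_
  rw [monomial_tupleDegrees]
  congr 1
  · congr 1
    rw [sortedCoeff]
    simp only [monotone_digits_iff hn]
    have e : (finFunctionFinEquiv.symm a : Fin d → Fin n) = fun j : Fin d => digFin hn a j :=
      funext fun j => finFunctionFinEquiv_symm_eq hn a j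
    simp only [input, a.isLt, dif_pos, e]
    split_ifs
    · rfl
    · rfl
  · rw [xpow_headDegrees, xpow, prod_pow_tailDegrees hn]
    simp_rw [finFunctionFinEquiv_symm_eq hn]
    obtain ⟨d, rfl⟩ := Nat.exists_eq_add_of_le' hd
    rw [Fin.prod_univ_eq_prod_range (fun j => (X (digFin hn a j) : MvPolynomial (Fin n) ℝ)) (d + 2),
      Finset.prod_range_succ', Finset.prod_range_succ']
    simp only [Nat.add_sub_cancel]
    ring

lemma entVal_eq (hn : 0 < n) (C W : ℕ → ℝ) (a : ℕ) : entVal n d C W a =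
    sortedCoeff n d C a * ∏ i : Fin n, W i ^ tailDegrees n d a i := by
  rw [prod_pow_tailDegrees hn (fun i : Fin n => W i), entVal, sortedCoeff]
  split_ifs
  · rfl
  · simp

lemma evalVal_eq (hn : 0 < n) (C X : ℕ → ℝ) : evalVal n d C X =
    ∑ a : Fin (n ^ d), sortedCoeff n d C a * (X (digFin hn a 0) * X (digFin hn a 1) *
      ∏ i : Fin n, X i ^ tailDegrees n d a i) := by
  rw [evalVal, Finset.sum_range]
  refine Finset.sum_congr rfl fun a _ => ?_
  rw [entVal_eq hn]
  simp only [digFin]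
  ring

lemma normVal_eq (v : ℕ → ℝ) : normVal n v = l2norm fun i : Fin n => v i := by
  rw [normVal, Finset.sum_range]; rfl

/-- The symmetric matrix of the quadratic form at `W`. -/
noncomputable def weightMatrix (hn : 0 < n) (d : ℕ) (C W : ℕ → ℝ) : Matrix (Fin n) (Fin n) ℝ :=
  edgeMatrix (fun a : Fin (n ^ d) => sortedCoeff n d C a * ∏ i : Fin n, W i ^ tailDegrees n d a i)
    (fun a => digFin hn a 0) fun a => digFin hn a 1

lemma mulVal_eq (hn : 0 < n) (C W Y : ℕ → ℝ) (i : Fin n) :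
    mulVal n d C W Y i = (weightMatrix hn d C W).mulVec (fun i => Y i) i := by
  rw [weightMatrix, edgeMatrix_mulVec, mulVal, Finset.sum_range]
  refine Finset.sum_congr rfl fun a _ => ?_
  rw [entVal_eq hn]
  simp only [dig_eq_iff hn]
  rfl

lemma iterVal_eq (hn : 0 < n) (C W : ℕ → ℝ) (t : ℕ) :
    (fun i : Fin n => iterVal n d C W t i) = powerIterate (weightMatrix hn d C W) t := by
  induction t with
  | zero => ext i; simp [iterVal, powerIterate]
  | succ t ih =>
    ext i
    rw [powerIterate_succ, ← ih, iterVal, mulVal_eq hn]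

lemma candVal_eq (hn : 0 < n) (q : ℕ) (C : ℕ → ℝ) (e t : ℕ) (i : Fin n) :
    candVal n d q C e t i = candidate (fun i : Fin n => weightVal n q e i)
      (powerIterate (weightMatrix hn d C (weightVal n q e)) t)
      (powerIterate (weightMatrix hn d C (weightVal n q e)) (t + 1)) i := by
  have h : ∀ i : Fin n, sumVal n d C (weightVal n q e) t i =
      candidateSum (fun i : Fin n => weightVal n q e i)
      (powerIterate (weightMatrix hn d C (weightVal n q e)) t)
      (powerIterate (weightMatrix hn d C (weightVal n q e)) (t + 1)) i := fun i => by
    rw [sumVal, normVal_eq, normVal_eq, candidateSum, ← iterVal_eq hn, ← iterVal_eq hn]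
  rw [candVal, candidate, normVal_eq, h]
  simp_rw [h]

lemma weightVal_pos (hn : 0 < n) (q e i : ℕ) : 0 < weightVal n q e i := by
  have : (0 : ℝ) < n := by exact_mod_cast hn
  unfold weightVal
  positivity

/-- By (a + b)² ≤ 2a² + 2b²: the q digits contribute 2, and the n summands 1/n contribute 2. -/
lemma sum_sq_weightVal_le (hn : 0 < n) {q : ℕ} (hq : 0 < q) (e : ℕ) :
    ∑ i : Fin n, weightVal n q e i ^ 2 ≤ 4 := by
  have hn0 : (0 : ℝ) < n := by exact_mod_cast hn
  have hq0 : (0 : ℝ) < q := by exact_mod_cast hq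
  have hcard : ∑ i : Fin n, (((Finset.range q).filter fun s => dig n e s = i).card : ℝ) = q := by
    rw [← Nat.cast_sum]
    simp only [dig_eq_iff hn, Finset.card_filter]
    rw [Finset.sum_comm]
    simp
  calc ∑ i : Fin n, weightVal n q e i ^ 2 ≤
      ∑ i : Fin n, (2 * ((((Finset.range q).filter fun s => dig n e s = i).card : ℝ) / q) +
        2 * (1 / n)) := by
        refine Finset.sum_le_sum fun i _ => ?_
        have h1 := Real.sq_sqrt
          (show 0 ≤ ((((Finset.range q).filter fun s => dig n e s = i).card : ℝ) / q) by positivity)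
        have h2 : (1 / √(n : ℝ)) ^ 2 = 1 / n := by
          rw [div_pow, Real.sq_sqrt hn0.le, one_pow]
        rw [← h1, ← h2, weightVal]
        nlinarith [sq_nonneg (√((((Finset.range q).filter fun s => dig n e s = i).card : ℝ) / q) -
          1 / √(n : ℝ))]
    _ = 4 := by
        rw [Finset.sum_add_distrib, ← Finset.mul_sum, ← Finset.sum_div, hcard]
        simp
        field_simp
        norm_num

/-- Since N ≤ q, there is room among the q digits for k_i copies of each i; the digits left over
only enlarge weights. -/
lemma exists_weight_ge (hn : 0 < n) {N q : ℕ} (hNq : N ≤ q) (k : Fin n → ℕ)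
    (hk : ∑ i, k i = N) : ∃ e < n ^ q, ∀ i : Fin n, √((k i : ℝ) / q) ≤ weightVal n q e i := by
  obtain ⟨φ⟩ : Nonempty ((Σ i, Fin (k i)) ↪ Fin q) := by
    rw [Function.Embedding.nonempty_iff_card_le]
    simpa [hk] using hNq
  set g : Fin q → Fin n := Function.extend φ Sigma.fst fun _ => ⟨0, hn⟩ with hg
  refine ⟨finFunctionFinEquiv g, (finFunctionFinEquiv g).isLt, fun i => ?_⟩
  have hdig : ∀ s : Fin q, digFin hn (finFunctionFinEquiv g : ℕ) s = g s := fun s => by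
    rw [← finFunctionFinEquiv_symm_eq, Equiv.symm_apply_apply]
  have hcard : k i ≤ ((Finset.range q).filter fun s =>
      dig n (finFunctionFinEquiv g : ℕ) s = i).card := by
    have := Finset.card_le_card_of_injOn (s := (Finset.univ : Finset (Fin (k i))))
      (t := (Finset.range q).filter fun s => dig n (finFunctionFinEquiv g : ℕ) s = i)
      (fun x => (φ ⟨i, x⟩ : ℕ)) (fun x _ => by
        have : digFin hn (finFunctionFinEquiv g : ℕ) (φ ⟨i, x⟩ : Fin q) = i := by
          rw [hdig, hg, φ.injective.extend_apply]
        rw [← dig_eq_iff] at this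
        exact Finset.mem_coe.2 (Finset.mem_filter.2 ⟨Finset.mem_range.2 (φ ⟨i, x⟩).isLt, this⟩))
        (fun x _ y _ hxy => by
        have := φ.injective (Fin.ext hxy)
        simpa using this)
    simpa using this
  unfold weightVal
  have h1 : √((k i : ℝ) / q) ≤ √((((Finset.range q).filter fun s =>
      dig n (finFunctionFinEquiv g : ℕ) s = i).card : ℝ) / q) := by
    apply Real.sqrt_le_sqrt
    gcongr
  have h2 : (0 : ℝ) ≤ 1 / √(n : ℝ) := by positivity
  linarith

section guarantee

variable {q : ℕ} {C : ℕ → ℝ}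

lemma sortedCoeff_nonneg (hC : ∀ a, 0 ≤ C a) (a : ℕ) : 0 ≤ sortedCoeff n d C a := by
  unfold sortedCoeff
  split_ifs
  exacts [hC a, le_rfl]

lemma weightMatrix_nonneg (hn : 0 < n) (hC : ∀ a, 0 ≤ C a) {W : ℕ → ℝ} (hW : ∀ i, 0 ≤ W i)
    (a b : Fin n) : 0 ≤ weightMatrix hn d C W a b :=
  edgeMatrix_nonneg (fun a : Fin (n ^ d) => sortedCoeff n d C a *
    ∏ i : Fin n, W i ^ tailDegrees n d a i) _ _ (fun _ => mul_nonneg (sortedCoeff_nonneg hC _)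
    (Finset.prod_nonneg fun i _ => pow_nonneg (hW i) _)) a b

lemma candVal_nonneg (hn : 0 < n) (hC : ∀ a, 0 ≤ C a) (e t : ℕ) (i : Fin n) :
    0 ≤ candVal n d q C e t i := by
  have hM := weightMatrix_nonneg (d := d) hn hC (W := weightVal n q e)
    fun i => (weightVal_pos hn q e i).le
  rw [candVal_eq hn]
  have h1 := powerIterate_nonneg hM t i
  have h2 := powerIterate_nonneg hM (t + 1) i
  have h3 := (weightVal_pos hn q e i).le
  have h4 := l2norm_nonneg (powerIterate (weightMatrix hn d C (weightVal n q e)) t)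
  have h5 := l2norm_nonneg (powerIterate (weightMatrix hn d C (weightVal n q e)) (t + 1))
  unfold candidate candidateSum
  exact div_nonneg (by positivity) (l2norm_nonneg _)

lemma testVal_nonneg (hn : 0 < n) (hC : ∀ a, 0 ≤ C a) (e t : ℕ) :
    0 ≤ Cmd.testVal n d q C e t := by
  rw [Cmd.testVal, evalVal_eq hn]
  have h := candVal_nonneg (d := d) (q := q) hn hC e t
  exact Finset.sum_nonneg fun a _ => mul_nonneg (sortedCoeff_nonneg hC _)
    (mul_nonneg (mul_nonneg (h _) (h _)) (Finset.prod_nonneg fun i _ => pow_nonneg (h i) _))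

lemma sum_sq_candVal (hn : 0 < n) (hC : ∀ a, 0 ≤ C a) (e t : ℕ) :
    ∑ i : Fin n, candVal n d q C e t i ^ 2 = 1 := by
  have hM := weightMatrix_nonneg (d := d) hn hC (W := weightVal n q e)
    fun i => (weightVal_pos hn q e i).le
  simp_rw [candVal_eq hn]
  exact sum_sq_candidate _ _ _ ⟨⟨0, hn⟩, weightVal_pos hn q e 0⟩ (powerIterate_nonneg hM t)
    (powerIterate_nonneg hM (t + 1))

/-- The test point of round t bounds the t-th ratio of iterates by 4^d b; power iteration adds the
factor 2. -/
lemma abs_eigenvalue_weightMatrix_le (hn : 0 < n) (hd : 2 ≤ d) (hq : 0 < q)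
    (hC : ∀ a, 0 ≤ C a) {e : ℕ} {b : ℝ} (hb : ∀ t < n, Cmd.testVal n d q C e t ≤ b) {x : ℝ}
    {v : Fin n → ℝ} (hv : (weightMatrix hn d C (weightVal n q e)).mulVec v = x • v)
    (hv0 : v ≠ 0) : |x| ≤ 2 * (4 ^ d * b) := by
  have hb0 : 0 ≤ b := (testVal_nonneg hn hC e 0).trans (hb 0 hn)
  have hM := weightMatrix_nonneg (d := d) hn hC (W := weightVal n q e)
    fun i => (weightVal_pos hn q e i).le
  refine abs_eigenvalue_le hM (by positivity) (fun t ht => ?_) hv hv0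
  have h := l2norm_mulVec_le (fun a : Fin (n ^ d) => sortedCoeff n d C a)
    (fun a => sortedCoeff_nonneg hC a) (fun a => digFin hn a 0) (fun a => digFin hn a 1)
    (fun a => tailDegrees n d a) (fun a => sum_tailDegrees hn a)
    (w := fun i : Fin n => weightVal n q e i) (fun i => weightVal_pos hn q e i)
    (sum_sq_weightVal_le hn hq e) (powerIterate_nonneg hM t)
    (powerIterate_succ (weightMatrix hn d C (weightVal n q e)) t)
  have e1 := hb t ht
  rw [Cmd.testVal, evalVal_eq hn] at e1
  simp_rw [candVal_eq hn] at e1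
  rw [Nat.sub_add_cancel hd] at h
  refine h.trans ?_
  have := l2norm_nonneg (powerIterate (weightMatrix hn d C (weightVal n q e)) t)
  gcongr

end guarantee

end RealRAM

/-! ### Feasible points, the sphere norm and the passage to the m-th root. -/

namespace SoS

open MvPolynomial

/-- A non-negative unit vector satisfies all constraints, so evaluation there is feasible in every
degree. -/
lemma isPseudoExpectation_eval {n m q : ℕ} (v : Fin n → ℝ) (hv : ∀ i, 0 ≤ v i)
    (hv1 : ∑ i, v i ^ 2 = 1) :
    IsPseudoExpectation (sphereMonomialSystem n m) q (aeval v).toLinearMap where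
  map_one := by simp
  sq_nonneg p _ := by simp [sq_nonneg]
  eq_zero g hg p _ := by
    rw [Set.mem_singleton_iff.1 hg]
    simp [hv1]
  ineq_nonneg g hg p _ := by
    obtain ⟨β, -, rfl⟩ := hg
    have : 0 ≤ aeval v (monomial β (1 : ℝ)) := by
      rw [aeval_monomial]
      simp only [map_one, one_mul]
      exact Finset.prod_nonneg fun i _ => pow_nonneg (hv i) _
    simpa using mul_nonneg (sq_nonneg (aeval v p)) this

lemma abs_eval_le_sphereNorm {n : ℕ} (f : MvPolynomial (Fin n) ℝ)
    (x : EuclideanSpace ℝ (Fin n)) (hx : ‖x‖ = 1) :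
    |eval (fun i => x i) f| ≤ sphereNorm f := by
  have hc : Continuous fun y : Metric.sphere (0 : EuclideanSpace ℝ (Fin n)) 1 =>
      |eval (fun i => (y : EuclideanSpace ℝ (Fin n)) i) f| :=
    ((MvPolynomial.continuous_eval f).comp (by fun_prop)).abs
  exact le_ciSup (f := fun y : Metric.sphere (0 : EuclideanSpace ℝ (Fin n)) 1 =>
    |eval (fun i => (y : EuclideanSpace ℝ (Fin n)) i) f|) (isCompact_range hc).bddAbove
    ⟨x, by simpa using hx⟩

/-- Since d/q = 1/m and N/m = (d-2)/2, the root produces 36^((d-2)/2) · 4^d ≤ 8^d · 4^d = 2^(5d) and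
the power (n/q)^((d-2)/4). -/
lemma rpow_bound {n d m N q : ℕ} (hd : 2 ≤ d) (hm : 0 < m) (hq : q = m * d) (hqn : q ≤ n)
    (hN : 2 * N = m * (d - 2)) {b V : ℝ} (hb : 0 ≤ b) (hV : 0 ≤ V)
    (hVb : V ≤ (36 * √((n : ℝ) / q)) ^ N * (4 ^ d * b) ^ m) {K : ℕ} (hK : 5 ≤ K) :
    V ^ ((d : ℝ) / q) ≤ 2 ^ (K * d) * ((n : ℝ) / q) ^ ((d : ℝ) / 4 - 1 / 2) * b := by
  have hd0 : (0 : ℝ) < d := by exact_mod_cast (by omega : 0 < d)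
  have hm0 : (0 : ℝ) < m := by exact_mod_cast hm
  have hq0 : (0 : ℝ) < q := by rw [hq]; push_cast; positivity
  set z : ℝ := (n : ℝ) / q with hz
  have hz1 : 1 ≤ z := by rw [hz, one_le_div hq0]; exact_mod_cast hqn
  have hz0 : 0 < z := by linarith
  have hdq : (d : ℝ) / q = 1 / m := by
    rw [hq]; push_cast; field_simp
  have hNm : (N : ℝ) * (1 / m) = ((d : ℝ) - 2) / 2 := by
    have : (2 : ℝ) * N = m * (d - 2) := by
      have := congrArg (Nat.cast (R := ℝ)) hN
      push_cast [Nat.cast_sub hd] at this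
      exact this
    field_simp
    linarith
  have h1 : V ^ ((d : ℝ) / q) ≤ ((36 * √z) ^ N * (4 ^ d * b) ^ m) ^ ((1 : ℝ) / m) := by
    rw [hdq]
    exact Real.rpow_le_rpow hV hVb (by positivity)
  have h2 : ((36 * √z) ^ N * (4 ^ d * b) ^ m) ^ ((1 : ℝ) / m) =
      (36 : ℝ) ^ (((d : ℝ) - 2) / 2) * z ^ ((d : ℝ) / 4 - 1 / 2) * (4 ^ d * b) := by
    rw [Real.mul_rpow (by positivity) (by positivity), ← Real.rpow_natCast (36 * √z) N,
      ← Real.rpow_mul (by positivity), hNm, ← Real.rpow_natCast (4 ^ d * b) m,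
      ← Real.rpow_mul (by positivity), mul_one_div_cancel hm0.ne', Real.rpow_one,
      Real.mul_rpow (by norm_num) (Real.sqrt_nonneg _), Real.sqrt_eq_rpow,
      ← Real.rpow_mul hz0.le]
    congr 3
    ring
  have h3 : (36 : ℝ) ^ (((d : ℝ) - 2) / 2) ≤ 8 ^ d := by
    calc (36 : ℝ) ^ (((d : ℝ) - 2) / 2) ≤ (64 : ℝ) ^ (((d : ℝ) - 2) / 2) := by
          apply Real.rpow_le_rpow (by norm_num) (by norm_num)
          have : (2 : ℝ) ≤ d := by exact_mod_cast hd
          linarith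
      _ ≤ (64 : ℝ) ^ ((d : ℝ) / 2) :=
          Real.rpow_le_rpow_of_exponent_le (by norm_num) (by linarith)
      _ = 8 ^ d := by
          rw [show (64 : ℝ) = 8 ^ (2 : ℝ) by norm_num, ← Real.rpow_mul (by norm_num),
            mul_div_cancel₀ _ (by norm_num), Real.rpow_natCast]
  have h4 : (8 : ℝ) ^ d * 4 ^ d ≤ 2 ^ (K * d) := by
    calc (8 : ℝ) ^ d * 4 ^ d = 2 ^ (5 * d) := by
          rw [← mul_pow, pow_mul]; norm_num
      _ ≤ 2 ^ (K * d) := pow_le_pow_right₀ (by norm_num) (Nat.mul_le_mul_right _ hK)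
  have hzp : 0 ≤ z ^ ((d : ℝ) / 4 - 1 / 2) := by positivity
  calc V ^ ((d : ℝ) / q) ≤ _ := h1
    _ = (36 : ℝ) ^ (((d : ℝ) - 2) / 2) * z ^ ((d : ℝ) / 4 - 1 / 2) * (4 ^ d * b) := h2
    _ ≤ 8 ^ d * z ^ ((d : ℝ) / 4 - 1 / 2) * (4 ^ d * b) := by gcongr
    _ = (8 ^ d * 4 ^ d) * z ^ ((d : ℝ) / 4 - 1 / 2) * b := by ring
    _ ≤ _ := by gcongr

end SoS

/-! ### Assembly of the approximation bound and the main theorem. -/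

namespace RealRAM

open MvPolynomial SoS

/-- Every pseudo-expectation of the power is bounded by the best value at the test points. -/
theorem pseudoExpectation_le {n d k : ℕ} {f : MvPolynomial (Fin n) ℝ} (hd : 2 ≤ d) (hk : 0 < k)
    (hqn : 2 * d * k ≤ n) (hf : f.IsHomogeneous d) (hf0 : ∀ m, 0 ≤ f.coeff m) {b : ℝ}
    (hb : ∀ e t, e < n ^ (2 * d * k) ∧ t < n →
      Cmd.testVal n d (2 * d * k) (input d (2 * d * k) f).real e t ≤ b)
    {E : MvPolynomial (Fin n) ℝ →ₗ[ℝ] ℝ}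
    (hE : IsPseudoExpectation (sphereMonomialSystem n (2 * (2 * k))) (2 * d * k) E) :
    E (f ^ (2 * k)) ≤
      (36 * √((n : ℝ) / (2 * d * k : ℕ))) ^ ((d - 2) * k) * (4 ^ d * b) ^ (2 * k) := by
  obtain ⟨d, rfl⟩ := Nat.exists_eq_add_of_le' hd
  have hq : 0 < 2 * (d + 2) * k := by positivity
  have hn : 0 < n := hq.trans_le hqn
  set q := 2 * (d + 2) * k with hq'
  set Cf := (input (d + 2) q f).real with hCf
  have hC : ∀ a, 0 ≤ Cf a := fun a => by
    simp only [hCf, input]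
    split_ifs
    exacts [hf0 _, le_rfl]
  have hN : 2 * (d * k) + 2 * (2 * k) = q := by rw [hq']; ring
  -- Weights are needed for all κ, but only those of degree N = d k matter; others get the junk
  -- tuple 0. From here on `d` is the degree minus two.
  have hex : ∀ κ : Fin n → ℕ, ∃ e, ∑ i, κ i = d * k →
      e < n ^ q ∧ ∀ i : Fin n, √((κ i : ℝ) / q) ≤ weightVal n q e i := fun κ => by
    by_cases hκ : ∑ i, κ i = d * k
    · obtain ⟨e, he⟩ := exists_weight_ge hn (q := q) (by omega) κ hκ
      exact ⟨e, fun _ => he⟩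
    · exact ⟨0, fun h => absurd h hκ⟩
  choose e he using hex
  have hrepr := eq_sum_sorted hd hn q hf
  conv_lhs => rw [hrepr]
  refine hE.pow_le (N := d * k) hN hq hqn ?_ (fun a : Fin (n ^ (d + 2)) => sortedCoeff n (d + 2) Cf a)
    (fun a => sortedCoeff_nonneg hC a) (fun a => headDegrees hn a)
    (fun a => tailDegrees n (d + 2) a) d (fun a => sum_headDegrees hn a)
    (fun a => sum_tailDegrees hn a) (by ring) (fun κ i => weightVal n q (e κ) i)
    (fun κ hκ i => (he κ (by simpa using hκ)).2 i) (fun κ _ i => ?_)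
    (fun κ => (1 / 2 : ℝ) • weightMatrix hn (d + 2) Cf (weightVal n q (e κ))) (fun κ => ?_)
    (fun κ => ?_) (fun κ hκ x v hv hv0 => ?_)
  -- Either N = 0, or d ≥ 1 and 2(d + 2)k ≤ 6dk.
  · rcases Nat.eq_zero_or_pos d with h | h
    · left; simp [h]
    · right; rw [hq']; nlinarith
  · have : 0 ≤ √((((Finset.range q).filter fun s => dig n (e κ) s = i).card : ℝ) / q) :=
      Real.sqrt_nonneg _
    unfold weightVal
    linarith
  · exact (edgeMatrix_isHermitian _ _ _).smul (by simp)
  · simp only [weightMatrix]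
    rw [quadPoly_half_edgeMatrix]
    simp only [xpow_headDegrees]
  · have h1 := he κ (by simpa using hκ)
    -- `weightMatrix` represents twice the form; doubling the eigenvalue cancels the factor 2 of
    -- power iteration.
    have h2 : (weightMatrix hn (d + 2) Cf (weightVal n q (e κ))).mulVec v = (2 * x) • v := by
      rw [mul_smul, ← hv, Matrix.smul_mulVec, smul_smul]
      norm_num
    have h3 := abs_eigenvalue_weightMatrix_le hn hd hq hC (fun t ht => hb (e κ) t ⟨h1.1, ht⟩) h2 hv0
    rw [abs_mul, abs_two] at h3
    linarith

end RealRAM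

theorem mainTheorem6 :
    ∃ (K : ℕ) (P : RealRAM.Program),
      ∀ (n d q : ℕ) (f : MvPolynomial (Fin n) ℝ),
        2 ≤ d → 0 < q → 2 * d ∣ q → q ≤ n →
        f.IsHomogeneous d → (∀ m, 0 ≤ f.coeff m) →
        -- the relaxation is feasible and bounded
        (SoS.pseudoValues (SoS.sphereMonomialSystem n (2 * q / d)) q (f ^ (q / d))).Nonempty ∧
        BddAbove (SoS.pseudoValues (SoS.sphereMonomialSystem n (2 * q / d)) q (f ^ (q / d))) ∧
        -- the approximation bound
        SoS.sosValue (SoS.sphereMonomialSystem n (2 * q / d)) q (f ^ (q / d)) ^ ((d : ℝ) / q) ≤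
          (2 : ℝ) ^ (K * d) * ((n : ℝ) / q) ^ ((d : ℝ) / 4 - 1 / 2) * SoS.sphereNorm f ∧
        -- the rounding algorithm
        P.steps (RealRAM.input d q f) ≤ n ^ (K * q) ∧
        ‖RealRAM.output n (P.run (RealRAM.input d q f))‖ = 1 ∧
        SoS.sosValue (SoS.sphereMonomialSystem n (2 * q / d)) q (f ^ (q / d)) ^ ((d : ℝ) / q) ≤
          (2 : ℝ) ^ (K * d) * ((n : ℝ) / q) ^ ((d : ℝ) / 4 - 1 / 2) *
            MvPolynomial.eval
              (fun i => RealRAM.output n (P.run (RealRAM.input d q f)) i) f := by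
  obtain ⟨K, hK⟩ := RealRAM.roundingProgram_spec
  refine ⟨K + 5, RealRAM.roundingProgram, fun n d q f hd hq hdvd hqn hf hf0 => ?_⟩
  obtain ⟨k, rfl⟩ := hdvd
  have hk : 0 < k := Nat.pos_of_mul_pos_left hq
  have hn : 0 < n := hq.trans_le hqn
  have hdq : d ≤ 2 * d * k := by nlinarith
  have hd0 : 0 < d := by omega
  have e1 : 2 * (2 * d * k) / d = 2 * (2 * k) := by
    rw [show 2 * (2 * d * k) = d * (2 * (2 * k)) by ring, Nat.mul_div_cancel_left _ hd0]
  have e2 : 2 * d * k / d = 2 * k := by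
    rw [show 2 * d * k = d * (2 * k) by ring, Nat.mul_div_cancel_left _ hd0]
  rw [e1, e2]
  set s := RealRAM.input d (2 * d * k) f with hs
  have hC : ∀ a, 0 ≤ s.real a := fun a => by
    simp only [hs, RealRAM.input]
    split_ifs
    exacts [hf0 _, le_rfl]
  obtain ⟨hsteps, h, hbest, hout⟩ := hK n d (2 * d * k) s hd hdq hqn (fun _ => rfl)
    fun a ha => by simp only [hs, RealRAM.input]; rw [dif_neg (by omega)]
  set b := h.arr 12 0 with hb
  have hb0 : 0 ≤ b := (RealRAM.testVal_nonneg hn hC 0 0).trans (hbest.le 0 0 ⟨by positivity, hn⟩)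
  -- The sentinel -1 is excluded by b ≥ 0, so the output is a genuine test point.
  obtain ⟨e, t, hcand, hval⟩ := hbest.mem.resolve_left (by rw [← hb]; linarith)
  set x := RealRAM.output n (RealRAM.roundingProgram.run s) with hx
  have hxi : ∀ i : Fin n, x i = RealRAM.candVal n d (2 * d * k) s.real e t i := fun i => by
    rw [← hcand i i.isLt, ← hout i i.isLt]; rfl
  have hx1 : ‖x‖ = 1 := by
    rw [EuclideanSpace.norm_eq]
    simp_rw [hxi, Real.norm_eq_abs, sq_abs]
    rw [RealRAM.sum_sq_candVal hn hC, Real.sqrt_one]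
  have hfx : MvPolynomial.eval (fun i => x i) f = b := by
    rw [hb, hval, RealRAM.Cmd.testVal, RealRAM.evalVal_eq hn]
    conv_lhs => rw [RealRAM.eq_sum_sorted hd hn (2 * d * k) hf]
    rw [map_sum]
    refine Finset.sum_congr rfl fun a _ => ?_
    rw [map_mul, map_mul, MvPolynomial.eval_C, RealRAM.xpow_headDegrees, SoS.xpow, map_prod]
    simp [hxi, ← hs]
  have hupper : ∀ v ∈ SoS.pseudoValues (SoS.sphereMonomialSystem n (2 * (2 * k))) (2 * d * k)
      (f ^ (2 * k)), v ≤ (36 * √((n : ℝ) / (2 * d * k : ℕ))) ^ ((d - 2) * k) *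
        (4 ^ d * b) ^ (2 * k) := by
    rintro v ⟨E, hE, rfl⟩
    exact RealRAM.pseudoExpectation_le hd hk hqn hf hf0 hbest.le hE
  -- Evaluation at the output is feasible. This gives non-emptiness, and also that the relaxation
  -- value is non-negative, as monotonicity of the real power requires.
  have hmem : (MvPolynomial.eval (fun i => x i) f) ^ (2 * k) ∈
      SoS.pseudoValues (SoS.sphereMonomialSystem n (2 * (2 * k))) (2 * d * k) (f ^ (2 * k)) :=
    ⟨_, SoS.isPseudoExpectation_eval (fun i => x i)
      (fun i => by rw [hxi]; exact RealRAM.candVal_nonneg hn hC e t i)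
      (by simp_rw [hxi]; exact RealRAM.sum_sq_candVal hn hC e t), by simp [MvPolynomial.aeval_eq_eval]⟩
  have hbdd : BddAbove (SoS.pseudoValues (SoS.sphereMonomialSystem n (2 * (2 * k))) (2 * d * k)
      (f ^ (2 * k))) := ⟨_, hupper⟩
  have hV0 : 0 ≤ SoS.sosValue (SoS.sphereMonomialSystem n (2 * (2 * k))) (2 * d * k) (f ^ (2 * k)) :=
    le_trans (by rw [hfx]; positivity) (le_csSup hbdd hmem)
  have hmain := SoS.rpow_bound (K := K + 5) hd (show 0 < 2 * k by omega)
    (show 2 * d * k = 2 * k * d by ring) hqn (show 2 * ((d - 2) * k) = 2 * k * (d - 2) by ring)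
    hb0 hV0 (csSup_le ⟨_, hmem⟩ hupper) (by omega)
  -- `hmain` is the bound with b = f(x); the bound by the sphere norm follows from f(x) ≤ ‖f‖₂.
  refine ⟨⟨_, hmem⟩, hbdd, hmain.trans ?_, ?_, hx1, by rw [hfx]; exact hmain⟩
  · refine mul_le_mul_of_nonneg_left ?_ (by positivity)
    rw [← hfx]
    exact (le_abs_self _).trans (SoS.abs_eval_le_sphereNorm f x hx1)
  · exact hsteps.trans (Nat.pow_le_pow_right hn (Nat.mul_le_mul_right _ (by omega)))
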